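/- **Notation.** For $n\in\mathbf N$ and $s,t,h>0$ let $\|f\|_{s,t,h}=\sup_{\alpha,\beta\in\mathbf N^n}\sup_{x\in\mathbf R^n}\frac{|x^\beta\partial^\alpha f(x)|}{h^{|\alpha|+|\beta|}\,\alpha!^s\,\beta!^t}$ for $f\in C^\infty(\mathbf R^n)$. The Gelfand–Shilov space $\mathcal S_s(\mathbf R^n)$ (respectively $\Sigma_s(\mathbf R^n)$) consists of all $f\in C^\infty(\mathbf R^n)$ with $\|f\|_{s,s,h}<\infty$ for some (respectively every) $h>0$. The space $\mathcal S_s'(\mathbf R^n)$ consists of the linear functionals $u$ on $\mathcal S_s(\mathbf R^n)$ such that for every $h>0$ there is $C$ with $|u(f)|\le C\|f\|_{s,s,h}$ whenever $\|f\|_{s,s,h}<\infty$; the space $\Sigma_s'(\mathbf R^n)$ consists of the linear functionals $u$ on $\Sigma_s(\mathbf R^n)$ with $|u(f)|\le C\|f\|_{s,s,h}$ for some $C,h>0$ and all $f$. For $s>\frac12$ we have $\mathcal S_{1/2}\subseteq\Sigma_s$, and $\Sigma_s'$ is regarded as a subspace of $\mathcal S_{1/2}'$ by restriction. A function $a$ is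 identified with the distribution $f\mapsto\int a f\,dx$. For $\phi\in\mathcal S_{1/2}(\mathbf R^n)$ and $u\in\mathcal S_{1/2}'(\mathbf R^n)$, or $\phi\in\Sigma_s(\mathbf R^n)$ and $u\in\Sigma_s'(\mathbf R^n)$, the short-time Fourier transform is $V_\phi u(x,\xi)=(2\pi)^{-n/2}\big(u,\phi(\cdot-x)e^{i\langle\cdot,\xi\rangle}\big)$, with $(\cdot,\cdot)$ the extension of the $L^2$ form, conjugate linear in the second argument. For $p,q\in[1,\infty]$ put $\|F\|_{L^{p,q}}=\big(\int(\int|F(x,\xi)|^p\,dx)^{q/p}\,d\xi\big)^{1/q}$ (essential suprema when an exponent is $\infty$), and for a weight $\vartheta$ on $\mathbf R^n\times\mathbf R^n$ let $M^{p,q}_{(\vartheta)}(\mathbf R^n)$ be the set of $u\in\mathcal S_{1/2}'(\mathbf R^n)$ with $\|\vartheta\, V_{\phi_0}u\|_{L^{p,q}}<\infty$, $\phi_0(x)=\pi^{-n/4}e^{-|x|^2/2}$; $M^\infty_{(\vartheta)}=M^{\infty,\infty}_{(\vartheta)}$. The class $\mathscr P_s(\mathbf R^n)$ consists of all $\omega\in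 L^\infty_{\rm loc}(\mathbf R^n)$ with $\omega>0$ everywhere such that, for some $c,C>0$, $\omega(x+y)\le C\omega(x)e^{c|y|^{1/s}}$ for all $x,y$. For $\omega\in\mathscr P_s(\mathbf R^{n})$, $S^{(\omega)}_s(\mathbf R^{n})$ consists of all $a\in C^\infty(\mathbf R^{n})$ such that for every $\varepsilon>0$ there is $C$ with $|\partial^\alpha a(X)|\le C\omega(X)\varepsilon^{|\alpha|}\alpha!^s$ for all $\alpha$ and $X$. A Gaussian is a function $\phi(X)=c\,e^{-\langle A(X-X_0),X-X_0\rangle}$ with $c\in\mathbf C\setminus\{0\}$ and $A$ real, symmetric and positive definite. **Statement.** Let $s>\frac12$ and $\omega\in\mathscr P_s(\mathbf R^{2d})$. Then every function in $S_s^{(\omega)}(\mathbf R^{2d})$ defines an element of $\mathcal S_{1/2}'(\mathbf R^{2d})$, and the following holds. (A) Let $\phi$ be a Gaussian on $\mathbf R^{2d}$ and $a\in\mathcal S'_{1/2}(\mathbf R^{2d})$. The following conditions are equivalent: 1. $a\in S_s^{(\omega)}(\mathbf R^{2d})$; 2. $a\in\Sigma_1'(\mathbf R^{2d})$, the function $X\mapsto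 e^{i\langle X,\Xi\rangle}V_\phi a(X,\Xi)$ is smooth for every $\Xi$, and for all $\varepsilon,R>0$ there is $C$ such that $$\big|\partial_X^\alpha\big(e^{i\langle X,\Xi\rangle}V_\phi a(X,\Xi)\big)\big|\le C\,\omega(X)\,\varepsilon^{|\alpha|}\,\alpha!^s\,e^{-R|\Xi|^{1/s}}\qquad\text{for all }\alpha\in\mathbf N^{2d},\ X,\Xi\in\mathbf R^{2d};$$ 3. $a\in\Sigma_1'(\mathbf R^{2d})$, and for every $R>0$ there is $C$ such that $\big|e^{i\langle X,\Xi\rangle}V_\phi a(X,\Xi)\big|\le C\,\omega(X)\,e^{-R|\Xi|^{1/s}}$ for all $X,\Xi\in\mathbf R^{2d}$. (B) With $\omega_R(x,\xi,\eta,y)=\omega(x,\xi)\,e^{-R(|y|^{1/s}+|\eta|^{1/s})}$, $x,\xi,\eta,y\in\mathbf R^d$, $$S_s^{(\omega)}(\mathbf R^{2d})=\bigcap_{R>0}M^\infty_{(1/\omega_R)}(\mathbf R^{2d})=\bigcap_{R>0}M^{\infty,1}_{(1/\omega_R)}(\mathbf R^{2d}).$$ Moreover, for every $q\in[1,\infty]$,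 $$S_s^{(\omega)}(\mathbf R^{2d})=\bigcap_{R>0}\{a\in\Sigma_s'(\mathbf R^{2d}):\|\omega_R^{-1}V_\phi a\|_{L^{\infty,q}}<\infty\}\quad\text{for every }\phi\in\Sigma_s(\mathbf R^{2d})\setminus\{0\},$$ $$S_s^{(\omega)}(\mathbf R^{2d})=\bigcap_{R>0}\{a\in\mathcal S_{1/2}'(\mathbf R^{2d}):\|\omega_R^{-1}V_\phi a\|_{L^{\infty,q}}<\infty\}\quad\text{for every }\phi\in\mathcal S_{1/2}(\mathbf R^{2d})\setminus\{0\}.$$ -/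

import Mathlib

open MeasureTheory Complex
open scoped ENNReal NNReal

noncomputable section

/-- The Euclidean space `ℝⁿ`. -/
abbrev RSpace (n : ℕ) : Type := EuclideanSpace ℝ (Fin n)

/-- `|α| = α₁ + ⋯ + αₙ`. -/
def multiOrder {n : ℕ} (α : Fin n → ℕ) : ℕ := ∑ i, α i

/-- `α! = α₁! ⋯ αₙ!`, as a real number. -/
def multiFactorial {n : ℕ} (α : Fin n → ℕ) : ℝ := ∏ i, ((α i).factorial : ℝ)

/-- `x^β = x₁^β₁ ⋯ xₙ^βₙ`. -/
def multiPow {n : ℕ} (x : RSpace n) (β : Fin n → ℕ) : ℝ := ∏ i, x i ^ β i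

/-- The partial derivative `∂^α f (x)` of a smooth function `f`: the derivative of order `|α|` of `f`
at `x`, evaluated at the list of standard basis vectors in which `eᵢ` occurs `αᵢ` times
(`finSigmaFinEquiv` enumerates the pairs `(i, j)`, `j < αᵢ`, by the numbers below `∑ i, αᵢ`). -/
def partialD {n : ℕ} (α : Fin n → ℕ) (f : RSpace n → ℂ) (x : RSpace n) : ℂ :=
  iteratedFDeriv ℝ (∑ i, α i) f x
    (fun k => EuclideanSpace.single (finSigmaFinEquiv.symm k).1 (1 : ℝ))

/-! ### Gelfand-Shilov spaces and their duals -/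

/-- The norm `sup_{α, β, x} |x^β ∂^α f(x)| / (h^{|α|+|β|} α!^s β!^t)`, with values in `[0, ∞]`. -/
def gsNorm {n : ℕ} (s t h : ℝ) (f : RSpace n → ℂ) : ℝ≥0∞ :=
  ⨆ (α : Fin n → ℕ) (β : Fin n → ℕ) (x : RSpace n),
    ENNReal.ofReal (|multiPow x β| * ‖partialD α f x‖ /
      (h ^ (multiOrder α + multiOrder β) * multiFactorial α ^ s * multiFactorial β ^ t))

lemma multiFactorial_pos {n : ℕ} (α : Fin n → ℕ) : 0 < multiFactorial α :=
  Finset.prod_pos fun i _ => by exact_mod_cast Nat.factorial_pos _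

lemma partialD_add {n : ℕ} {f g : RSpace n → ℂ} (hf : ContDiff ℝ (⊤ : ℕ∞) f) (hg : ContDiff ℝ (⊤ : ℕ∞) g)
    (α : Fin n → ℕ) (x : RSpace n) :
    partialD α (f + g) x = partialD α f x + partialD α g x := by
  unfold partialD
  rw [iteratedFDeriv_add_apply
    ((hf.of_le (by exact_mod_cast le_top)).contDiffAt)
    ((hg.of_le (by exact_mod_cast le_top)).contDiffAt)]
  rfl

lemma partialD_smul {n : ℕ} (c : ℂ) {f : RSpace n → ℂ} (hf : ContDiff ℝ (⊤ : ℕ∞) f)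
    (α : Fin n → ℕ) (x : RSpace n) :
    partialD α (c • f) x = c * partialD α f x := by
  unfold partialD
  rw [iteratedFDeriv_const_smul_apply
    ((hf.of_le (by exact_mod_cast le_top)).contDiffAt)]
  rfl

lemma gsNorm_add_le {n : ℕ} {s t h : ℝ} (hh : 0 < h) {f g : RSpace n → ℂ}
    (hf : ContDiff ℝ (⊤ : ℕ∞) f) (hg : ContDiff ℝ (⊤ : ℕ∞) g) :
    gsNorm s t h (f + g) ≤ gsNorm s t h f + gsNorm s t h g := by
  refine iSup_le fun α => iSup_le fun β => iSup_le fun x => ?_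
  have hD : 0 < h ^ (multiOrder α + multiOrder β) * multiFactorial α ^ s *
      multiFactorial β ^ t := by
    have h1 := Real.rpow_pos_of_pos (multiFactorial_pos α) s
    have h2 := Real.rpow_pos_of_pos (multiFactorial_pos β) t
    positivity
  have key : |multiPow x β| * ‖partialD α (f + g) x‖ /
      (h ^ (multiOrder α + multiOrder β) * multiFactorial α ^ s * multiFactorial β ^ t) ≤
      |multiPow x β| * ‖partialD α f x‖ /
      (h ^ (multiOrder α + multiOrder β) * multiFactorial α ^ s * multiFactorial β ^ t) +
      |multiPow x β| * ‖partialD α g x‖ /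
      (h ^ (multiOrder α + multiOrder β) * multiFactorial α ^ s * multiFactorial β ^ t) := by
    rw [partialD_add hf hg, ← add_div, ← mul_add]
    gcongr
    exact norm_add_le _ _
  refine (ENNReal.ofReal_le_ofReal key).trans (ENNReal.ofReal_add_le.trans ?_)
  unfold gsNorm
  exact add_le_add
    (le_iSup_of_le α (le_iSup_of_le β (le_iSup_of_le x le_rfl)))
    (le_iSup_of_le α (le_iSup_of_le β (le_iSup_of_le x le_rfl)))

lemma gsNorm_smul_le {n : ℕ} {s t h : ℝ} (c : ℂ) {f : RSpace n → ℂ} (hf : ContDiff ℝ (⊤ : ℕ∞) f) :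
    gsNorm s t h (c • f) ≤ ENNReal.ofReal ‖c‖ * gsNorm s t h f := by
  refine iSup_le fun α => iSup_le fun β => iSup_le fun x => ?_
  rw [partialD_smul c hf, norm_mul, mul_left_comm, mul_div_assoc,
    ENNReal.ofReal_mul (norm_nonneg c)]
  gcongr
  unfold gsNorm
  exact le_iSup_of_le α (le_iSup_of_le β (le_iSup_of_le x le_rfl))

lemma gsNorm_zero {n : ℕ} (s t h : ℝ) : gsNorm s t h (0 : RSpace n → ℂ) = 0 := by
  have hz : ∀ (α : Fin n → ℕ) (x : RSpace n), partialD α (0 : RSpace n → ℂ) x = 0 := by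
    intro α x
    simp [partialD]
  simp [gsNorm, hz]

lemma gsNorm_anti {n : ℕ} {s t h h' : ℝ} (hh : 0 < h) (hle : h ≤ h') (f : RSpace n → ℂ) :
    gsNorm s t h' f ≤ gsNorm s t h f := by
  refine iSup_mono fun α => iSup_mono fun β => iSup_mono fun x => ?_
  have h1 := Real.rpow_pos_of_pos (multiFactorial_pos α) s
  have h2 := Real.rpow_pos_of_pos (multiFactorial_pos β) t
  refine ENNReal.ofReal_le_ofReal ?_
  gcongr

/-- The Gelfand-Shilov space `𝓢_t^s(ℝⁿ)` of Roumieu type, the union over `h > 0` of the Banach spaces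
of smooth functions with `gsNorm s t h f < ∞`. -/
def gelfandShilov (n : ℕ) (s t : ℝ) : Submodule ℂ (RSpace n → ℂ) where
  carrier := {f | ContDiff ℝ (⊤ : ℕ∞) f ∧ ∃ h : ℝ, 0 < h ∧ gsNorm s t h f < ⊤}
  zero_mem' := ⟨contDiff_const, 1, one_pos, by rw [gsNorm_zero]; exact ENNReal.zero_lt_top⟩
  add_mem' := by
    rintro f g ⟨hf, h, hh, hfh⟩ ⟨hg, k, hk, hgk⟩
    refine ⟨hf.add hg, max h k, lt_max_of_lt_left hh, ?_⟩
    refine (gsNorm_add_le (lt_max_of_lt_left hh) hf hg).trans_lt (ENNReal.add_lt_top.2 ⟨?_, ?_⟩)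
    · exact (gsNorm_anti hh (le_max_left _ _) f).trans_lt hfh
    · exact (gsNorm_anti hk (le_max_right _ _) g).trans_lt hgk
  smul_mem' := by
    rintro c f ⟨hf, h, hh, hfh⟩
    exact ⟨contDiff_const.smul hf, h, hh,
      (gsNorm_smul_le c hf).trans_lt (ENNReal.mul_lt_top ENNReal.ofReal_lt_top hfh)⟩

/-- The Gelfand-Shilov space `Σ_t^s(ℝⁿ)` of Beurling type, the intersection over `h > 0` of the
Banach spaces of smooth functions with `gsNorm s t h f < ∞`. -/
def gelfandShilovSigma (n : ℕ) (s t : ℝ) : Submodule ℂ (RSpace n → ℂ) where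
  carrier := {f | ContDiff ℝ (⊤ : ℕ∞) f ∧ ∀ h : ℝ, 0 < h → gsNorm s t h f < ⊤}
  zero_mem' := ⟨contDiff_const, fun h _ => by rw [gsNorm_zero]; exact ENNReal.zero_lt_top⟩
  add_mem' := by
    rintro f g ⟨hf, hfh⟩ ⟨hg, hgh⟩
    exact ⟨hf.add hg, fun h hh =>
      (gsNorm_add_le hh hf hg).trans_lt (ENNReal.add_lt_top.2 ⟨hfh h hh, hgh h hh⟩)⟩
  smul_mem' := by
    rintro c f ⟨hf, hfh⟩
    exact ⟨contDiff_const.smul hf, fun h hh =>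
      (gsNorm_smul_le c hf).trans_lt (ENNReal.mul_lt_top ENNReal.ofReal_lt_top (hfh h hh))⟩

/-- The distribution space `(𝓢_t^s)'(ℝⁿ)`: the linear functionals on `𝓢_t^s(ℝⁿ)` whose restriction to
each of the Banach spaces with norm `gsNorm s t h`, `h > 0`, is bounded, i.e. which are continuous
for the inductive limit topology. -/
def GelfandShilovDual (n : ℕ) (s t : ℝ) : Type :=
  {u : gelfandShilov n s t →ₗ[ℂ] ℂ //
    ∀ h : ℝ, 0 < h → ∃ C : ℝ≥0, ∀ f : gelfandShilov n s t,
      gsNorm s t h (f : RSpace n → ℂ) < ⊤ → ‖u f‖ₑ ≤ C * gsNorm s t h (f : RSpace n → ℂ)}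

/-- The distribution space `(Σ_t^s)'(ℝⁿ)`: the linear functionals on `Σ_t^s(ℝⁿ)` which are bounded by
one of the norms `gsNorm s t h`, `h > 0`, i.e. which are continuous for the Fréchet topology. -/
def GelfandShilovSigmaDual (n : ℕ) (s t : ℝ) : Type :=
  {u : gelfandShilovSigma n s t →ₗ[ℂ] ℂ //
    ∃ h : ℝ, 0 < h ∧ ∃ C : ℝ≥0, ∀ f : gelfandShilovSigma n s t,
      ‖u f‖ₑ ≤ C * gsNorm s t h (f : RSpace n → ℂ)}

open Classical in
/-- The value `⟨u, f⟩` of a linear functional `u` on a space `T` of test functions at `f ∈ T`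
(and `0` for functions `f` outside `T`). -/
def pairing {n : ℕ} {T : Submodule ℂ (RSpace n → ℂ)} (u : T →ₗ[ℂ] ℂ) (f : RSpace n → ℂ) : ℂ :=
  if hf : f ∈ T then u ⟨f, hf⟩ else 0

/-- The distribution `v ∈ (Σ_s)'` extends the distribution `u ∈ (𝓢_{1/2})'`. For `s > 1/2` this is the
identification of `(Σ_s)'` with a subspace of `(𝓢_{1/2})'` dual to the inclusion `𝓢_{1/2} ⊆ Σ_s`. -/
def ExtendsTo {n : ℕ} {s : ℝ} (u : GelfandShilovDual n (1 / 2) (1 / 2))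
    (v : GelfandShilovSigmaDual n s s) : Prop :=
  ∀ f ∈ gelfandShilov n (1 / 2) (1 / 2),
    f ∈ gelfandShilovSigma n s s ∧ pairing v.1 f = pairing u.1 f

/-- The distribution `u ∈ (𝓢_{1/2})'` is given by the function `a`: `⟨u, f⟩ = ∫ a f` for every test
function `f`. -/
def IsGivenBy {n : ℕ} (u : GelfandShilovDual n (1 / 2) (1 / 2)) (a : RSpace n → ℂ) : Prop :=
  ∀ f ∈ gelfandShilov n (1 / 2) (1 / 2),
    Integrable (fun x => a x * f x) ∧ pairing u.1 f = ∫ x, a x * f x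

/-! ### The short-time Fourier transform and modulation spaces -/

/-- The short-time Fourier transform
`V_φ u (x, ξ) = (2π)^{-n/2} (u, φ(· - x) e^{i⟨·, ξ⟩})_{L²}` of a distribution `u`, the form being
linear in the first and conjugate linear in the second argument; for a function `u` it is
`(2π)^{-n/2} ∫ u(y) conj(φ(y - x)) e^{-i⟨y, ξ⟩} dy`. -/
def stft {n : ℕ} {T : Submodule ℂ (RSpace n → ℂ)} (φ : RSpace n → ℂ) (u : T →ₗ[ℂ] ℂ)
    (x ξ : RSpace n) : ℂ :=
  (((2 * Real.pi) ^ (-(n : ℝ) / 2) : ℝ) : ℂ) *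
    pairing u (fun y => (starRingEnd ℂ) (φ (y - x) * Complex.exp (I * (inner ℝ y ξ : ℝ))))

/-- The mixed norm `‖F‖_{L^{p,q}} = (∫ (∫ |F(x, ξ)|^p dx)^{q/p} dξ)^{1/q}`, with essential suprema
when `p = ∞` or `q = ∞`. -/
def mixedNorm {n : ℕ} (p q : ℝ≥0∞) (F : RSpace n → RSpace n → ℂ) : ℝ≥0∞ :=
  eLpNorm (fun ξ => eLpNorm (fun x => F x ξ) p volume) q volume

/-- The Gaussian `π^{-n/4} e^{-|x|²/2}`. -/
def standardGaussian (n : ℕ) (x : RSpace n) : ℂ :=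
  ((Real.pi ^ (-(n : ℝ) / 4) * Real.exp (-‖x‖ ^ 2 / 2) : ℝ) : ℂ)

/-- The modulation space `M^{p,q}_{(ϑ)}(ℝⁿ)`, where `ϑ` is a weight on `ℝⁿ × ℝⁿ`. -/
def modulationSpace (n : ℕ) (p q : ℝ≥0∞) (ϑ : RSpace n → RSpace n → ℝ) :
    Set (GelfandShilovDual n (1 / 2) (1 / 2)) :=
  {u | mixedNorm p q (fun x ξ => stft (standardGaussian n) u.1 x ξ * (ϑ x ξ : ℂ)) < ⊤}

/-- A Gaussian: `φ(x) = c e^{-⟨A(x - x₀), x - x₀⟩}` with `c ≠ 0` and `A` a real symmetric positive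
definite matrix. -/
def IsGaussianFun {n : ℕ} (φ : RSpace n → ℂ) : Prop :=
  ∃ (c : ℂ) (A : Matrix (Fin n) (Fin n) ℝ) (x₀ : RSpace n), c ≠ 0 ∧ A.PosDef ∧
    ∀ x, φ x = c * Complex.exp
      (-((∑ i, ∑ j, A i j * (x i - x₀ i) * (x j - x₀ j) : ℝ) : ℂ))

/-! ### Weights and symbol classes -/

/-- The weight class `𝒫_s(ℝⁿ)`. -/
def weightClass (n : ℕ) (s : ℝ) : Set (RSpace n → ℝ) :=
  {ω | (∀ K : Set (RSpace n), IsCompact K → MemLp ω ⊤ (volume.restrict K)) ∧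
    (∀ x, 0 < ω x) ∧
    ∃ c C : ℝ, 0 < c ∧ ∀ x y, ω (x + y) ≤ C * (ω x * Real.exp (c * ‖y‖ ^ (1 / s)))}

/-- The symbol class `S_s^{(ω)}(ℝⁿ)`, as a set of smooth functions. -/
def symbolClass {n : ℕ} (s : ℝ) (ω : RSpace n → ℝ) : Set (RSpace n → ℂ) :=
  {a | ContDiff ℝ (⊤ : ℕ∞) a ∧ ∀ ε : ℝ, 0 < ε → ∃ C : ℝ, ∀ (α : Fin n → ℕ) (x : RSpace n),
    ‖partialD α a x‖ ≤ C * (ω x * ε ^ multiOrder α * multiFactorial α ^ s)}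

/-- The symbol class `S_s^{(ω)}(ℝⁿ)`, as a set of distributions. -/
def symbolDistributions {n : ℕ} (s : ℝ) (ω : RSpace n → ℝ) :
    Set (GelfandShilovDual n (1 / 2) (1 / 2)) :=
  {u | ∃ a ∈ symbolClass s ω, IsGivenBy u a}

/-- The first component `z ∈ ℝᵈ` of `Z = (z, w) ∈ ℝ²ᵈ`. -/
def firstPart {d : ℕ} (Z : RSpace (d + d)) : RSpace d :=
  WithLp.toLp 2 (fun i => Z (Fin.castAdd d i))

/-- The second component `w ∈ ℝᵈ` of `Z = (z, w) ∈ ℝ²ᵈ`. -/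
def secondPart {d : ℕ} (Z : RSpace (d + d)) : RSpace d :=
  WithLp.toLp 2 (fun i => Z (Fin.natAdd d i))

/-- The weight `ω_R(x, ξ, η, y) = ω(x, ξ) e^{-R(|y|^{1/s} + |η|^{1/s})}`, where `X = (x, ξ)` and
`Ξ = (η, y)`. -/
def weightR {d : ℕ} (s : ℝ) (ω : RSpace (d + d) → ℝ) (R : ℝ) (X Ξ : RSpace (d + d)) : ℝ :=
  ω X * Real.exp (-R * (‖secondPart Ξ‖ ^ (1 / s) + ‖firstPart Ξ‖ ^ (1 / s)))

/-- The function `X ↦ e^{i⟨X, Ξ⟩} V_φ u (X, Ξ)`. -/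
def modulatedStft {n : ℕ} (φ : RSpace n → ℂ) (u : GelfandShilovDual n (1 / 2) (1 / 2))
    (Ξ : RSpace n) (X : RSpace n) : ℂ :=
  Complex.exp (I * (inner ℝ X Ξ : ℝ)) * stft φ u.1 X Ξ

end

noncomputable section

/-! ### Elementary estimates -/

/-! Up to a constant, `stft φ u X Ξ` is `u` paired with the time-frequency shift `y ↦ ψ(y - X)
e^{-i⟨y, Ξ⟩}` of the conjugate window `ψ`. The proof is a direct estimate for symbols, and a
reconstruction of the symbol from these pairings.

Direct half. After the substitution `y = X + Y`, the factor `e^{i⟨X, Ξ⟩}` cancels the phase and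
leaves the Fourier integral in `Y` of `ψ(Y) a(X + Y)`. Since `ω` is moderate and `ψ` decays faster
than `ω` grows, the `m`-th `Y`-derivative is at most a constant times `ω(X) h^m m!^s` times an
integrable function, for every scale `h`; this means decay `e^{-R|Ξ|^{1/s}}` for every `R`, through
`le_exp_of_forall_pow_le`. Derivatives in `X` fall on `a` alone, which gives
`HasSymbolBound.exists_norm_iteratedFDeriv_integral_le`.

Converse half. Every test function is a superposition of shifts of `ψ`, and functionals may be
applied under that integral (`tfShift_inversion`): coefficients decay twice as fast as the norms of
the shifts grow, and Hahn-Banach moves the integral into a Banach space of bounded families. Hence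
`u` is formally a superposition of conjugated shifts with density `stft`. If that density is at most
`ω(X) N(Ξ)` with `N` integrable against every `e^{R|Ξ|^{1/s}}`, the superposition is a symbol
(`hasSymbolBound_tfSynthesis`): at scale `h`, the `k`-th derivative of a shift costs `(2h)^k k!^s`
and a factor `exp(s(|Ξ|/h)^{1/s})`, which `N` absorbs however small `h` is. Fubini identifies it
with `u` (`integral_tfSynthesis_mul`).

The exponent `q` is immaterial because `R` may be increased: finiteness of the mixed norms for all
`R` produces such an `N` (`exists_integrable_bound_of_mixedNorm`). Membership in `Σ_1'` comes from
the at most exponential growth of the weights (`weightClass_one`), and `ExtendsTo.pairing_eq` makes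
extensions to `Σ_s` unique. Throughout, Gelfand-Shilov norms are replaced by the bounds `HasGSBound`
on full derivatives, at the price of a fixed dilation of the scale. -/

lemma pow_le_factorial_rpow_mul_exp {σ t : ℝ} (hσ : 0 < σ) (ht : 0 ≤ t) (k : ℕ) :
    t ^ k ≤ (k.factorial : ℝ) ^ σ * Real.exp (σ * t ^ (1 / σ)) := by
  have hy : 0 ≤ t ^ (1 / σ) := Real.rpow_nonneg ht _
  -- The claim is `y^k / k! ≤ e^y` for `y = t^{1/σ}`, raised to the power `σ`.
  have h1 := Real.pow_div_factorial_le_exp _ hy k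
  have hk : (0 : ℝ) < k.factorial := by exact_mod_cast k.factorial_pos
  have h2 : ((t ^ (1 / σ)) ^ k) ≤ k.factorial * Real.exp (t ^ (1 / σ)) := by
    rw [div_le_iff₀ hk] at h1
    linarith
  have h3 := Real.rpow_le_rpow (by positivity) h2 hσ.le
  rw [Real.mul_rpow hk.le (Real.exp_pos _).le, ← Real.exp_mul, ← Real.rpow_natCast,
    ← Real.rpow_mul hy, ← Real.rpow_mul ht] at h3
  rw [show 1 / σ * (k * σ) = k by field_simp, Real.rpow_natCast] at h3
  rwa [mul_comm σ]

/-- Instead of optimizing over `k`, take `1/σ`-th powers and sum: with `y = (t/h)^{1/σ}` the left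
sides become the terms of the series of `e^{y/2}`, and halving `y` makes the right sides geometric
with sum 2. This is the device that turns factorial bounds into exponential decay, both in space and
in frequency. -/
lemma le_exp_of_forall_pow_le {σ A M h t : ℝ} (hσ : 0 < σ) (hA : 0 ≤ A) (hM : 0 ≤ M) (hh : 0 < h)
    (ht : 0 ≤ t) (H : ∀ k : ℕ, A * t ^ k ≤ M * (h ^ k * (k.factorial : ℝ) ^ σ)) :
    A ≤ 2 ^ σ * M * Real.exp (-(σ / 2 * (t / h) ^ (1 / σ))) := by
  set y := (t / h) ^ (1 / σ) with hy
  have hth : 0 ≤ t / h := by positivity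
  have hy0 : 0 ≤ y := Real.rpow_nonneg hth _
  have key : ∀ k : ℕ, A ^ (1 / σ) * ((y / 2) ^ k / k.factorial) ≤ M ^ (1 / σ) * (1 / 2) ^ k := by
    intro k
    have hk : (0 : ℝ) < k.factorial := by exact_mod_cast k.factorial_pos
    have h1 : A * (t / h) ^ k ≤ M * (k.factorial : ℝ) ^ σ := by
      rw [div_pow, ← mul_div_assoc, div_le_iff₀ (by positivity)]
      linarith [H k]
    have h2 := Real.rpow_le_rpow (by positivity) h1 (by positivity : 0 ≤ 1 / σ)
    rw [Real.mul_rpow hA (by positivity), Real.mul_rpow hM (by positivity), ← Real.rpow_mul hk.le,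
      mul_one_div_cancel hσ.ne', Real.rpow_one, ← Real.rpow_natCast, ← Real.rpow_mul hth,
      mul_comm (k : ℝ), Real.rpow_mul hth, ← hy, Real.rpow_natCast] at h2
    rw [div_pow, div_div, ← mul_div_assoc, div_le_iff₀ (by positivity)]
    calc A ^ (1 / σ) * y ^ k ≤ _ := h2
      _ = M ^ (1 / σ) * (1 / 2) ^ k * (2 ^ k * k.factorial) := by
        rw [div_pow, one_pow]; field_simp
  have hs1 : HasSum (fun k : ℕ => A ^ (1 / σ) * ((y / 2) ^ k / k.factorial))
      (A ^ (1 / σ) * Real.exp (y / 2)) := by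
    have := NormedSpace.exp_series_hasSum_exp' (𝕂 := ℝ) (y / 2)
    rw [← Real.exp_eq_exp_ℝ] at this
    simpa [div_eq_inv_mul] using this.mul_left (A ^ (1 / σ))
  have hs2 : HasSum (fun k : ℕ => M ^ (1 / σ) * (1 / 2 : ℝ) ^ k) (M ^ (1 / σ) * 2) :=
    hasSum_geometric_two.mul_left _
  have h3 := hasSum_le key hs1 hs2
  have h4 := Real.rpow_le_rpow (by positivity) h3 hσ.le
  rw [Real.mul_rpow (by positivity) (by positivity), Real.mul_rpow (by positivity) (by positivity),
    ← Real.rpow_mul hA, ← Real.rpow_mul hM, one_div_mul_cancel hσ.ne', Real.rpow_one, Real.rpow_one,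
    ← Real.exp_mul] at h4
  have h5 : A = A * Real.exp (y / 2 * σ) * Real.exp (-(σ / 2 * y)) := by
    rw [mul_assoc, ← Real.exp_add]; ring_nf; simp
  rw [h5, mul_comm (2 ^ σ)]
  gcongr

lemma factorial_add_le (a b : ℕ) : (a + b).factorial ≤ 2 ^ (a + b) * (a.factorial * b.factorial) := by
  rw [← Nat.add_choose_mul_factorial_mul_factorial, mul_assoc]
  exact Nat.mul_le_mul_right _ (Nat.choose_le_two_pow _ _)

lemma factorial_sum_le {ι : Type*} (s : Finset ι) (α : ι → ℕ) :
    (∑ i ∈ s, α i).factorial ≤ (2 ^ s.card) ^ (∑ i ∈ s, α i) * ∏ i ∈ s, (α i).factorial := by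
  classical
  induction s using Finset.induction_on with
  | empty => simp
  | insert a s ha ih =>
    rw [Finset.sum_insert ha, Finset.prod_insert ha, Finset.card_insert_of_notMem ha]
    refine (factorial_add_le _ _).trans ?_
    have h1 : (2 ^ s.card) ^ (∑ i ∈ s, α i) ≤ (2 ^ s.card) ^ (α a + ∑ i ∈ s, α i) :=
      Nat.pow_le_pow_right (by positivity) (by omega)
    calc 2 ^ (α a + ∑ i ∈ s, α i) * ((α a).factorial * (∑ i ∈ s, α i).factorial)
        ≤ 2 ^ (α a + ∑ i ∈ s, α i) * ((α a).factorial *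
          ((2 ^ s.card) ^ (α a + ∑ i ∈ s, α i) * ∏ i ∈ s, (α i).factorial)) := by
          gcongr
          exact ih.trans (by gcongr)
      _ = _ := by rw [pow_succ, mul_pow]; ring

lemma factorial_multiOrder_le {n : ℕ} (α : Fin n → ℕ) :
    ((multiOrder α).factorial : ℝ) ≤ (2 ^ n) ^ multiOrder α * multiFactorial α := by
  have := factorial_sum_le Finset.univ α
  simp only [Finset.card_univ, Fintype.card_fin] at this
  unfold multiOrder multiFactorial
  exact_mod_cast this

lemma multiFactorial_le {n : ℕ} (α : Fin n → ℕ) :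
    multiFactorial α ≤ (multiOrder α).factorial := by
  unfold multiOrder multiFactorial
  exact_mod_cast Nat.le_of_dvd (Nat.factorial_pos _) (Nat.prod_factorial_dvd_factorial_sum _ _)

/-! ### Symmetry of iterated derivatives and multi-indices -/

section Symmetry

variable {E F : Type*} [NormedAddCommGroup E] [NormedSpace ℝ E]
  [NormedAddCommGroup F] [NormedSpace ℝ F]

/-- Iterated directional derivatives along a list of vectors. -/
def listDeriv (f : E → F) : List E → E → F
  | [] => f
  | a :: l => fun x => fderiv ℝ (listDeriv f l) x a

lemma ContDiff.listDeriv {f : E → F} (hf : ContDiff ℝ (⊤ : ℕ∞) f) (l : List E) :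
    ContDiff ℝ (⊤ : ℕ∞) (listDeriv f l) := by
  induction l with
  | nil => exact hf
  | cons a l ih =>
    have := ih.fderiv_right (m := (⊤ : ℕ∞)) (by exact_mod_cast le_top)
    exact this.clm_apply contDiff_const

/-- Permutations are generated by swaps of adjacent entries, and such a swap is the symmetry of the
second derivative of the smooth function `listDeriv f l`. -/
lemma listDeriv_perm {f : E → F} (hf : ContDiff ℝ (⊤ : ℕ∞) f) {l l' : List E} (h : l.Perm l') :
    listDeriv f l = listDeriv f l' := by
  induction h with
  | nil => rfl
  | cons a _ ih => simp only [listDeriv, ih]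
  | trans _ _ ih1 ih2 => exact ih1.trans ih2
  | swap a b l =>
    have hl := hf.listDeriv l
    have hd : Differentiable ℝ (fderiv ℝ (listDeriv f l)) :=
      (hl.fderiv_right (m := (⊤ : ℕ∞)) (by exact_mod_cast le_top)).differentiable (by simp)
    ext x
    simp only [listDeriv]
    rw [fderiv_clm_apply (hd x) (by fun_prop), fderiv_clm_apply (hd x) (by fun_prop)]
    have := (hl.contDiffAt (x := x)).isSymmSndFDerivAt
      (by rw [minSmoothness_of_isRCLikeNormedField]; exact WithTop.coe_le_coe.2 le_top)
    simpa using this b a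

lemma iteratedFDeriv_eq_listDeriv {f : E → F} (hf : ContDiff ℝ (⊤ : ℕ∞) f) {k : ℕ} (v : Fin k → E)
    (x : E) : iteratedFDeriv ℝ k f x v = listDeriv f (List.ofFn v) x := by
  induction k generalizing x with
  | zero => simp [listDeriv]
  | succ k ih =>
    rw [iteratedFDeriv_succ_apply_left, List.ofFn_succ]
    simp only [listDeriv]
    have hd : DifferentiableAt ℝ (iteratedFDeriv ℝ k f) x :=
      (hf.differentiable_iteratedFDeriv (by exact_mod_cast ENat.natCast_lt_top k)) x
    rw [show listDeriv f (List.ofFn fun i => v i.succ) =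
      fun y => iteratedFDeriv ℝ k f y (Fin.tail v) from funext fun y => (ih (Fin.tail v) y).symm]
    rw [fderiv_continuousMultilinear_apply_const_apply hd]

end Symmetry

/-- The standard basis vector. -/
abbrev stdVec {n : ℕ} (i : Fin n) : RSpace n := EuclideanSpace.single i (1 : ℝ)

/-- Take `α i` to be the number of occurrences of `i` in `J`. The list of basis vectors given by `J`
and the one in `partialD` are then permutations of each other, since every index has the same
multiplicity in both. -/
lemma partialD_eq_iteratedFDeriv {n k : ℕ} {f : RSpace n → ℂ} (hf : ContDiff ℝ (⊤ : ℕ∞) f)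
    (J : Fin k → Fin n) (x : RSpace n) :
    ∃ α : Fin n → ℕ, multiOrder α = k ∧
      iteratedFDeriv ℝ k f x (fun j => stdVec (J j)) = partialD α f x := by
  refine ⟨fun i => (Finset.univ.filter fun j => J j = i).card, ?_, ?_⟩
  · unfold multiOrder
    rw [← Finset.card_eq_sum_card_fiberwise (fun _ _ => Finset.mem_coe.2 (Finset.mem_univ _))]
    simp
  · rw [partialD, iteratedFDeriv_eq_listDeriv hf, iteratedFDeriv_eq_listDeriv hf]
    refine congrFun (listDeriv_perm hf ?_) x
    rw [← Function.comp_def stdVec, ← List.map_ofFn,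
      ← Function.comp_def (fun i : Fin n => EuclideanSpace.single i (1 : ℝ)),
      ← List.map_ofFn]
    refine List.Perm.map _ ?_
    rw [← Multiset.coe_eq_coe]
    ext i
    have hofFn : ∀ {m : ℕ} (g : Fin m → Fin n), ((List.ofFn g : List (Fin n)) : Multiset (Fin n)) =
        Finset.univ.val.map g := by
      intro m g
      simp [Fin.univ_def, List.ofFn_eq_map]
    rw [hofFn, hofFn, Multiset.count_map, Multiset.count_map]
    set β : Fin n → ℕ := fun i => (Finset.univ.filter fun j => J j = i).card
    change (Finset.univ.filter fun j => i = J j).card =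
      (Finset.univ.filter fun j : Fin (∑ i, β i) => i = (finSigmaFinEquiv.symm j).1).card
    have h1 : (Finset.univ.filter fun j : Fin (∑ i, β i) => i = (finSigmaFinEquiv.symm j).1).card =
        (Finset.univ.filter fun p : (i : Fin n) × Fin (β i) => i = p.1).card := by
      refine Finset.card_equiv finSigmaFinEquiv.symm ?_
      simp
    rw [h1]
    have h2 : (Finset.univ.filter fun p : (i : Fin n) × Fin (β i) => i = p.1) =
        (Finset.univ : Finset (Fin (β i))).map ⟨fun a => ⟨i, a⟩, fun a b h => by simpa using h⟩ := by
      ext ⟨a, b⟩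
      simp only [Finset.mem_filter, Finset.mem_univ, true_and, Finset.mem_map]
      constructor
      · rintro rfl; exact ⟨b, rfl⟩
      · rintro ⟨c, hc⟩; exact (Sigma.mk.inj hc).1
    rw [h2, Finset.card_map, Finset.card_univ, Fintype.card_fin]
    simp only [β, eq_comm]

lemma norm_partialD_le {n : ℕ} (f : RSpace n → ℂ) (α : Fin n → ℕ) (x : RSpace n) :
    ‖partialD α f x‖ ≤ ‖iteratedFDeriv ℝ (multiOrder α) f x‖ := by
  refine ((iteratedFDeriv ℝ (∑ i, α i) f x).le_opNorm _).trans ?_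
  simp only [PiLp.norm_single, norm_one, Finset.prod_const_one, mul_one]
  rfl

/-- Expanding the arguments in the standard basis gives `n ^ k` terms, each a partial derivative
times coordinates bounded by the norms of the arguments. -/
lemma norm_iteratedFDeriv_le_of_partialD {n k : ℕ} {f : RSpace n → ℂ}
    (hf : ContDiff ℝ (⊤ : ℕ∞) f) {x : RSpace n} {M : ℝ} (hM : 0 ≤ M)
    (h : ∀ α : Fin n → ℕ, multiOrder α = k → ‖partialD α f x‖ ≤ M) :
    ‖iteratedFDeriv ℝ k f x‖ ≤ n ^ k * M := by
  refine ContinuousMultilinearMap.opNorm_le_bound (by positivity) fun v => ?_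
  have hv : v = fun j => ∑ i, v j i • stdVec i := by
    ext j : 1
    have := (EuclideanSpace.basisFun (Fin n) ℝ).sum_repr (v j)
    simpa using this.symm
  rw [hv]
  rw [ContinuousMultilinearMap.map_sum]
  refine (norm_sum_le _ _).trans ?_
  have : ∀ J ∈ (Finset.univ : Finset (Fin k → Fin n)),
      ‖iteratedFDeriv ℝ k f x fun j => v j (J j) • stdVec (J j)‖ ≤ M * ∏ j, ‖v j‖ := by
    intro J _
    rw [ContinuousMultilinearMap.map_smul_univ, norm_smul, mul_comm, norm_prod]
    obtain ⟨α, hα, h2⟩ := partialD_eq_iteratedFDeriv hf J x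
    rw [h2]
    gcongr
    · exact h α hα
    · exact PiLp.norm_apply_le _ _
  refine (Finset.sum_le_sum this).trans ?_
  rw [← hv]
  simp [mul_assoc]

/-! ### Gelfand-Shilov bounds in terms of iterated derivatives -/

/-- Smoothness together with the bounds `‖Dᵏf(x)‖ ≤ C hᵏ k!^σ exp(-(‖x‖/h)^{1/σ})`. -/
def HasGSBound {n : ℕ} (σ h C : ℝ) (f : RSpace n → ℂ) : Prop :=
  ContDiff ℝ (⊤ : ℕ∞) f ∧ ∀ (k : ℕ) (x : RSpace n), ‖iteratedFDeriv ℝ k f x‖ ≤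
    C * (h ^ k * (k.factorial : ℝ) ^ σ * Real.exp (-(‖x‖ / h) ^ (1 / σ)))

lemma HasGSBound.nonneg {n : ℕ} {σ h C : ℝ} {f : RSpace n → ℂ} (hf : HasGSBound σ h C f) :
    0 ≤ C := by
  have := (norm_nonneg _).trans (hf.2 0 0)
  simp only [pow_zero, Nat.factorial_zero, Nat.cast_one, Real.one_rpow, one_mul] at this
  exact nonneg_of_mul_nonneg_left this (Real.exp_pos _)

lemma exp_neg_div_rpow_mono {p t h h' : ℝ} (hp : 0 ≤ p) (ht : 0 ≤ t) (hh : 0 < h) (hle : h ≤ h') :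
    Real.exp (-(t / h) ^ p) ≤ Real.exp (-(t / h') ^ p) := by
  have : 0 < h' := hh.trans_le hle
  gcongr

lemma HasGSBound.mono {n : ℕ} {σ h h' C C' : ℝ} {f : RSpace n → ℂ} (hf : HasGSBound σ h C f)
    (hσ : 0 < σ) (hh : 0 < h) (hle : h ≤ h') (hC : C ≤ C') : HasGSBound σ h' C' f := by
  refine ⟨hf.1, fun k x => (hf.2 k x).trans ?_⟩
  have h1 := exp_neg_div_rpow_mono (p := 1 / σ) (by positivity) (norm_nonneg x) hh hle
  have := hf.nonneg
  have := this.trans hC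
  have := hh.trans_le hle
  gcongr

lemma le_of_gsNorm_le {n : ℕ} {σ h M : ℝ} {f : RSpace n → ℂ} (hh : 0 < h) (hM : 0 ≤ M)
    (hf : gsNorm σ σ h f ≤ ENNReal.ofReal M) (α β : Fin n → ℕ) (x : RSpace n) :
    |multiPow x β| * ‖partialD α f x‖ ≤
      M * (h ^ (multiOrder α + multiOrder β) * multiFactorial α ^ σ * multiFactorial β ^ σ) := by
  have h1 := Real.rpow_pos_of_pos (multiFactorial_pos α) σ
  have h2 := Real.rpow_pos_of_pos (multiFactorial_pos β) σ
  rw [← div_le_iff₀ (by positivity), ← ENNReal.ofReal_le_ofReal_iff hM]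
  refine le_trans ?_ hf
  unfold gsNorm
  exact le_iSup_of_le α (le_iSup_of_le β (le_iSup_of_le x le_rfl))

lemma exists_abs_ge_norm_div {n : ℕ} [NeZero n] (x : RSpace n) : ∃ i, ‖x‖ ≤ n * |x i| := by
  obtain ⟨i, -, hi⟩ := Finset.exists_max_image Finset.univ (fun i => |x i|)
    ⟨(0 : Fin n), Finset.mem_univ _⟩
  refine ⟨i, ?_⟩
  have h1 : ‖x‖ ≤ ∑ j, |x j| := by
    have hx : x = ∑ j, x j • stdVec j := by
      simpa using ((EuclideanSpace.basisFun (Fin n) ℝ).sum_repr x).symm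
    conv_lhs => rw [hx]
    refine (norm_sum_le _ _).trans (Finset.sum_le_sum fun j _ => ?_)
    simp [norm_smul]
  refine h1.trans ((Finset.sum_le_sum fun j hj => hi j hj).trans ?_)
  simp

lemma multiPow_abs_le {n : ℕ} (x : RSpace n) (β : Fin n → ℕ) :
    |multiPow x β| ≤ ‖x‖ ^ multiOrder β := by
  unfold multiPow multiOrder
  rw [Finset.abs_prod, ← Finset.prod_pow_eq_pow_sum]
  refine Finset.prod_le_prod (fun _ _ => abs_nonneg _) fun i _ => ?_
  rw [abs_pow]
  gcongr
  exact PiLp.norm_apply_le x i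

/-- The single monomial `x_i^l` in the coordinate of largest modulus suffices. The base `n + 1` is
used instead of `n` to remain positive in dimension zero. -/
lemma norm_pow_mul_le_of_multiPow {n l : ℕ} {x : RSpace n} {A B : ℝ} (hA : 0 ≤ A) (hB : 0 ≤ B)
    (H : ∀ β : Fin n → ℕ, multiOrder β = l → |multiPow x β| * A ≤ B) :
    ‖x‖ ^ l * A ≤ (n + 1) ^ l * B := by
  rcases Nat.eq_zero_or_pos n with rfl | hn
  · have hx : x = 0 := Subsingleton.elim _ _
    rcases Nat.eq_zero_or_pos l with rfl | hl
    · simpa [multiPow] using H 0 (by simp [multiOrder])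
    · rw [hx, norm_zero, zero_pow hl.ne', zero_mul]
      positivity
  · have : NeZero n := ⟨hn.ne'⟩
    obtain ⟨i, hi⟩ := exists_abs_ge_norm_div x
    have h1 := H (Pi.single i l) (by simp [multiOrder])
    have h2 : multiPow x (Pi.single i l) = x i ^ l := by
      unfold multiPow
      rw [Finset.prod_eq_single i]
      · simp
      · intro j _ hj; simp [hj]
      · simp
    rw [h2, abs_pow] at h1
    calc ‖x‖ ^ l * A ≤ ((n + 1) * |x i|) ^ l * A := by
          gcongr
          refine hi.trans ?_
          gcongr; linarith
      _ = (n + 1) ^ l * (|x i| ^ l * A) := by rw [mul_pow]; ring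
      _ ≤ _ := by gcongr

/-- The dilation of the scale that is lost between `gsNorm` and `HasGSBound`. -/
def gsScale (n : ℕ) (σ : ℝ) : ℝ := (n + 1) * max 1 ((2 / σ) ^ σ) + 2 ^ (n * σ) * max 1 (σ ^ σ)

lemma one_le_gsScale {n : ℕ} {σ : ℝ} : 1 ≤ gsScale n σ := by
  unfold gsScale
  have h1 : (1 : ℝ) ≤ max 1 ((2 / σ) ^ σ) := le_max_left _ _
  have h2 : (1 : ℝ) ≤ max 1 (σ ^ σ) := le_max_left _ _
  have h3 : (0 : ℝ) < 2 ^ (n * σ) := by positivity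
  have h4 : (0 : ℝ) ≤ n := by positivity
  nlinarith [mul_nonneg h3.le (zero_le_one.trans h2), mul_nonneg h4 (zero_le_one.trans h1)]

lemma gsScale_ge_left {n : ℕ} {σ : ℝ} : (n + 1) * max 1 ((2 / σ) ^ σ) ≤ gsScale n σ := by
  unfold gsScale
  have h2 : (1 : ℝ) ≤ max 1 (σ ^ σ) := le_max_left _ _
  have h3 : (0 : ℝ) < 2 ^ (n * σ) := by positivity
  nlinarith [mul_nonneg h3.le (zero_le_one.trans h2)]

lemma gsScale_ge_right {n : ℕ} {σ : ℝ} : 2 ^ (n * σ) * max 1 (σ ^ σ) ≤ gsScale n σ := by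
  unfold gsScale
  have h1 : (1 : ℝ) ≤ max 1 ((2 / σ) ^ σ) := le_max_left _ _
  have : 0 ≤ (n + 1) * max 1 ((2 / σ) ^ σ) := by positivity
  linarith

/-- The exponential absorbs `‖x‖^l` at the price `(σ^σ h)^l l!^σ`, and passing from `|α|!` to `α!`
costs `2^{n|α|}`. Both losses are geometric in the order, so a dilation of the scale covers them. -/
lemma gsNorm_le_of_hasGSBound {n : ℕ} {σ h C : ℝ} (hσ : 0 < σ) (hh : 0 < h) {f : RSpace n → ℂ}
    (hf : HasGSBound σ h C f) : gsNorm σ σ (gsScale n σ * h) f ≤ ENNReal.ofReal C := by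
  refine iSup_le fun α => iSup_le fun β => iSup_le fun x => ENNReal.ofReal_le_ofReal ?_
  have hc := one_le_gsScale (n := n) (σ := σ)
  have h1 := Real.rpow_pos_of_pos (multiFactorial_pos α) σ
  have h2 := Real.rpow_pos_of_pos (multiFactorial_pos β) σ
  have hC := hf.nonneg
  rw [div_le_iff₀ (by positivity)]
  set k := multiOrder α
  set l := multiOrder β
  set c : ℝ := 2 ^ (n * σ) with hcdef
  have hfac : ∀ γ : Fin n → ℕ, ((multiOrder γ).factorial : ℝ) ^ σ ≤
      c ^ multiOrder γ * multiFactorial γ ^ σ := by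
    intro γ
    have := Real.rpow_le_rpow (by positivity) (factorial_multiOrder_le γ) hσ.le
    rw [Real.mul_rpow (by positivity) (multiFactorial_pos γ).le] at this
    refine this.trans_eq ?_
    congr 1
    rw [hcdef, ← Real.rpow_natCast, ← Real.rpow_natCast, ← Real.rpow_natCast, ← Real.rpow_mul,
      ← Real.rpow_mul, ← Real.rpow_mul]
    · ring_nf
    all_goals positivity
  have hexp : ‖x‖ ^ l * Real.exp (-(‖x‖ / h) ^ (1 / σ)) ≤
      (σ ^ σ * h) ^ l * (l.factorial : ℝ) ^ σ := by
    have h0 : 0 ≤ ‖x‖ / h := by positivity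
    -- The division by `σ^σ` normalizes the exponent: `σ t^{1/σ}` becomes `(‖x‖/h)^{1/σ}`.
    have := pow_le_factorial_rpow_mul_exp hσ (t := (‖x‖ / h) / σ ^ σ) (by positivity) l
    rw [Real.div_rpow h0 (by positivity), ← Real.rpow_mul hσ.le, mul_one_div_cancel hσ.ne',
      Real.rpow_one, mul_div_cancel₀ _ hσ.ne', div_div, div_pow, div_le_iff₀ (by positivity)] at this
    rw [Real.exp_neg, ← div_eq_mul_inv, div_le_iff₀ (Real.exp_pos _), mul_comm (σ ^ σ)]
    linarith
  have hcm : c * max 1 (σ ^ σ) ≤ gsScale n σ := gsScale_ge_right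
  have hc0 : 0 < c := by positivity
  have hm1 : (1 : ℝ) ≤ max 1 (σ ^ σ) := le_max_left _ _
  calc |multiPow x β| * ‖partialD α f x‖
      ≤ ‖x‖ ^ l * (C * (h ^ k * (k.factorial : ℝ) ^ σ * Real.exp (-(‖x‖ / h) ^ (1 / σ)))) := by
        gcongr
        · exact multiPow_abs_le x β
        · exact (norm_partialD_le f α x).trans (hf.2 _ x)
    _ = C * (h ^ k * (k.factorial : ℝ) ^ σ) * (‖x‖ ^ l * Real.exp (-(‖x‖ / h) ^ (1 / σ))) := by ring
    _ ≤ C * (h ^ k * (c ^ k * multiFactorial α ^ σ)) *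
        ((σ ^ σ * h) ^ l * (c ^ l * multiFactorial β ^ σ)) := by
        have h3 := hexp.trans (mul_le_mul_of_nonneg_left (hfac β) (by positivity))
        have h4 := hfac α
        exact mul_le_mul (by gcongr) h3 (by positivity) (by positivity)
    _ = C * (((c * 1 * h) ^ k * (c * σ ^ σ * h) ^ l) * multiFactorial α ^ σ *
        multiFactorial β ^ σ) := by
        simp only [mul_pow]; ring
    _ ≤ C * (((gsScale n σ * h) ^ k * (gsScale n σ * h) ^ l) * multiFactorial α ^ σ *
        multiFactorial β ^ σ) := by
        gcongr
        · exact le_trans (by gcongr) hcm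
        · exact le_trans (by gcongr; exact le_max_right _ _) hcm
    _ = _ := by rw [pow_add]

/-- For fixed `x` and `k` the norm bounds `‖Dᵏf(x)‖ ‖x‖^l` for all `l` at once, which is the input
of `le_exp_of_forall_pow_le`. -/
lemma hasGSBound_of_gsNorm_le {n : ℕ} {σ h M : ℝ} (hσ : 0 < σ) (hh : 0 < h) (hM : 0 ≤ M)
    {f : RSpace n → ℂ} (hsm : ContDiff ℝ (⊤ : ℕ∞) f) (hf : gsNorm σ σ h f ≤ ENNReal.ofReal M) :
    HasGSBound σ (gsScale n σ * h) (2 ^ σ * M) f := by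
  refine ⟨hsm, fun k x => ?_⟩
  have hpos : (0 : ℝ) < n + 1 := by positivity
  have hle := gsScale_ge_left (n := n) (σ := σ)
  have hm1 : (1 : ℝ) ≤ max 1 ((2 / σ) ^ σ) := le_max_left _ _
  have key : ∀ l : ℕ, ‖iteratedFDeriv ℝ k f x‖ * ‖x‖ ^ l ≤
      (M * (((n + 1) * h) ^ k * (k.factorial : ℝ) ^ σ)) *
        (((n + 1) * h) ^ l * (l.factorial : ℝ) ^ σ) := by
    intro l
    have h1 : ∀ α : Fin n → ℕ, multiOrder α = k → ‖x‖ ^ l * ‖partialD α f x‖ ≤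
        (n + 1) ^ l * (M * (h ^ (k + l) * (k.factorial : ℝ) ^ σ * (l.factorial : ℝ) ^ σ)) := by
      intro α hα
      refine norm_pow_mul_le_of_multiPow (norm_nonneg _) (by positivity) fun β hβ => ?_
      refine (le_of_gsNorm_le hh hM hf α β x).trans ?_
      subst hα hβ
      have h3 := multiFactorial_pos α
      have h4 := multiFactorial_pos β
      gcongr
      · exact multiFactorial_le α
      · exact multiFactorial_le β
    -- The passage from partial to full derivatives divides by `‖x‖^l`, so the origin is treated
    -- separately; there only `l = 0` has content.
    rcases eq_or_lt_of_le (norm_nonneg x) with hx | hx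
    · rcases Nat.eq_zero_or_pos l with rfl | hl
      · have h2 := norm_iteratedFDeriv_le_of_partialD (M := M * (h ^ k * (k.factorial : ℝ) ^ σ))
          (x := x) hsm (by positivity) fun α hα => by simpa using h1 α hα
        simp only [pow_zero, mul_one, Nat.factorial_zero, Nat.cast_one, Real.one_rpow]
        refine h2.trans ?_
        rw [mul_pow]
        have : (n : ℝ) ^ k ≤ (n + 1) ^ k := by gcongr; linarith
        calc (n : ℝ) ^ k * (M * (h ^ k * (k.factorial : ℝ) ^ σ))
            ≤ (n + 1) ^ k * (M * (h ^ k * (k.factorial : ℝ) ^ σ)) := by gcongr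
          _ = _ := by ring
      · rw [← hx, zero_pow hl.ne', mul_zero]; positivity
    · have h2 := norm_iteratedFDeriv_le_of_partialD (k := k) (x := x)
        (M := (n + 1) ^ l * (M * (h ^ (k + l) * (k.factorial : ℝ) ^ σ * (l.factorial : ℝ) ^ σ)) /
          ‖x‖ ^ l) hsm (by positivity) fun α hα => by
          rw [le_div_iff₀ (by positivity), mul_comm]; exact h1 α hα
      rw [← mul_div_assoc, le_div_iff₀ (by positivity)] at h2
      refine h2.trans ?_
      have : (n : ℝ) ^ k ≤ (n + 1) ^ k := by gcongr; linarith
      calc _ ≤ (n + 1 : ℝ) ^ k * ((n + 1) ^ l *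
            (M * (h ^ (k + l) * (k.factorial : ℝ) ^ σ * (l.factorial : ℝ) ^ σ))) := by gcongr
        _ = _ := by rw [mul_pow, mul_pow, pow_add]; ring
  refine (le_exp_of_forall_pow_le hσ (norm_nonneg _) (by positivity) (by positivity)
    (norm_nonneg x) key).trans ?_
  have hexp : σ / 2 * (‖x‖ / ((n + 1) * h)) ^ (1 / σ) =
      (‖x‖ / ((n + 1) * (2 / σ) ^ σ * h)) ^ (1 / σ) := by
    rw [show ‖x‖ / ((n + 1) * (2 / σ) ^ σ * h) = ‖x‖ / ((n + 1) * h) / (2 / σ) ^ σ by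
      field_simp, Real.div_rpow (x := ‖x‖ / ((n + 1) * h)) (by positivity) (by positivity), ← Real.rpow_mul (by positivity),
      mul_one_div_cancel hσ.ne', Real.rpow_one]
    field_simp
  rw [hexp]
  have h5 : Real.exp (-(‖x‖ / ((n + 1) * (2 / σ) ^ σ * h)) ^ (1 / σ)) ≤
      Real.exp (-(‖x‖ / (gsScale n σ * h)) ^ (1 / σ)) := by
    refine exp_neg_div_rpow_mono (by positivity) (norm_nonneg x) (by positivity) ?_
    gcongr
    refine le_trans ?_ hle
    gcongr
    exact le_max_right _ _
  calc _ = 2 ^ σ * M * (((n + 1) * 1 * h) ^ k * (k.factorial : ℝ) ^ σ *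
        Real.exp (-(‖x‖ / ((n + 1) * (2 / σ) ^ σ * h)) ^ (1 / σ))) := by rw [mul_one]; ring
    _ ≤ _ := by
      have h6 : (n + 1) * 1 ≤ gsScale n σ := le_trans (by gcongr) hle
      have h7 : 0 < gsScale n σ := by linarith
      gcongr

lemma mem_gelfandShilov_iff {n : ℕ} {σ : ℝ} (hσ : 0 < σ) {f : RSpace n → ℂ} :
    f ∈ gelfandShilov n σ σ ↔ ∃ h C : ℝ, 0 < h ∧ HasGSBound σ h C f := by
  have hc := one_le_gsScale (n := n) (σ := σ)
  constructor
  · rintro ⟨hf, h, hh, hn⟩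
    exact ⟨_, _, by positivity, hasGSBound_of_gsNorm_le hσ hh ENNReal.toReal_nonneg hf
      (ENNReal.ofReal_toReal hn.ne).ge⟩
  · rintro ⟨h, C, hh, hf⟩
    exact ⟨hf.1, _, by positivity, (gsNorm_le_of_hasGSBound hσ hh hf).trans_lt ENNReal.ofReal_lt_top⟩

lemma mem_gelfandShilovSigma_iff {n : ℕ} {σ : ℝ} (hσ : 0 < σ) {f : RSpace n → ℂ} :
    f ∈ gelfandShilovSigma n σ σ ↔ ∀ h : ℝ, 0 < h → ∃ C : ℝ, HasGSBound σ h C f := by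
  have hc := one_le_gsScale (n := n) (σ := σ)
  have hc' : gsScale n σ ≠ 0 := by positivity
  constructor
  · rintro ⟨hf, hn⟩ h hh
    have := hn (h / gsScale n σ) (by positivity)
    refine ⟨2 ^ σ * (gsNorm σ σ (h / gsScale n σ) f).toReal, ?_⟩
    have := hasGSBound_of_gsNorm_le hσ (h := h / gsScale n σ) (by positivity)
      ENNReal.toReal_nonneg hf (ENNReal.ofReal_toReal this.ne).ge
    rwa [mul_div_cancel₀ _ hc'] at this
  · intro H
    refine ⟨(H 1 one_pos).choose_spec.1, fun h hh => ?_⟩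
    obtain ⟨C, hC⟩ := H (h / gsScale n σ) (by positivity)
    have := gsNorm_le_of_hasGSBound hσ (by positivity) hC
    rw [mul_div_cancel₀ _ hc'] at this
    exact this.trans_lt ENNReal.ofReal_lt_top

/-! ### Comparison of exponentials, integrability -/

lemma exists_mul_rpow_le_rpow_add {p q a : ℝ} (hp : 0 < p) (hpq : p < q) (ha : 0 ≤ a) :
    ∃ K : ℝ, 0 ≤ K ∧ ∀ u : ℝ, 0 ≤ u → a * u ^ p ≤ u ^ q + K := by
  -- The threshold `u = a^{1/(q-p)}` is where `a u^p = u^q`; below it the constant suffices, above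
  -- it `u^q` does.
  refine ⟨a * (a ^ (1 / (q - p))) ^ p, by positivity, fun u hu => ?_⟩
  have hd : 0 < q - p := sub_pos.2 hpq
  rcases le_total u (a ^ (1 / (q - p))) with h | h
  · have : a * u ^ p ≤ a * (a ^ (1 / (q - p))) ^ p := by gcongr
    have h2 : 0 ≤ u ^ q := by positivity
    linarith
  · have h1 : a ≤ u ^ (q - p) := by
      have := Real.rpow_le_rpow (by positivity) h hd.le
      rwa [← Real.rpow_mul ha, one_div_mul_cancel hd.ne', Real.rpow_one] at this
    have h2 : u ^ (q - p) * u ^ p = u ^ q := by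
      rcases eq_or_lt_of_le hu with rfl | hu'
      · rw [Real.zero_rpow hp.ne', Real.zero_rpow (hp.trans hpq).ne', mul_zero]
      · rw [← Real.rpow_add hu']; ring_nf
    have h3 : a * u ^ p ≤ u ^ (q - p) * u ^ p := by gcongr
    have : 0 ≤ a * (a ^ (1 / (q - p))) ^ p := by positivity
    linarith

lemma exists_pow_le_mul_exp {p r : ℝ} (hp : 0 < p) (hr : 0 < r) (k : ℕ) :
    ∃ K : ℝ, 0 < K ∧ ∀ t : ℝ, 0 ≤ t → t ^ k ≤ K * Real.exp (r * t ^ p) := by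
  have hσ : 0 < 1 / p := by positivity
  -- Rescaling `t` by `b` makes the exponent in `pow_le_factorial_rpow_mul_exp` with `σ = 1/p` equal
  -- to `r t^p`.
  set b : ℝ := (r * p) ^ (1 / p) with hb
  have hb0 : 0 < b := by positivity
  refine ⟨(k.factorial : ℝ) ^ (1 / p) / b ^ k, by positivity, fun t ht => ?_⟩
  have := pow_le_factorial_rpow_mul_exp hσ (t := b * t) (by positivity) k
  rw [one_div_one_div, Real.mul_rpow hb0.le ht, hb, ← Real.rpow_mul (by positivity),
    one_div_mul_cancel hp.ne', Real.rpow_one, ← hb, mul_pow] at this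
  rw [div_mul_eq_mul_div, le_div_iff₀ (by positivity), mul_comm]
  have h1 : 1 / p * (r * p * t ^ p) = r * t ^ p := by field_simp
  rw [h1] at this
  linarith

lemma integrable_exp_neg_norm_rpow {n : ℕ} {p r : ℝ} (hp : 0 < p) (hr : 0 < r) :
    Integrable (fun x : RSpace n => Real.exp (-(r * ‖x‖ ^ p))) := by
  obtain ⟨K, hK, h⟩ := exists_pow_le_mul_exp hp hr (n + 1)
  have hi : Integrable (fun x : RSpace n => (1 + ‖x‖) ^ (-((n : ℝ) + 1))) :=
    integrable_one_add_norm (by simp)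
  refine (hi.const_mul (2 ^ n * (1 + K))).mono' ?_ (Filter.Eventually.of_forall fun x => ?_)
  · refine Continuous.aestronglyMeasurable ?_
    have : Continuous fun x : RSpace n => ‖x‖ ^ p :=
      continuous_norm.rpow_const fun _ => Or.inr hp.le
    fun_prop
  · rw [Real.norm_eq_abs, abs_of_pos (Real.exp_pos _), Real.rpow_neg (by positivity), Real.exp_neg]
    have h0 : 0 < 1 + ‖x‖ := by positivity
    rw [← div_eq_mul_inv, le_div_iff₀ (by positivity), ← div_eq_inv_mul, div_le_iff₀ (Real.exp_pos _)]
    rw [show ((n : ℝ) + 1) = ((n + 1 : ℕ) : ℝ) by push_cast; ring, Real.rpow_natCast]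
    have h1 : (1 + ‖x‖) ^ (n + 1) ≤ 2 ^ n * (1 + ‖x‖ ^ (n + 1)) := by
      have := add_pow_le (zero_le_one (α := ℝ)) (norm_nonneg x) (n + 1)
      simpa using this
    have h2 : 1 ≤ Real.exp (r * ‖x‖ ^ p) := Real.one_le_exp (by positivity)
    have h3 := h ‖x‖ (norm_nonneg x)
    calc _ ≤ _ := h1
      _ ≤ 2 ^ n * (Real.exp (r * ‖x‖ ^ p) + K * Real.exp (r * ‖x‖ ^ p)) := by gcongr
      _ = _ := by ring

lemma div_rpow_norm_eq {n : ℕ} {p h : ℝ} (hh : 0 < h) (x : RSpace n) :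
    (‖x‖ / h) ^ p = (1 / h) ^ p * ‖x‖ ^ p := by
  rw [← Real.mul_rpow (by positivity) (by positivity)]; ring_nf

lemma integrable_exp_neg_div_rpow {n : ℕ} {p h : ℝ} (hp : 0 < p) (hh : 0 < h) :
    Integrable (fun x : RSpace n => Real.exp (-(‖x‖ / h) ^ p)) := by
  simp_rw [div_rpow_norm_eq hh]
  exact integrable_exp_neg_norm_rpow hp (by positivity)

/-- Half of `‖y‖` is at most the larger of `‖y - x‖` and `‖x‖`. Doubling the scale thus replaces
subadditivity of `t^p`, which fails for `p > 1`. -/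
lemma neg_div_rpow_le {E : Type*} [NormedAddCommGroup E] {p h : ℝ} (hp : 0 ≤ p) (hh : 0 < h)
    (x y : E) : -(‖y - x‖ / h) ^ p ≤ (‖x‖ / h) ^ p + -(‖y‖ / (2 * h)) ^ p := by
  have h1 : ‖y‖ / (2 * h) ≤ max (‖y - x‖ / h) (‖x‖ / h) := by
    have : ‖y‖ ≤ ‖y - x‖ + ‖x‖ := by simpa using norm_add_le (y - x) x
    rcases le_total ‖y - x‖ ‖x‖ with h2 | h2
    · refine le_max_of_le_right ?_
      rw [div_le_div_iff₀ (by positivity) hh]; nlinarith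
    · refine le_max_of_le_left ?_
      rw [div_le_div_iff₀ (by positivity) hh]; nlinarith
  have h3 : (‖y‖ / (2 * h)) ^ p ≤ (‖y - x‖ / h) ^ p + (‖x‖ / h) ^ p := by
    refine (Real.rpow_le_rpow (by positivity) h1 hp).trans ?_
    rcases max_choice (‖y - x‖ / h) (‖x‖ / h) with h4 | h4 <;> rw [h4]
    · have : 0 ≤ (‖x‖ / h) ^ p := by positivity
      linarith
    · have : 0 ≤ (‖y - x‖ / h) ^ p := by positivity
      linarith
  linarith

/-! ### Leibniz rule -/

lemma factorial_mul_factorial_sub_rpow_le {σ : ℝ} (hσ : 0 ≤ σ) {j k : ℕ} (hj : j ≤ k) :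
    (j.factorial : ℝ) ^ σ * ((k - j).factorial : ℝ) ^ σ ≤ (k.factorial : ℝ) ^ σ := by
  rw [← Real.mul_rpow (by positivity) (by positivity)]
  refine Real.rpow_le_rpow (by positivity) ?_ hσ
  exact_mod_cast Nat.le_of_dvd (Nat.factorial_pos _) (Nat.factorial_mul_factorial_dvd_factorial hj)

/-- Because `j!^σ (k-j)!^σ ≤ k!^σ`, the Leibniz sum is dominated by the binomial expansion of `(a +
b)^k`: under products the scales add. -/
lemma sum_choose_mul_le {σ A B a b : ℝ} (hσ : 0 ≤ σ) (hA : 0 ≤ A) (ha : 0 ≤ a)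
    {k : ℕ} {u v : ℕ → ℝ} (hv0 : ∀ j, 0 ≤ v j)
    (hu : ∀ j ≤ k, u j ≤ A * (a ^ j * (j.factorial : ℝ) ^ σ))
    (hv : ∀ j ≤ k, v j ≤ B * (b ^ j * (j.factorial : ℝ) ^ σ)) (hB : 0 ≤ B) (hb : 0 ≤ b) :
    ∑ i ∈ Finset.range (k + 1), (k.choose i : ℝ) * u i * v (k - i) ≤
      A * B * ((a + b) ^ k * (k.factorial : ℝ) ^ σ) := by
  rw [add_pow, Finset.sum_mul, Finset.mul_sum]
  refine Finset.sum_le_sum fun i hi => ?_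
  have hik : i ≤ k := by simpa [Nat.lt_succ_iff] using hi
  have h1 := factorial_mul_factorial_sub_rpow_le hσ hik
  calc (k.choose i : ℝ) * u i * v (k - i)
      ≤ k.choose i * (A * (a ^ i * (i.factorial : ℝ) ^ σ)) *
        (B * (b ^ (k - i) * ((k - i).factorial : ℝ) ^ σ)) := by
        gcongr
        · exact hv0 _
        · exact hu i hik
        · exact hv _ (Nat.sub_le _ _)
    _ = A * B * (a ^ i * b ^ (k - i) * k.choose i *
        ((i.factorial : ℝ) ^ σ * ((k - i).factorial : ℝ) ^ σ)) := by ring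
    _ ≤ A * B * (a ^ i * b ^ (k - i) * k.choose i * (k.factorial : ℝ) ^ σ) := by gcongr

lemma norm_iteratedFDeriv_smul_le_of_le {E F : Type*} [NormedAddCommGroup E] [NormedSpace ℝ E]
    [NormedAddCommGroup F] [NormedSpace ℝ F] [NormedSpace ℂ F] [IsScalarTower ℝ ℂ F]
    {σ A B a b : ℝ} (hσ : 0 ≤ σ) (hA : 0 ≤ A) (ha : 0 ≤ a) (hB : 0 ≤ B) (hb : 0 ≤ b)
    {f : E → ℂ} {g : E → F} (hf : ContDiff ℝ (⊤ : ℕ∞) f) (hg : ContDiff ℝ (⊤ : ℕ∞) g) {x : E} {k : ℕ}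
    (hu : ∀ j ≤ k, ‖iteratedFDeriv ℝ j f x‖ ≤ A * (a ^ j * (j.factorial : ℝ) ^ σ))
    (hv : ∀ j ≤ k, ‖iteratedFDeriv ℝ j g x‖ ≤ B * (b ^ j * (j.factorial : ℝ) ^ σ)) :
    ‖iteratedFDeriv ℝ k (fun y => f y • g y) x‖ ≤
      A * B * ((a + b) ^ k * (k.factorial : ℝ) ^ σ) :=
  (norm_iteratedFDeriv_smul_le hf hg x (by exact_mod_cast le_top)).trans
    (sum_choose_mul_le hσ hA ha (fun _ => norm_nonneg _) hu hv hB hb)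

lemma factorial_add_rpow_le {σ : ℝ} (hσ : 0 ≤ σ) (a b : ℕ) :
    ((a + b).factorial : ℝ) ^ σ ≤
      (2 ^ σ) ^ (a + b) * ((a.factorial : ℝ) ^ σ * (b.factorial : ℝ) ^ σ) := by
  have h : ((a + b).factorial : ℝ) ≤ 2 ^ (a + b) * (a.factorial * b.factorial) := by
    exact_mod_cast factorial_add_le a b
  have := Real.rpow_le_rpow (by positivity) h hσ
  rwa [Real.mul_rpow (by positivity) (by positivity), Real.mul_rpow (by positivity) (by positivity),
    ← Real.rpow_natCast, ← Real.rpow_mul (by norm_num), mul_comm _ σ, Real.rpow_mul (by norm_num),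
    Real.rpow_natCast] at this

lemma norm_iteratedFDeriv_iteratedFDeriv {E F : Type*} [NormedAddCommGroup E] [NormedSpace ℝ E]
    [NormedAddCommGroup F] [NormedSpace ℝ F] (f : E → F) (k m : ℕ) (x : E) :
    ‖iteratedFDeriv ℝ m (iteratedFDeriv ℝ k f) x‖ = ‖iteratedFDeriv ℝ (m + k) f x‖ := by
  induction k generalizing m with
  | zero =>
    rw [iteratedFDeriv_zero_eq_comp]
    exact LinearIsometryEquiv.norm_iteratedFDeriv_comp_left _ _ _ _
  | succ k ih =>
    have h := LinearIsometryEquiv.norm_iteratedFDeriv_comp_left (𝕜 := ℝ)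
      (continuousMultilinearCurryLeftEquiv ℝ (fun _ : Fin (k + 1) => E) F).symm
      (fderiv ℝ (iteratedFDeriv ℝ k f)) x m
    rw [iteratedFDeriv_succ_eq_comp_left]
    refine h.trans ?_
    rw [norm_iteratedFDeriv_fderiv, ih, show m + 1 + k = m + (k + 1) by ring]

/-! ### Inclusions between Gelfand-Shilov spaces, weights -/

/-- The surplus `k!^{τ-σ}` beats every geometric factor `(h/h')^k`, and `‖x‖^{1/σ}` beats every
multiple of `‖x‖^{1/τ}`; hence every scale `h'` is reached. That `D` does not depend on `f` makes
the inclusion of the spaces continuous. -/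
lemma exists_hasGSBound_of_lt (n : ℕ) {σ τ h h' : ℝ} (hσ : 0 < σ) (hστ : σ < τ) (hh : 0 < h)
    (hh' : 0 < h') : ∃ D : ℝ, 0 ≤ D ∧ ∀ (f : RSpace n → ℂ) (C : ℝ),
      HasGSBound σ h C f → HasGSBound τ h' (D * C) f := by
  have hτ : 0 < τ := hσ.trans hστ
  obtain ⟨K, hK, HK⟩ := exists_mul_rpow_le_rpow_add (p := 1 / τ) (q := 1 / σ)
    (a := (h / h') ^ (1 / τ)) (by positivity) (by gcongr) (by positivity)
  set D := Real.exp ((τ - σ) * (h / h') ^ (1 / (τ - σ)))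
  refine ⟨D * Real.exp K, by positivity, fun f C hf => ⟨hf.1, fun k x => (hf.2 k x).trans ?_⟩⟩
  have hC := hf.nonneg
  have h1 : h ^ k * (k.factorial : ℝ) ^ σ ≤ D * (h' ^ k * (k.factorial : ℝ) ^ τ) := by
    have := pow_le_factorial_rpow_mul_exp (sub_pos.2 hστ) (t := h / h') (by positivity) k
    have hk : (0 : ℝ) < k.factorial := by exact_mod_cast k.factorial_pos
    rw [div_pow, div_le_iff₀ (by positivity)] at this
    have h2 : (k.factorial : ℝ) ^ τ = (k.factorial : ℝ) ^ (τ - σ) * (k.factorial : ℝ) ^ σ := by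
      rw [← Real.rpow_add hk]; ring_nf
    rw [h2]
    calc _ ≤ _ := mul_le_mul_of_nonneg_right this (by positivity)
      _ = _ := by ring
  have h2 : Real.exp (-(‖x‖ / h) ^ (1 / σ)) ≤ Real.exp K * Real.exp (-(‖x‖ / h') ^ (1 / τ)) := by
    rw [← Real.exp_add]
    refine Real.exp_le_exp.2 ?_
    have := HK (‖x‖ / h) (by positivity)
    rw [← Real.mul_rpow (by positivity) (by positivity),
      show h / h' * (‖x‖ / h) = ‖x‖ / h' by field_simp] at this
    linarith
  calc _ ≤ C * (D * (h' ^ k * (k.factorial : ℝ) ^ τ) *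
        (Real.exp K * Real.exp (-(‖x‖ / h') ^ (1 / τ)))) := by gcongr
    _ = _ := by ring

lemma gelfandShilov_le_sigma {n : ℕ} {σ τ : ℝ} (hσ : 0 < σ) (hστ : σ < τ) {f : RSpace n → ℂ}
    (hf : f ∈ gelfandShilov n σ σ) : f ∈ gelfandShilovSigma n τ τ := by
  obtain ⟨h, C, hh, hf⟩ := (mem_gelfandShilov_iff hσ).1 hf
  exact (mem_gelfandShilovSigma_iff (hσ.trans hστ)).2 fun h' hh' => by
    obtain ⟨D, -, hD⟩ := exists_hasGSBound_of_lt n hσ hστ hh hh'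
    exact ⟨_, hD f C hf⟩

lemma weightClass_bound {n : ℕ} {s : ℝ} {ω : RSpace n → ℝ} (hω : ω ∈ weightClass n s) :
    ∃ c C : ℝ, 0 < c ∧ 1 ≤ C ∧ ∀ x y, ω (x + y) ≤ C * (ω x * Real.exp (c * ‖y‖ ^ (1 / s))) := by
  obtain ⟨-, hpos, c, C, hc, H⟩ := hω
  refine ⟨c, max 1 C, hc, le_max_left _ _, fun x y => (H x y).trans ?_⟩
  have := hpos x
  gcongr
  exact le_max_right _ _

/-- A displacement of length at most one multiplies the weight by a bounded factor, and `y` is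
reached in about `‖y‖` such steps, so the growth is at most exponential whatever `s` is. -/
lemma weightClass_one {n : ℕ} {s : ℝ} (hs : 0 < s) {ω : RSpace n → ℝ} (hω : ω ∈ weightClass n s) :
    ω ∈ weightClass n 1 := by
  obtain ⟨c, C, hc, hC, H⟩ := weightClass_bound hω
  have hpos := hω.2.1
  have hC0 : 0 < C := by linarith
  -- The factor `e^b = C e^c` is the cost of one step of length at most one.
  set b := c + Real.log C
  have hb : 0 < b := by have := Real.log_nonneg hC; positivity
  have iter : ∀ (m : ℕ) (x z : RSpace n), ‖z‖ ≤ 1 → ω (x + (m : ℝ) • z) ≤ ω x * Real.exp (b * m) := by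
    intro m x z hz
    induction m with
    | zero => simp
    | succ m ih =>
      have h1 : x + ((m + 1 : ℕ) : ℝ) • z = (x + (m : ℝ) • z) + z := by
        push_cast; rw [add_smul, one_smul, add_assoc]
      rw [h1]
      refine (H _ _).trans ?_
      have h2 : ‖z‖ ^ (1 / s) ≤ 1 := Real.rpow_le_one (norm_nonneg _) hz (by positivity)
      have h3 : C * Real.exp (c * ‖z‖ ^ (1 / s)) ≤ Real.exp b := by
        rw [Real.exp_add, Real.exp_log hC0, mul_comm]
        gcongr
        nlinarith
      calc _ = ω (x + (m : ℝ) • z) * (C * Real.exp (c * ‖z‖ ^ (1 / s))) := by ring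
        _ ≤ (ω x * Real.exp (b * m)) * Real.exp b :=
          mul_le_mul ih h3 (by positivity) (mul_nonneg (hpos x).le (Real.exp_pos _).le)
        _ = _ := by push_cast; rw [mul_assoc, ← Real.exp_add]; ring_nf
  refine ⟨hω.1, hpos, b, Real.exp b, hb, fun x y => ?_⟩
  set m : ℕ := ⌊‖y‖⌋₊ + 1
  have hm : ‖y‖ ≤ m := by
    have := (Nat.lt_floor_add_one ‖y‖).le
    exact_mod_cast this
  have hm0 : (0 : ℝ) < m := by positivity
  have h1 := iter m x ((m : ℝ)⁻¹ • y) (by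
    rw [norm_smul, norm_inv, Real.norm_natCast, ← div_eq_inv_mul, div_le_one hm0]; exact hm)
  rw [smul_inv_smul₀ hm0.ne'] at h1
  refine h1.trans ?_
  have hx := hpos x
  have h2 : (m : ℝ) ≤ ‖y‖ + 1 := by
    have := Nat.floor_le (norm_nonneg y)
    push_cast [m]; linarith
  rw [div_one, Real.rpow_one, mul_left_comm, ← Real.exp_add]
  gcongr
  nlinarith

/-! ### Time-frequency shifts -/

/-- The character `y ↦ e^{-i⟨y, Ξ⟩}`. -/
def modChar {n : ℕ} (Ξ y : RSpace n) : ℂ := Complex.exp (-(I * (inner ℝ y Ξ : ℝ)))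

/-- The time-frequency shift `y ↦ ψ(y - X) e^{-i⟨y, Ξ⟩}`. -/
def tfShift {n : ℕ} (ψ : RSpace n → ℂ) (X Ξ : RSpace n) (y : RSpace n) : ℂ :=
  modChar Ξ y * ψ (y - X)

lemma norm_modChar {n : ℕ} (Ξ y : RSpace n) : ‖modChar Ξ y‖ = 1 := by
  rw [modChar, ← mul_neg, ← ofReal_neg, mul_comm, norm_exp_ofReal_mul_I]

lemma contDiff_modChar {n : ℕ} (Ξ : RSpace n) : ContDiff ℝ (⊤ : ℕ∞) (modChar Ξ) := by
  unfold modChar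
  refine ContDiff.cexp ?_
  refine (contDiff_const.mul (ofRealCLM.contDiff.comp ?_)).neg
  exact contDiff_id.inner ℝ contDiff_const

lemma iteratedDeriv_cexp_I_mul (k : ℕ) :
    iteratedDeriv k (fun t : ℝ => Complex.exp (-(I * t))) =
      fun t : ℝ => (-I) ^ k * Complex.exp (-(I * t)) := by
  induction k with
  | zero => simp
  | succ k ih =>
    rw [iteratedDeriv_succ, ih]
    ext t
    have h1 : HasDerivAt (fun t : ℝ => -(I * (t : ℂ))) (-I) t := by
      have h2 := ((hasDerivAt_id (t : ℂ)).comp_ofReal.const_mul I).neg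
      rw [mul_one] at h2
      exact h2
    rw [(h1.cexp.const_mul _).deriv]
    ring

/-- The character is `t ↦ e^{-it}`, whose derivatives have modulus one, composed with a functional
of norm `‖Ξ‖`. -/
lemma norm_iteratedFDeriv_modChar_le {n : ℕ} (Ξ y : RSpace n) (k : ℕ) :
    ‖iteratedFDeriv ℝ k (modChar Ξ) y‖ ≤ ‖Ξ‖ ^ k := by
  have hf : ContDiff ℝ (⊤ : ℕ∞) (fun t : ℝ => Complex.exp (-(I * t))) :=
    (contDiff_const.mul ofRealCLM.contDiff).neg.cexp
  have h1 : modChar Ξ = (fun t : ℝ => Complex.exp (-(I * t))) ∘ (innerSL ℝ Ξ) := by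
    ext y
    simp [modChar, real_inner_comm]
  rw [h1, ContinuousLinearMap.iteratedFDeriv_comp_right _ hf y (by exact_mod_cast le_top)]
  refine (ContinuousMultilinearMap.norm_compContinuousLinearMap_le _ _).trans ?_
  rw [norm_iteratedFDeriv_eq_norm_iteratedDeriv, iteratedDeriv_cexp_I_mul]
  have h2 : ∀ r : ℝ, ‖Complex.exp (-(I * (r : ℂ)))‖ = 1 := fun r => by
    rw [← mul_neg, ← ofReal_neg, mul_comm, norm_exp_ofReal_mul_I]
  simp [h2]

lemma contDiff_tfShift {n : ℕ} {f : RSpace n → ℂ} (hf : ContDiff ℝ (⊤ : ℕ∞) f) (X Ξ : RSpace n) :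
    ContDiff ℝ (⊤ : ℕ∞) (tfShift f X Ξ) :=
  (contDiff_modChar Ξ).mul (hf.comp (contDiff_id.sub contDiff_const))

lemma norm_tfShift {n : ℕ} (f : RSpace n → ℂ) (X Ξ y : RSpace n) :
    ‖tfShift f X Ξ y‖ = ‖f (y - X)‖ := by
  rw [tfShift, norm_mul, norm_modChar, one_mul]

/-- The powers `‖Ξ‖^j` from the character are traded for `h^j j!^σ` at the cost of an exponential in
`‖Ξ‖/h`; the Leibniz rule then doubles the scale. -/
lemma norm_iteratedFDeriv_tfShift_le {n : ℕ} {σ h C : ℝ} (hσ : 0 < σ) (hh : 0 < h)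
    {f : RSpace n → ℂ} (hf : HasGSBound σ h C f) (X Ξ y : RSpace n) (k : ℕ) :
    ‖iteratedFDeriv ℝ k (tfShift f X Ξ) y‖ ≤
      C * Real.exp (σ * (‖Ξ‖ / h) ^ (1 / σ)) * Real.exp (-(‖y - X‖ / h) ^ (1 / σ)) *
        ((2 * h) ^ k * (k.factorial : ℝ) ^ σ) := by
  have hC := hf.nonneg
  have h1 : ∀ j ≤ k, ‖iteratedFDeriv ℝ j (modChar Ξ) y‖ ≤
      Real.exp (σ * (‖Ξ‖ / h) ^ (1 / σ)) * (h ^ j * (j.factorial : ℝ) ^ σ) := by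
    intro j _
    refine (norm_iteratedFDeriv_modChar_le Ξ y j).trans ?_
    have := pow_le_factorial_rpow_mul_exp hσ (t := ‖Ξ‖ / h) (by positivity) j
    rw [div_pow, div_le_iff₀ (by positivity)] at this
    linarith
  have h2 : ∀ j ≤ k, ‖iteratedFDeriv ℝ j (fun y => f (y - X)) y‖ ≤
      (C * Real.exp (-(‖y - X‖ / h) ^ (1 / σ))) * (h ^ j * (j.factorial : ℝ) ^ σ) := by
    intro j _
    rw [iteratedFDeriv_comp_sub]
    exact (hf.2 j (y - X)).trans_eq (by ring)
  have h3 : ContDiff ℝ (⊤ : ℕ∞) (fun y => f (y - X)) := hf.1.comp (contDiff_id.sub contDiff_const)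
  have := norm_iteratedFDeriv_smul_le_of_le hσ.le (Real.exp_pos _).le hh.le (by positivity) hh.le
    (contDiff_modChar Ξ) h3 h1 h2
  refine this.trans_eq ?_
  ring

lemma HasGSBound.tfShift {n : ℕ} {σ h C : ℝ} (hσ : 0 < σ) (hh : 0 < h)
    {f : RSpace n → ℂ} (hf : HasGSBound σ h C f) (X Ξ : RSpace n) :
    HasGSBound σ (2 * h)
      (C * Real.exp ((‖X‖ / h) ^ (1 / σ) + σ * (‖Ξ‖ / h) ^ (1 / σ))) (tfShift f X Ξ) := by
  refine ⟨contDiff_tfShift hf.1 X Ξ, fun k y => ?_⟩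
  refine (norm_iteratedFDeriv_tfShift_le hσ hh hf X Ξ y k).trans ?_
  have hC := hf.nonneg
  have h1 : Real.exp (-(‖y - X‖ / h) ^ (1 / σ)) ≤
      Real.exp ((‖X‖ / h) ^ (1 / σ)) * Real.exp (-(‖y‖ / (2 * h)) ^ (1 / σ)) := by
    rw [← Real.exp_add]
    exact Real.exp_le_exp.2 (neg_div_rpow_le (by positivity) hh X y)
  rw [Real.exp_add]
  calc _ ≤ C * Real.exp (σ * (‖Ξ‖ / h) ^ (1 / σ)) * (Real.exp ((‖X‖ / h) ^ (1 / σ)) *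
        Real.exp (-(‖y‖ / (2 * h)) ^ (1 / σ))) * ((2 * h) ^ k * (k.factorial : ℝ) ^ σ) := by gcongr
    _ = _ := by ring

lemma HasGSBound.add {n : ℕ} {σ h C C' : ℝ} {f g : RSpace n → ℂ}
    (hf : HasGSBound σ h C f) (hg : HasGSBound σ h C' g) : HasGSBound σ h (C + C') (f + g) := by
  refine ⟨hf.1.add hg.1, fun k x => ?_⟩
  rw [iteratedFDeriv_add_apply ((hf.1.of_le (by exact_mod_cast le_top)).contDiffAt)
    ((hg.1.of_le (by exact_mod_cast le_top)).contDiffAt), add_mul]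
  exact (norm_add_le _ _).trans (add_le_add (hf.2 k x) (hg.2 k x))

/-- The mean value inequality for `Dᵏf` on the unit ball about `y` uses one more derivative; the
resulting `(k+1)!^σ` costs a factor `2^σ` per order, and the decay at nearby points costs a doubled
scale. -/
lemma HasGSBound.translate_sub {n : ℕ} {σ h C : ℝ} (hσ : 0 < σ) (hh : 0 < h)
    {f : RSpace n → ℂ} (hf : HasGSBound σ h C f) {z : RSpace n} (hz : ‖z‖ ≤ 1) :
    HasGSBound σ (max 2 (2 ^ σ) * h) (‖z‖ * (C * (2 ^ σ * h) * Real.exp ((1 / h) ^ (1 / σ))))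
      (fun y => f (y - z) - f y) := by
  have hC := hf.nonneg
  have hc : ContDiff ℝ (⊤ : ℕ∞) (fun y => f (y - z)) := hf.1.comp (contDiff_id.sub contDiff_const)
  refine ⟨hc.sub hf.1, fun k y => ?_⟩
  rw [show (fun y => f (y - z) - f y) = (fun y => f (y - z)) - f from rfl,
    iteratedFDeriv_sub_apply ((hc.of_le (by exact_mod_cast le_top)).contDiffAt)
    ((hf.1.of_le (by exact_mod_cast le_top)).contDiffAt), iteratedFDeriv_comp_sub]
  have hfac : (((k + 1).factorial : ℕ) : ℝ) ^ σ ≤ (2 ^ σ) ^ (k + 1) * (k.factorial : ℝ) ^ σ := by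
    simpa using factorial_add_rpow_le hσ.le k 1
  have hb : ∀ w ∈ Metric.closedBall y 1, ‖fderiv ℝ (iteratedFDeriv ℝ k f) w‖ ≤
      C * (h ^ (k + 1) * ((2 ^ σ) ^ (k + 1) * (k.factorial : ℝ) ^ σ)) *
        (Real.exp ((1 / h) ^ (1 / σ)) * Real.exp (-(‖y‖ / (2 * h)) ^ (1 / σ))) := by
    intro w hw
    rw [norm_fderiv_iteratedFDeriv]
    refine (hf.2 (k + 1) w).trans ?_
    have h1 : Real.exp (-(‖w‖ / h) ^ (1 / σ)) ≤
        Real.exp ((1 / h) ^ (1 / σ)) * Real.exp (-(‖y‖ / (2 * h)) ^ (1 / σ)) := by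
      rw [← Real.exp_add]
      refine Real.exp_le_exp.2 ?_
      have h2 := neg_div_rpow_le (p := 1 / σ) (by positivity) hh (y - w) y
      rw [sub_sub_cancel] at h2
      refine h2.trans ?_
      gcongr
      rwa [Metric.mem_closedBall', dist_eq_norm] at hw
    rw [← mul_assoc]
    gcongr
  have hd : ∀ w ∈ Metric.closedBall y 1, DifferentiableAt ℝ (iteratedFDeriv ℝ k f) w := fun w _ =>
    (hf.1.differentiable_iteratedFDeriv (by exact_mod_cast ENat.natCast_lt_top k)) w
  have := (convex_closedBall y 1).norm_image_sub_le_of_norm_fderiv_le hd hb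
    (Metric.mem_closedBall_self zero_le_one) (y := y - z) (by simpa [Metric.mem_closedBall, dist_eq_norm] using hz)
  refine this.trans ?_
  rw [show y - z - y = -z by abel, norm_neg]
  have h3 : Real.exp (-(‖y‖ / (2 * h)) ^ (1 / σ)) ≤
      Real.exp (-(‖y‖ / (max 2 (2 ^ σ) * h)) ^ (1 / σ)) :=
    exp_neg_div_rpow_mono (by positivity) (norm_nonneg y) (by positivity)
      (by gcongr; exact le_max_left _ _)
  calc _ = ‖z‖ * (C * (2 ^ σ * h) * Real.exp ((1 / h) ^ (1 / σ))) * ((2 ^ σ * h) ^ k *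
        (k.factorial : ℝ) ^ σ * Real.exp (-(‖y‖ / (2 * h)) ^ (1 / σ))) := by
        rw [mul_pow, pow_succ, pow_succ]; ring
    _ ≤ _ := by
      gcongr
      exact le_max_right _ _

lemma norm_modChar_sub_one_le {n : ℕ} (η y : RSpace n) : ‖modChar η y - 1‖ ≤ ‖y‖ * ‖η‖ := by
  rw [modChar, ← mul_neg, ← ofReal_neg]
  refine (Real.norm_exp_I_mul_ofReal_sub_one_le).trans ?_
  rw [norm_neg]
  exact norm_inner_le_norm y η

/-- Every derivative of `modChar η - 1` is of first order in `η`: the function itself is at most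
`‖y‖ ‖η‖`, and for `j ≥ 1` one has `‖η‖^j ≤ h^{j-1} ‖η‖`. The factor `‖y‖` is absorbed by relaxing
the decay from scale `h` to `2h`. -/
lemma HasGSBound.modulate_sub {n : ℕ} {σ h C : ℝ} (hσ : 0 < σ) (hh : 0 < h)
    {f : RSpace n → ℂ} (hf : HasGSBound σ h C f) :
    ∃ L : ℝ, 0 ≤ L ∧ ∀ η : RSpace n, ‖η‖ ≤ h →
      HasGSBound σ (2 * h) (‖η‖ * L) (fun y => (modChar η y - 1) * f y) := by
  have hC := hf.nonneg
  have hp : 0 < 1 / σ := by positivity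
  have hr : 0 < (1 / h) ^ (1 / σ) - (1 / (2 * h)) ^ (1 / σ) := by
    refine sub_pos.2 (Real.rpow_lt_rpow (by positivity) ?_ hp)
    gcongr
    linarith
  obtain ⟨K, hK, HK⟩ := exists_pow_le_mul_exp hp hr 1
  refine ⟨C * (1 / h + K), by positivity, fun η hη => ?_⟩
  have hm : ContDiff ℝ (⊤ : ℕ∞) (fun y => modChar η y - 1) := (contDiff_modChar η).sub contDiff_const
  refine ⟨hm.mul hf.1, fun k y => ?_⟩
  have h1 : ∀ j ≤ k, ‖iteratedFDeriv ℝ j (fun y => modChar η y - 1) y‖ ≤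
      (‖η‖ * (1 / h + ‖y‖)) * (h ^ j * (j.factorial : ℝ) ^ σ) := by
    intro j _
    rcases Nat.eq_zero_or_pos j with rfl | hj
    · simp only [norm_iteratedFDeriv_zero, pow_zero, Nat.factorial_zero, Nat.cast_one,
        Real.one_rpow, mul_one]
      refine (norm_modChar_sub_one_le η y).trans ?_
      have : 0 ≤ ‖η‖ * (1 / h) := by positivity
      nlinarith
    · rw [show (fun y => modChar η y - 1) = modChar η - fun _ => 1 from rfl,
        iteratedFDeriv_sub_apply
          (((contDiff_modChar η).of_le (by exact_mod_cast le_top)).contDiffAt)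
          contDiff_const.contDiffAt, iteratedFDeriv_const_of_ne hj.ne']
      simp only [Pi.zero_apply, sub_zero]
      refine (norm_iteratedFDeriv_modChar_le η y j).trans ?_
      obtain ⟨i, rfl⟩ := Nat.exists_eq_succ_of_ne_zero hj.ne'
      have h2 : (1 : ℝ) ≤ ((i + 1).factorial : ℝ) ^ σ :=
        Real.one_le_rpow (by exact_mod_cast Nat.factorial_pos _) hσ.le
      calc ‖η‖ ^ (i + 1) = ‖η‖ ^ i * ‖η‖ := pow_succ _ _
        _ ≤ h ^ i * ‖η‖ := by gcongr
        _ = (‖η‖ * (1 / h + 0)) * (h ^ (i + 1) * 1) := by rw [pow_succ]; field_simp; ring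
        _ ≤ _ := by gcongr; exact norm_nonneg y
  have h2 : ∀ j ≤ k, ‖iteratedFDeriv ℝ j f y‖ ≤
      (C * Real.exp (-(‖y‖ / h) ^ (1 / σ))) * (h ^ j * (j.factorial : ℝ) ^ σ) := by
    intro j _
    exact (hf.2 j y).trans_eq (by ring)
  refine (norm_iteratedFDeriv_smul_le_of_le hσ.le (by positivity) hh.le (by positivity) hh.le
    hm hf.1 h1 h2).trans ?_
  have h3 : (1 / h + ‖y‖) * Real.exp (-(‖y‖ / h) ^ (1 / σ)) ≤
      (1 / h + K) * Real.exp (-(‖y‖ / (2 * h)) ^ (1 / σ)) := by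
    have h4 := HK ‖y‖ (norm_nonneg y)
    rw [pow_one, sub_mul, ← div_rpow_norm_eq hh, ← div_rpow_norm_eq (by positivity)] at h4
    have h5 := exp_neg_div_rpow_mono (p := 1 / σ) hp.le (norm_nonneg y) hh
      (by linarith : h ≤ 2 * h)
    rw [add_mul, add_mul]
    refine add_le_add (by gcongr) ?_
    calc ‖y‖ * Real.exp (-(‖y‖ / h) ^ (1 / σ)) ≤ _ * Real.exp (-(‖y‖ / h) ^ (1 / σ)) :=
          mul_le_mul_of_nonneg_right h4 (Real.exp_pos _).le
      _ = _ := by rw [mul_assoc, ← Real.exp_add]; ring_nf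
  calc _ = ‖η‖ * C * ((1 / h + ‖y‖) * Real.exp (-(‖y‖ / h) ^ (1 / σ))) *
        ((2 * h) ^ k * (k.factorial : ℝ) ^ σ) := by ring
    _ ≤ ‖η‖ * C * ((1 / h + K) * Real.exp (-(‖y‖ / (2 * h)) ^ (1 / σ))) *
        ((2 * h) ^ k * (k.factorial : ℝ) ^ σ) := by gcongr
    _ = _ := by ring

lemma modChar_add {n : ℕ} (Ξ η y : RSpace n) : modChar (Ξ + η) y = modChar Ξ y * modChar η y := by
  rw [modChar, modChar, modChar, ← Complex.exp_add, inner_add_right]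
  push_cast
  ring_nf

/-- The shift depends on `(X, Ξ)` in a locally Lipschitz way at an enlarged scale: the difference
splits into a translation increment, shifted by `(X₀, Ξ)`, and a modulation increment of the shift
at `(X₀, Ξ₀)`. -/
lemma HasGSBound.exists_tfShift_sub {n : ℕ} {σ h C : ℝ} (hσ : 0 < σ) (hh : 0 < h)
    {f : RSpace n → ℂ} (hf : HasGSBound σ h C f) (X₀ Ξ₀ : RSpace n) :
    ∃ L δ : ℝ, 0 ≤ L ∧ 0 < δ ∧ ∀ X Ξ : RSpace n, ‖X - X₀‖ ≤ δ → ‖Ξ - Ξ₀‖ ≤ δ →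
      HasGSBound σ (2 * max 2 (2 ^ σ) * h) (L * (‖X - X₀‖ + ‖Ξ - Ξ₀‖))
        (_root_.tfShift f X Ξ - _root_.tfShift f X₀ Ξ₀) := by
  have hC := hf.nonneg
  have hp : 0 < 1 / σ := by positivity
  set m : ℝ := max 2 (2 ^ σ)
  have hm2 : 2 ≤ m := le_max_left _ _
  obtain ⟨L, hL, HL⟩ := (hf.tfShift hσ hh X₀ Ξ₀).modulate_sub hσ (by positivity)
  set A : ℝ := C * (2 ^ σ * h) * Real.exp ((1 / h) ^ (1 / σ)) *
    Real.exp ((‖X₀‖ / (m * h)) ^ (1 / σ) + σ * ((‖Ξ₀‖ + 1) / (m * h)) ^ (1 / σ))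
  have hA : 0 ≤ A := by positivity
  refine ⟨A + L, min 1 (2 * h), by positivity, by positivity, fun X Ξ hX hΞ => ?_⟩
  have h1 := (hf.translate_sub hσ hh (hX.trans (min_le_left _ _))).tfShift hσ (by positivity) X₀ Ξ
  have h2 := HL _ (hΞ.trans (min_le_right _ _))
  have h1' := h1.mono (h' := 2 * m * h) (C' := A * ‖X - X₀‖) hσ (by positivity)
    (by rw [mul_assoc]) (by
      have : ‖Ξ‖ ≤ ‖Ξ₀‖ + 1 := by
        have h3 := norm_add_le (Ξ - Ξ₀) Ξ₀
        rw [sub_add_cancel] at h3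
        linarith [hΞ.trans (min_le_left _ _)]
      rw [mul_assoc ‖X - X₀‖, mul_comm ‖X - X₀‖]
      refine mul_le_mul_of_nonneg_right ?_ (norm_nonneg _)
      change C * (2 ^ σ * h) * Real.exp ((1 / h) ^ (1 / σ)) *
        Real.exp ((‖X₀‖ / (m * h)) ^ (1 / σ) + σ * (‖Ξ‖ / (m * h)) ^ (1 / σ)) ≤ A
      simp only [A]
      gcongr)
  have h2' := h2.mono (h' := 2 * m * h) (C' := L * ‖Ξ - Ξ₀‖) hσ (by positivity)
    (by rw [← mul_assoc]; gcongr) (by rw [mul_comm])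
  have h3 := h1'.add h2'
  have h4 : _root_.tfShift (fun y => f (y - (X - X₀)) - f y) X₀ Ξ +
      (fun y => (modChar (Ξ - Ξ₀) y - 1) * _root_.tfShift f X₀ Ξ₀ y) =
      _root_.tfShift f X Ξ - _root_.tfShift f X₀ Ξ₀ := by
    ext y
    have h5 := modChar_add Ξ₀ (Ξ - Ξ₀) y
    rw [add_sub_cancel] at h5
    simp only [Pi.add_apply, Pi.sub_apply, _root_.tfShift, h5,
      show y - X₀ - (X - X₀) = y - X by abel]
    ring
  rw [h4] at h3
  refine h3.mono hσ (by positivity) le_rfl ?_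
  have hx := norm_nonneg (X - X₀)
  have hy := norm_nonneg (Ξ - Ξ₀)
  nlinarith [mul_nonneg hA hy, mul_nonneg hL hx]

/-! ### Differentiation under the integral sign -/

section ParametricIntegral

variable {E F Ω : Type*} [NormedAddCommGroup E] [NormedSpace ℝ E]
  [NormedAddCommGroup F] [NormedSpace ℝ F] [MeasurableSpace Ω] {μ : Measure Ω}

lemma integral_clm_apply_of_norm_le [CompleteSpace F] {φ : Ω → E →L[ℝ] F} {b : Ω → ℝ}
    (hφ : AEStronglyMeasurable φ μ) (hb : Integrable b μ) (h : ∀ w, ‖φ w‖ ≤ b w) (v : E) :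
    (∫ w, φ w ∂μ) v = ∫ w, φ w v ∂μ :=
  ContinuousLinearMap.integral_apply (hb.mono' hφ (Filter.Eventually.of_forall h)) v

lemma iteratedFDeriv_integral_aux {G : E → Ω → F}
    (hG : ∀ w, ContDiff ℝ (⊤ : ℕ∞) (fun x => G x w))
    (hm : ∀ k x, AEStronglyMeasurable (fun w => iteratedFDeriv ℝ k (fun x => G x w) x) μ)
    (hb : ∀ k x₀, ∃ b : Ω → ℝ, Integrable b μ ∧ ∀ᵐ w ∂μ, ∀ x ∈ Metric.ball x₀ 1,
      ‖iteratedFDeriv ℝ k (fun x => G x w) x‖ ≤ b w) (k : ℕ) (x₀ : E) :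
    HasFDerivAt (fun x => ∫ w, iteratedFDeriv ℝ k (fun x => G x w) x ∂μ)
      (∫ w, fderiv ℝ (iteratedFDeriv ℝ k (fun x => G x w)) x₀ ∂μ) x₀ := by
  obtain ⟨b, hbi, hb1⟩ := hb (k + 1) x₀
  obtain ⟨b0, hb0i, hb01⟩ := hb k x₀
  have hcurry : ∀ w x, fderiv ℝ (iteratedFDeriv ℝ k (fun x => G x w)) x =
      continuousMultilinearCurryLeftEquiv ℝ (fun _ : Fin (k + 1) => E) F
        (iteratedFDeriv ℝ (k + 1) (fun x => G x w) x) := by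
    intro w x
    rw [iteratedFDeriv_succ_eq_comp_left]
    simp
  refine hasFDerivAt_integral_of_dominated_of_fderiv_le (bound := b) (𝕜 := ℝ)
    (F' := fun x w => fderiv ℝ (iteratedFDeriv ℝ k (fun x => G x w)) x)
    (Metric.ball_mem_nhds x₀ one_pos) (Filter.Eventually.of_forall fun x => hm k x) ?_ ?_ ?_ hbi ?_
  · exact hb0i.mono' (hm k x₀) (hb01.mono fun w hw => hw x₀ (Metric.mem_ball_self one_pos))
  · simp_rw [hcurry]
    exact (LinearIsometryEquiv.continuous _).comp_aestronglyMeasurable (hm (k + 1) x₀)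
  · refine hb1.mono fun w hw x hx => ?_
    rw [norm_fderiv_iteratedFDeriv]
    exact hw x hx
  · refine Filter.Eventually.of_forall fun w x _ => ?_
    exact ((hG w).differentiable_iteratedFDeriv (by exact_mod_cast ENat.natCast_lt_top k)
      x).hasFDerivAt

/-- Induction on the order, each step being differentiation under the integral sign with the bound
of the next order. Bounds that are local in `x` and hold for almost every `w` suffice, as needed in
`hasSymbolBound_tfSynthesis`. -/
lemma iteratedFDeriv_integral [CompleteSpace F] {G : E → Ω → F}
    (hG : ∀ w, ContDiff ℝ (⊤ : ℕ∞) (fun x => G x w))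
    (hm : ∀ k x, AEStronglyMeasurable (fun w => iteratedFDeriv ℝ k (fun x => G x w) x) μ)
    (hb : ∀ k x₀, ∃ b : Ω → ℝ, Integrable b μ ∧ ∀ᵐ w ∂μ, ∀ x ∈ Metric.ball x₀ 1,
      ‖iteratedFDeriv ℝ k (fun x => G x w) x‖ ≤ b w) :
    ContDiff ℝ (⊤ : ℕ∞) (fun x => ∫ w, G x w ∂μ) ∧
      ∀ k x, iteratedFDeriv ℝ k (fun x => ∫ w, G x w ∂μ) x =
        ∫ w, iteratedFDeriv ℝ k (fun x => G x w) x ∂μ := by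
  have hder := iteratedFDeriv_integral_aux hG hm hb
  have hint : ∀ k x, Integrable (fun w => iteratedFDeriv ℝ k (fun x => G x w) x) μ := by
    intro k x
    obtain ⟨b, hbi, hb1⟩ := hb k x
    exact hbi.mono' (hm k x) (hb1.mono fun w hw => hw x (Metric.mem_ball_self one_pos))
  have hfd : ∀ k x v, (∫ w, fderiv ℝ (iteratedFDeriv ℝ k (fun x => G x w)) x ∂μ) v =
      ∫ w, fderiv ℝ (iteratedFDeriv ℝ k (fun x => G x w)) x v ∂μ ∧
      Integrable (fun w => fderiv ℝ (iteratedFDeriv ℝ k (fun x => G x w)) x v) μ := by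
    intro k x v
    have hcurry : ∀ w, fderiv ℝ (iteratedFDeriv ℝ k (fun x => G x w)) x =
        continuousMultilinearCurryLeftEquiv ℝ (fun _ : Fin (k + 1) => E) F
          (iteratedFDeriv ℝ (k + 1) (fun x => G x w) x) := by
      intro w
      rw [iteratedFDeriv_succ_eq_comp_left]
      simp
    have hmeas : AEStronglyMeasurable
        (fun w => fderiv ℝ (iteratedFDeriv ℝ k (fun x => G x w)) x) μ := by
      simp_rw [hcurry]
      exact (LinearIsometryEquiv.continuous _).comp_aestronglyMeasurable (hm (k + 1) x)
    have hnorm : ∀ w, ‖fderiv ℝ (iteratedFDeriv ℝ k (fun x => G x w)) x‖ ≤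
        ‖iteratedFDeriv ℝ (k + 1) (fun x => G x w) x‖ := fun w => (norm_fderiv_iteratedFDeriv).le
    refine ⟨?_, ((hint (k + 1) x).norm.mul_const ‖v‖).mono'
      (hmeas.apply_continuousLinearMap v) (Filter.Eventually.of_forall fun w =>
        (ContinuousLinearMap.le_opNorm _ v).trans
          (mul_le_mul_of_nonneg_right (hnorm w) (norm_nonneg v)))⟩
    exact integral_clm_apply_of_norm_le (F := ContinuousMultilinearMap ℝ (fun _ : Fin k => E) F)
      (φ := fun w => fderiv ℝ (iteratedFDeriv ℝ k (fun x => G x w)) x)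
      (b := fun w => ‖iteratedFDeriv ℝ (k + 1) (fun x => G x w) x‖) hmeas (hint (k + 1) x).norm
      hnorm v
  have key : ∀ k, iteratedFDeriv ℝ k (fun x => ∫ w, G x w ∂μ) =
      fun x => ∫ w, iteratedFDeriv ℝ k (fun x => G x w) x ∂μ := by
    intro k
    induction k with
    | zero =>
      ext x v
      rw [iteratedFDeriv_zero_apply, ContinuousMultilinearMap.integral_apply (hint 0 x)]
      simp
    | succ k ih =>
      ext1 x
      ext v
      rw [iteratedFDeriv_succ_apply_left, ih, (hder k x).fderiv,
        ContinuousMultilinearMap.integral_apply (hint (k + 1) x),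
        (hfd k x _).1, ContinuousMultilinearMap.integral_apply (hfd k x _).2]
      simp_rw [iteratedFDeriv_succ_apply_left]
  refine ⟨?_, fun k x => congrFun (key k) x⟩
  refine contDiff_of_differentiable_iteratedFDeriv fun k _ => ?_
  rw [key]
  exact fun x => (hder k x).differentiableAt

end ParametricIntegral

/-! ### Decay of Fourier transforms -/

section FourierDecay

open scoped FourierTransform

lemma integral_modChar_mul_eq_fourier {n : ℕ} (W : RSpace n → ℂ) (Ξ : RSpace n) :
    ∫ y, modChar Ξ y * W y = 𝓕 W ((2 * Real.pi)⁻¹ • Ξ) := by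
  rw [Real.fourier_eq']
  congr 1
  ext y
  rw [modChar, inner_smul_right, smul_eq_mul]
  congr 2
  push_cast
  have : (Real.pi : ℂ) ≠ 0 := by exact_mod_cast Real.pi_ne_zero
  field_simp

/-- The Fourier transform of `DᵏW`, evaluated on `k` copies of `Ξ`, is that of `W` times a factor of
modulus `‖Ξ‖^{2k}`, while the operator norm contributes only `‖Ξ‖^k`. -/
lemma pow_mul_norm_integral_modChar_le {n : ℕ} {W : RSpace n → ℂ} (hW : ContDiff ℝ (⊤ : ℕ∞) W)
    (hi : ∀ k, Integrable (iteratedFDeriv ℝ k W)) (Ξ : RSpace n) (k : ℕ) :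
    ‖∫ y, modChar Ξ y * W y‖ * ‖Ξ‖ ^ k ≤ ∫ y, ‖iteratedFDeriv ℝ k W y‖ := by
  rw [integral_modChar_mul_eq_fourier]
  have h1 := Real.fourier_iteratedFDeriv (N := ⊤) hW (fun k _ => hi k) (n := k) le_top
  have hpi := Real.pi_pos
  rcases eq_or_ne Ξ 0 with rfl | hΞ
  · rcases Nat.eq_zero_or_pos k with rfl | hk
    · simp only [norm_zero, pow_zero, mul_one, norm_iteratedFDeriv_zero]
      exact VectorFourier.norm_fourierIntegral_le_integral_norm _ _ _ _ _
    · rw [norm_zero, zero_pow hk.ne', mul_zero]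
      exact integral_nonneg fun _ => norm_nonneg _
  · have hpos : 0 < ‖Ξ‖ := norm_pos_iff.2 hΞ
    have h2 := congrFun h1 ((2 * Real.pi)⁻¹ • Ξ)
    have h3 := congrArg (fun T => ‖T (fun _ => Ξ)‖) h2
    simp only [VectorFourier.fourierPowSMulRight_apply] at h3
    have h4 : ‖𝓕 (iteratedFDeriv ℝ k W) ((2 * Real.pi)⁻¹ • Ξ) (fun _ => Ξ)‖ ≤
        (∫ y, ‖iteratedFDeriv ℝ k W y‖) * ‖Ξ‖ ^ k := by
      refine (ContinuousMultilinearMap.le_opNorm _ _).trans ?_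
      rw [Finset.prod_const, Finset.card_univ, Fintype.card_fin]
      gcongr
      exact VectorFourier.norm_fourierIntegral_le_integral_norm _ _ _ _ _
    rw [h3] at h4
    simp only [neg_apply, Finset.prod_const, Finset.card_univ, Fintype.card_fin, norm_smul,
      norm_pow, norm_neg, norm_mul, Complex.norm_I, mul_one, Complex.norm_ofNat, Complex.norm_real,
      Real.norm_eq_abs, abs_of_pos hpi] at h4
    change (2 * Real.pi) ^ k * (|inner ℝ ((2 * Real.pi)⁻¹ • Ξ) Ξ| ^ k * _) ≤ _ at h4
    rw [real_inner_smul_left, real_inner_self_eq_norm_sq, abs_of_nonneg (by positivity),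
      ← mul_assoc, ← mul_pow,
      show 2 * Real.pi * ((2 * Real.pi)⁻¹ * ‖Ξ‖ ^ 2) = ‖Ξ‖ * ‖Ξ‖ by field_simp, mul_pow,
      mul_assoc, mul_comm] at h4
    have := le_of_mul_le_mul_right h4 (by positivity)
    rwa [mul_comm] at this

/-- The bounds with `‖Ξ‖^k` for all `k` feed `le_exp_of_forall_pow_le`. The constant `M` enters
linearly, so that its dependence on a position `X` is carried along. -/
lemma norm_integral_modChar_mul_le {n : ℕ} {σ h M : ℝ} (hσ : 0 < σ) (hh : 0 < h)
    {W : RSpace n → ℂ} (hW : ContDiff ℝ (⊤ : ℕ∞) W)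
    {b : RSpace n → ℝ} (hb : Integrable b) (hb0 : ∀ y, 0 ≤ b y) (hM : 0 ≤ M)
    (hWb : ∀ k y, ‖iteratedFDeriv ℝ k W y‖ ≤ M * (h ^ k * (k.factorial : ℝ) ^ σ) * b y)
    (Ξ : RSpace n) :
    ‖∫ y, modChar Ξ y * W y‖ ≤
      2 ^ σ * (M * ∫ y, b y) * Real.exp (-(‖Ξ‖ / ((2 / σ) ^ σ * h)) ^ (1 / σ)) := by
  have hi : ∀ k, Integrable (iteratedFDeriv ℝ k W) := fun k =>
    (hb.const_mul _).mono' (hW.continuous_iteratedFDeriv (by exact_mod_cast le_top)).aestronglyMeasurable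
      (Filter.Eventually.of_forall (hWb k))
  have hexp : σ / 2 * (‖Ξ‖ / h) ^ (1 / σ) = (‖Ξ‖ / ((2 / σ) ^ σ * h)) ^ (1 / σ) := by
    rw [show ‖Ξ‖ / ((2 / σ) ^ σ * h) = ‖Ξ‖ / h / (2 / σ) ^ σ by field_simp,
      Real.div_rpow (x := ‖Ξ‖ / h) (by positivity) (by positivity), ← Real.rpow_mul (by positivity),
      mul_one_div_cancel hσ.ne', Real.rpow_one]
    field_simp
  rw [← hexp]
  have hbi : 0 ≤ ∫ y, b y := integral_nonneg hb0
  refine le_exp_of_forall_pow_le hσ (norm_nonneg _) (by positivity) hh (norm_nonneg _) fun k => ?_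
  refine (pow_mul_norm_integral_modChar_le hW hi Ξ k).trans ?_
  refine (integral_mono (hi k).norm (hb.const_mul _) (hWb k)).trans_eq ?_
  rw [integral_const_mul]
  ring

end FourierDecay

/-! ### Embedding of the Gelfand-Shilov norms into a space of bounded families -/

/-- The index set of the weighted suprema in `gsNorm`. -/
abbrev GSIndex (n : ℕ) : Type := (Fin n → ℕ) × (Fin n → ℕ) × RSpace n

/-- The weight in front of the derivative `∂^α f(x)` in `gsNorm`. -/
def gsCoeff {n : ℕ} (σ h : ℝ) (i : GSIndex n) : ℝ :=
  multiPow i.2.2 i.2.1 /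
    (h ^ (multiOrder i.1 + multiOrder i.2.1) * multiFactorial i.1 ^ σ * multiFactorial i.2.1 ^ σ)

/-- The family of all `x^β ∂^α f(x) / (h^{|α|+|β|} α!^σ β!^σ)`. -/
def gsCoord {n : ℕ} (σ h : ℝ) (f : RSpace n → ℂ) (i : GSIndex n) : ℂ :=
  (gsCoeff σ h i : ℂ) * partialD i.1 f i.2.2

lemma norm_gsCoord {n : ℕ} {σ h : ℝ} (hh : 0 < h) (f : RSpace n → ℂ) (i : GSIndex n) :
    ‖gsCoord σ h f i‖ = |multiPow i.2.2 i.2.1| * ‖partialD i.1 f i.2.2‖ /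
      (h ^ (multiOrder i.1 + multiOrder i.2.1) * multiFactorial i.1 ^ σ *
        multiFactorial i.2.1 ^ σ) := by
  have h1 := Real.rpow_pos_of_pos (multiFactorial_pos i.1) σ
  have h2 := Real.rpow_pos_of_pos (multiFactorial_pos i.2.1) σ
  rw [gsCoord, norm_mul, Complex.norm_real, Real.norm_eq_abs, gsCoeff, abs_div,
    abs_of_pos (a := h ^ _ * _ * _) (by positivity)]
  ring

lemma norm_gsCoord_le {n : ℕ} {σ h M : ℝ} (hh : 0 < h) (hM : 0 ≤ M) {f : RSpace n → ℂ}
    (hf : gsNorm σ σ h f ≤ ENNReal.ofReal M) (i : GSIndex n) : ‖gsCoord σ h f i‖ ≤ M := by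
  have h1 := Real.rpow_pos_of_pos (multiFactorial_pos i.1) σ
  have h2 := Real.rpow_pos_of_pos (multiFactorial_pos i.2.1) σ
  rw [norm_gsCoord hh, div_le_iff₀ (by positivity)]
  exact le_of_gsNorm_le hh hM hf _ _ _

lemma gsNorm_le_of_norm_gsCoord {n : ℕ} {σ h M : ℝ} (hh : 0 < h) {f : RSpace n → ℂ}
    (hf : ∀ i, ‖gsCoord σ h f i‖ ≤ M) : gsNorm σ σ h f ≤ ENNReal.ofReal M := by
  refine iSup_le fun α => iSup_le fun β => iSup_le fun x => ENNReal.ofReal_le_ofReal ?_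
  rw [← norm_gsCoord hh f (α, β, x)]
  exact hf _

/-- The Banach space of bounded families. -/
abbrev GSFamily (n : ℕ) : Type := lp (fun _ : GSIndex n => ℂ) ⊤

lemma memℓp_gsCoord {n : ℕ} {σ h : ℝ} (hh : 0 < h) {f : RSpace n → ℂ}
    (hf : gsNorm σ σ h f < ⊤) : Memℓp (E := fun _ : GSIndex n => ℂ) (gsCoord σ h f) ⊤ := by
  refine memℓp_infty ⟨(gsNorm σ σ h f).toReal, ?_⟩
  rintro _ ⟨i, rfl⟩
  exact norm_gsCoord_le hh ENNReal.toReal_nonneg (ENNReal.ofReal_toReal hf.ne).ge i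

/-- Evaluation of a bounded family. -/
def familyEval {n : ℕ} (i : GSIndex n) : GSFamily n →L[ℂ] ℂ :=
  LinearMap.mkContinuous
    { toFun := fun g => g i
      map_add' := fun _ _ => rfl
      map_smul' := fun _ _ => rfl } 1
    fun g => by
      rw [one_mul]
      exact lp.norm_apply_le_norm (by simp) g i

lemma familyEval_apply {n : ℕ} (i : GSIndex n) (g : GSFamily n) : familyEval i g = g i := rfl

lemma gsCoord_add {n : ℕ} {σ h : ℝ} {f g : RSpace n → ℂ} (hf : ContDiff ℝ (⊤ : ℕ∞) f)
    (hg : ContDiff ℝ (⊤ : ℕ∞) g) : gsCoord σ h (f + g) = gsCoord σ h f + gsCoord σ h g := by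
  ext i
  simp only [gsCoord, Pi.add_apply, partialD_add hf hg]
  ring

lemma gsCoord_smul {n : ℕ} {σ h : ℝ} (c : ℂ) {f : RSpace n → ℂ} (hf : ContDiff ℝ (⊤ : ℕ∞) f) :
    gsCoord σ h (c • f) = c • gsCoord σ h f := by
  ext i
  simp only [gsCoord, Pi.smul_apply, smul_eq_mul, partialD_smul c hf]
  ring

lemma eq_zero_of_gsCoord {n : ℕ} {σ h : ℝ} (hh : 0 < h) {f : RSpace n → ℂ}
    (hf : ContDiff ℝ (⊤ : ℕ∞) f) (h0 : gsCoord σ h f = 0) : f = 0 := by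
  ext x
  obtain ⟨α, -, h1⟩ := partialD_eq_iteratedFDeriv hf (Fin.elim0 : Fin 0 → Fin n) x
  rw [iteratedFDeriv_zero_apply] at h1
  have h2 := congrFun h0 (α, 0, x)
  have h3 := Real.rpow_pos_of_pos (multiFactorial_pos α) σ
  have h4 : gsCoeff σ h (α, (0 : Fin n → ℕ), x) ≠ 0 := by
    have h5 := Real.rpow_pos_of_pos (multiFactorial_pos (0 : Fin n → ℕ)) σ
    have : multiPow x 0 = 1 := by simp [multiPow]
    simp only [gsCoeff, this]
    positivity
  simp only [gsCoord, Pi.zero_apply, mul_eq_zero, ofReal_eq_zero, h4, false_or] at h2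
  rw [h1, h2, Pi.zero_apply]

/-- The weighted derivatives embed the test functions of finite norm into a space of bounded
families, and Hahn-Banach extends the functional. Integrals of test functions can then be taken as
Bochner integrals of families, without completeness of a space of test functions. -/
lemma exists_extension_to_families {n : ℕ} {σ h : ℝ} (hh : 0 < h) {T : Submodule ℂ (RSpace n → ℂ)}
    (hT : ∀ f ∈ T, ContDiff ℝ (⊤ : ℕ∞) f) (u : T →ₗ[ℂ] ℂ) (C : ℝ≥0)
    (hu : ∀ f : T, gsNorm σ σ h (f : RSpace n → ℂ) < ⊤ →
      ‖u f‖ₑ ≤ C * gsNorm σ σ h (f : RSpace n → ℂ)) :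
    ∃ U : GSFamily n →L[ℂ] ℂ, ∀ (f : T), gsNorm σ σ h (f : RSpace n → ℂ) < ⊤ → ∀ g : GSFamily n,
      (g : GSIndex n → ℂ) = gsCoord σ h (f : RSpace n → ℂ) → U g = u f := by
  let P : Submodule ℂ T :=
    { carrier := {f | gsNorm σ σ h (f : RSpace n → ℂ) < ⊤}
      zero_mem' := by
        change gsNorm σ σ h (0 : RSpace n → ℂ) < ⊤
        rw [gsNorm_zero]; exact ENNReal.zero_lt_top
      add_mem' := fun {f g} hf hg =>
        (gsNorm_add_le hh (hT _ f.2) (hT _ g.2)).trans_lt (ENNReal.add_lt_top.2 ⟨hf, hg⟩)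
      smul_mem' := fun c f hf =>
        (gsNorm_smul_le c (hT _ f.2)).trans_lt (ENNReal.mul_lt_top ENNReal.ofReal_lt_top hf) }
  let J : P →ₗ[ℂ] GSFamily n :=
    { toFun := fun f => ⟨gsCoord σ h (f : RSpace n → ℂ), memℓp_gsCoord hh f.2⟩
      map_add' := fun f g => Subtype.ext (gsCoord_add (hT _ f.1.2) (hT _ g.1.2))
      map_smul' := fun c f => Subtype.ext (gsCoord_smul c (hT _ f.1.2)) }
  have hJ : Function.Injective J := by
    rw [injective_iff_map_eq_zero]
    intro f hf
    have h1 : gsCoord σ h (f : RSpace n → ℂ) = 0 := congrArg Subtype.val hf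
    exact Subtype.ext (Subtype.ext (eq_zero_of_gsCoord hh (hT _ f.1.2) h1))
  let e := LinearEquiv.ofInjective J hJ
  let φ : LinearMap.range J →L[ℂ] ℂ := LinearMap.mkContinuous
    ((u ∘ₗ P.subtype) ∘ₗ e.symm.toLinearMap) C (by
      intro y
      obtain ⟨f, rfl⟩ := e.surjective y
      simp only [LinearMap.comp_apply, LinearEquiv.coe_coe, LinearEquiv.symm_apply_apply]
      have h1 : gsNorm σ σ h (f : RSpace n → ℂ) ≤ ENNReal.ofReal ‖J f‖ :=
        gsNorm_le_of_norm_gsCoord hh fun i => lp.norm_apply_le_norm (by simp) (J f) i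
      have h2 := (hu f f.2).trans (mul_le_mul_right h1 _)
      rw [← ofReal_norm, ← ENNReal.ofReal_coe_nnreal, ← ENNReal.ofReal_mul (by positivity),
        ENNReal.ofReal_le_ofReal_iff (by positivity)] at h2
      exact h2)
  obtain ⟨U, hU, -⟩ := exists_extension_norm_eq (LinearMap.range J) φ
  refine ⟨U, fun f hf g hg => ?_⟩
  have h1 : g = (e ⟨f, hf⟩ : GSFamily n) := Subtype.ext hg
  rw [h1, hU]
  simp [φ]

/-! ### The inversion formula for the short-time Fourier transform -/

section Coefficients

open scoped FourierTransform

/-- The coefficient `∫ f(Z) conj(ψ(Z - X) e^{-i⟨Z, Ξ⟩}) dZ`. -/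
def tfCoeff {n : ℕ} (f ψ : RSpace n → ℂ) (p : RSpace n × RSpace n) : ℂ :=
  ∫ Z, f Z * (starRingEnd ℂ) (tfShift ψ p.1 p.2 Z)

lemma conj_modChar {n : ℕ} (Ξ y : RSpace n) : (starRingEnd ℂ) (modChar Ξ y) = modChar (-Ξ) y := by
  rw [modChar, modChar, ← Complex.exp_conj, inner_neg_right]
  simp

lemma conj_tfShift {n : ℕ} (ψ : RSpace n → ℂ) (X Ξ y : RSpace n) :
    (starRingEnd ℂ) (tfShift ψ X Ξ y) = tfShift (fun z => (starRingEnd ℂ) (ψ z)) X (-Ξ) y := by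
  rw [tfShift, map_mul, conj_modChar]
  rfl

lemma HasGSBound.conj {n : ℕ} {σ h C : ℝ} {f : RSpace n → ℂ} (hf : HasGSBound σ h C f) :
    HasGSBound σ h C (fun z => (starRingEnd ℂ) (f z)) := by
  refine ⟨conjCLE.contDiff.comp hf.1, fun k x => ?_⟩
  have h := conjLIE.norm_iteratedFDeriv_comp_left (𝕜 := ℝ) f x k
  refine le_trans (le_of_eq ?_) (hf.2 k x)
  rw [← h]
  rfl

lemma HasGSBound.norm_le {n : ℕ} {σ h C : ℝ} {f : RSpace n → ℂ} (hf : HasGSBound σ h C f)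
    (x : RSpace n) : ‖f x‖ ≤ C * Real.exp (-(‖x‖ / h) ^ (1 / σ)) := by
  simpa using hf.2 0 x

lemma HasGSBound.norm_le_const {n : ℕ} {σ h C : ℝ} (hh : 0 < h) {f : RSpace n → ℂ}
    (hf : HasGSBound σ h C f) (x : RSpace n) : ‖f x‖ ≤ C := by
  refine (hf.norm_le x).trans (mul_le_of_le_one_right hf.nonneg ?_)
  rw [Real.exp_le_one_iff, neg_nonpos]
  positivity

lemma HasGSBound.integrable {n : ℕ} {σ h C : ℝ} (hσ : 0 < σ) (hh : 0 < h) {f : RSpace n → ℂ}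
    (hf : HasGSBound σ h C f) : Integrable f :=
  ((integrable_exp_neg_div_rpow (by positivity) hh).const_mul C).mono'
    hf.1.continuous.aestronglyMeasurable (Filter.Eventually.of_forall hf.norm_le)

lemma tfCoeff_eq {n : ℕ} (f ψ : RSpace n → ℂ) (X Ξ : RSpace n) :
    tfCoeff f ψ (X, Ξ) = ∫ Z, modChar (-Ξ) Z * (f Z * (starRingEnd ℂ) (ψ (Z - X))) := by
  unfold tfCoeff
  congr 1
  ext Z
  rw [conj_tfShift, tfShift]
  ring

/-- The decay rate of `tfCoeff`. -/
def coeffRate (σ : ℝ) : ℝ := min (1 / 2 * (1 / 2) ^ (1 / σ)) ((1 / (2 * (2 / σ) ^ σ)) ^ (1 / σ))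

lemma coeffRate_pos {σ : ℝ} (hσ : 0 < σ) : 0 < coeffRate σ :=
  lt_min (by positivity) (by positivity)

/-- The coefficient is a Fourier integral of `f` times a translate of the conjugate window. Half of
the decay of `f` is kept for integrability; the other half together with the window gives decay in
`X`. Measured in `‖X‖/h` and `‖Ξ‖/h`, the rate does not depend on `h`. -/
lemma exists_norm_tfCoeff_le {n : ℕ} {σ h C C' : ℝ} (hσ : 0 < σ) (hh : 0 < h) {f ψ : RSpace n → ℂ}
    (hf : HasGSBound σ h C f) (hψ : HasGSBound σ h C' ψ) :
    ∃ K : ℝ, 0 ≤ K ∧ ∀ X Ξ : RSpace n, ‖tfCoeff f ψ (X, Ξ)‖ ≤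
      K * Real.exp (-(coeffRate σ * ((‖X‖ / h) ^ (1 / σ) + (‖Ξ‖ / h) ^ (1 / σ)))) := by
  have hC := hf.nonneg
  have hC' := hψ.nonneg
  have hp : 0 < 1 / σ := by positivity
  set b : RSpace n → ℝ := fun Z => Real.exp (-(1 / 2 * (1 / h) ^ (1 / σ) * ‖Z‖ ^ (1 / σ)))
  have hb : Integrable b := integrable_exp_neg_norm_rpow hp (by positivity)
  have hb0 : 0 ≤ ∫ Z, b Z := integral_nonneg fun _ => (Real.exp_pos _).le
  refine ⟨2 ^ σ * (C * C' * ∫ Z, b Z), by positivity, fun X Ξ => ?_⟩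
  rw [tfCoeff_eq]
  have hc : ContDiff ℝ (⊤ : ℕ∞) (fun Z => (starRingEnd ℂ) (ψ (Z - X))) :=
    hψ.conj.1.comp (contDiff_id.sub contDiff_const)
  have hW : ∀ k Z, ‖iteratedFDeriv ℝ k (fun Z => f Z * (starRingEnd ℂ) (ψ (Z - X))) Z‖ ≤
      (C * C' * Real.exp (-(1 / 2 * (‖X‖ / (2 * h)) ^ (1 / σ)))) *
        ((2 * h) ^ k * (k.factorial : ℝ) ^ σ) * b Z := by
    intro k Z
    have h1 : ∀ j ≤ k, ‖iteratedFDeriv ℝ j f Z‖ ≤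
        (C * Real.exp (-(‖Z‖ / h) ^ (1 / σ))) * (h ^ j * (j.factorial : ℝ) ^ σ) := fun j _ =>
      (hf.2 j Z).trans_eq (by ring)
    have h2 : ∀ j ≤ k, ‖iteratedFDeriv ℝ j (fun Z => (starRingEnd ℂ) (ψ (Z - X))) Z‖ ≤
        (C' * Real.exp (-(‖Z - X‖ / h) ^ (1 / σ))) * (h ^ j * (j.factorial : ℝ) ^ σ) := by
      intro j _
      rw [iteratedFDeriv_comp_sub' (f := fun z => (starRingEnd ℂ) (ψ z))]
      exact (hψ.conj.2 j (Z - X)).trans_eq (by ring)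
    refine (norm_iteratedFDeriv_smul_le_of_le hσ.le (by positivity) hh.le (by positivity) hh.le
      hf.1 hc h1 h2).trans ?_
    have h3 : Real.exp (-(‖Z‖ / h) ^ (1 / σ)) * Real.exp (-(‖Z - X‖ / h) ^ (1 / σ)) ≤
        Real.exp (-(1 / 2 * (‖X‖ / (2 * h)) ^ (1 / σ))) * b Z := by
      simp only [b]
      rw [← Real.exp_add, ← Real.exp_add, mul_assoc, ← div_rpow_norm_eq hh]
      refine Real.exp_le_exp.2 ?_
      have h4 := neg_div_rpow_le hp.le hh Z X
      rw [norm_sub_rev X Z] at h4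
      have h5 : 0 ≤ (‖Z - X‖ / h) ^ (1 / σ) := by positivity
      linarith
    calc _ = C * C' * (Real.exp (-(‖Z‖ / h) ^ (1 / σ)) * Real.exp (-(‖Z - X‖ / h) ^ (1 / σ))) *
          ((2 * h) ^ k * (k.factorial : ℝ) ^ σ) := by ring
      _ ≤ C * C' * (Real.exp (-(1 / 2 * (‖X‖ / (2 * h)) ^ (1 / σ))) * b Z) *
          ((2 * h) ^ k * (k.factorial : ℝ) ^ σ) := by gcongr
      _ = _ := by ring
  refine (norm_integral_modChar_mul_le hσ (by positivity) (hf.1.mul hc) hb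
    (fun _ => (Real.exp_pos _).le) (by positivity) hW (-Ξ)).trans ?_
  rw [norm_neg]
  have h6 : Real.exp (-(1 / 2 * (‖X‖ / (2 * h)) ^ (1 / σ))) *
      Real.exp (-(‖Ξ‖ / ((2 / σ) ^ σ * (2 * h))) ^ (1 / σ)) ≤
      Real.exp (-(coeffRate σ * ((‖X‖ / h) ^ (1 / σ) + (‖Ξ‖ / h) ^ (1 / σ)))) := by
    rw [← Real.exp_add]
    refine Real.exp_le_exp.2 ?_
    rw [show ‖X‖ / (2 * h) = 1 / 2 * (‖X‖ / h) by field_simp,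
      show ‖Ξ‖ / ((2 / σ) ^ σ * (2 * h)) = 1 / (2 * (2 / σ) ^ σ) * (‖Ξ‖ / h) by field_simp,
      Real.mul_rpow (by positivity) (by positivity), Real.mul_rpow (by positivity) (by positivity)]
    have h7 : coeffRate σ * (‖X‖ / h) ^ (1 / σ) ≤ 1 / 2 * (1 / 2) ^ (1 / σ) * (‖X‖ / h) ^ (1 / σ) :=
      mul_le_mul_of_nonneg_right (min_le_left _ _) (by positivity)
    have h8 : coeffRate σ * (‖Ξ‖ / h) ^ (1 / σ) ≤
        (1 / (2 * (2 / σ) ^ σ)) ^ (1 / σ) * (‖Ξ‖ / h) ^ (1 / σ) :=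
      mul_le_mul_of_nonneg_right (min_le_right _ _) (by positivity)
    linarith
  calc _ = 2 ^ σ * (C * C' * ∫ Z, b Z) * (Real.exp (-(1 / 2 * (‖X‖ / (2 * h)) ^ (1 / σ))) *
        Real.exp (-(‖Ξ‖ / ((2 / σ) ^ σ * (2 * h))) ^ (1 / σ))) := by ring
    _ ≤ _ := by gcongr

lemma integral_modChar_mul_fourier {n : ℕ} {W : RSpace n → ℂ} (hc : Continuous W)
    (hW : Integrable W) (hi : Integrable (fun Ξ => ∫ Z, modChar (-Ξ) Z * W Z)) (Y : RSpace n) :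
    ∫ Ξ, modChar Ξ Y * ∫ Z, modChar (-Ξ) Z * W Z = (2 * Real.pi) ^ n * W Y := by
  have hpi := Real.pi_pos
  -- The substitution `Ξ = -2πw` passes to the normalization of `𝓕`; its Jacobian is the factor
  -- `(2π)^n`.
  set R : ℝ := -(2 * Real.pi)
  have hR : R ≠ 0 := by simp [R, hpi.ne']
  have h1 : ∀ w : RSpace n, ∫ Z, modChar (-(R • w)) Z * W Z = 𝓕 W w := by
    intro w
    rw [integral_modChar_mul_eq_fourier, ← neg_smul, smul_smul]
    rw [neg_neg, inv_mul_cancel₀ (by positivity), one_smul]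
  have h2 : Integrable (𝓕 W) := by
    have := hi.comp_smul hR
    simp_rw [h1] at this
    exact this
  have h3 := hW.fourierInv_fourier_eq h2 (v := Y) hc.continuousAt
  have h4 := Measure.integral_comp_smul (volume : Measure (RSpace n))
    (fun Ξ => modChar Ξ Y * ∫ Z, modChar (-Ξ) Z * W Z) R
  simp_rw [h1] at h4
  rw [Real.fourierInv_eq'] at h3
  have h5 : ∫ w, modChar (R • w) Y * 𝓕 W w = W Y := by
    rw [← h3]
    congr 1
    ext w
    rw [smul_eq_mul, modChar, inner_smul_right, real_inner_comm]
    congr 2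
    simp only [R]
    push_cast
    ring
  rw [h5, finrank_euclideanSpace_fin] at h4
  rw [h4, Complex.real_smul, ← mul_assoc]
  have h6 : |(R ^ n)⁻¹| = ((2 * Real.pi) ^ n)⁻¹ := by
    rw [abs_inv, abs_pow, abs_neg, abs_of_pos (by positivity)]
  have h7 : ((2 : ℂ) * Real.pi) ^ n ≠ 0 := pow_ne_zero _ (by
    have : (Real.pi : ℂ) ≠ 0 := by exact_mod_cast hpi.ne'
    simp [this])
  rw [h6]
  push_cast
  rw [mul_inv_cancel₀ h7, one_mul]

end Coefficients

lemma continuous_tfShift_param {n : ℕ} {ψ : RSpace n → ℂ} (hψ : Continuous ψ) (Z : RSpace n) :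
    Continuous (fun p : RSpace n × RSpace n => tfShift ψ p.1 p.2 Z) := by
  unfold tfShift modChar
  fun_prop

/-- By `HasGSBound.exists_tfShift_sub`, it is enough to control increments linearly by a bound for
the increment of the shift. This serves derivatives at a point and the map into bounded families
alike. -/
lemma continuous_of_tfShift_sub {n : ℕ} {σ h C : ℝ} (hσ : 0 < σ) (hh : 0 < h) {ψ : RSpace n → ℂ}
    (hψ : HasGSBound σ h C ψ) {B : Type*} [SeminormedAddCommGroup B]
    (Φ : RSpace n × RSpace n → B) (K : ℝ)
    (hΦ : ∀ p p₀ M, HasGSBound σ (2 * max 2 (2 ^ σ) * h) M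
      (tfShift ψ p.1 p.2 - tfShift ψ p₀.1 p₀.2) → ‖Φ p - Φ p₀‖ ≤ K * M) : Continuous Φ := by
  rw [continuous_iff_continuousAt]
  intro p₀
  obtain ⟨L, δ, hL, hδ, H⟩ := hψ.exists_tfShift_sub hσ hh p₀.1 p₀.2
  rw [ContinuousAt, tendsto_iff_norm_sub_tendsto_zero]
  have hlim : Filter.Tendsto (fun p : RSpace n × RSpace n =>
      K * (L * (‖p.1 - p₀.1‖ + ‖p.2 - p₀.2‖))) (nhds p₀) (nhds 0) := by
    have : Continuous (fun p : RSpace n × RSpace n =>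
      K * (L * (‖p.1 - p₀.1‖ + ‖p.2 - p₀.2‖))) := by fun_prop
    simpa using this.tendsto p₀
  refine tendsto_of_tendsto_of_tendsto_of_le_of_le' tendsto_const_nhds hlim
    (Filter.Eventually.of_forall fun _ => norm_nonneg _) ?_
  filter_upwards [Metric.closedBall_mem_nhds p₀ hδ] with p hp
  rw [Metric.mem_closedBall, dist_eq_norm, Prod.norm_def, max_le_iff] at hp
  exact hΦ p p₀ _ (H p.1 p.2 hp.1 hp.2)

lemma continuous_iteratedFDeriv_tfShift {n : ℕ} {σ h C : ℝ} (hσ : 0 < σ) (hh : 0 < h)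
    {ψ : RSpace n → ℂ} (hψ : HasGSBound σ h C ψ) (k : ℕ) (x : RSpace n) :
    Continuous (fun p : RSpace n × RSpace n => iteratedFDeriv ℝ k (tfShift ψ p.1 p.2) x) := by
  refine continuous_of_tfShift_sub hσ hh hψ _ ((2 * max 2 (2 ^ σ) * h) ^ k * (k.factorial : ℝ) ^ σ *
    Real.exp (-(‖x‖ / (2 * max 2 (2 ^ σ) * h)) ^ (1 / σ))) fun p p₀ M hM => ?_
  have h1 := hM.2 k x
  rw [iteratedFDeriv_sub_apply
    (((contDiff_tfShift hψ.1 _ _).of_le (by exact_mod_cast le_top)).contDiffAt)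
    (((contDiff_tfShift hψ.1 _ _).of_le (by exact_mod_cast le_top)).contDiffAt)] at h1
  linarith

lemma continuous_tfCoeff {n : ℕ} {σ h C C' : ℝ} (hσ : 0 < σ) (hh : 0 < h) {f ψ : RSpace n → ℂ}
    (hf : HasGSBound σ h C f) (hψ : HasGSBound σ h C' ψ) : Continuous (tfCoeff f ψ) := by
  refine continuous_of_dominated (bound := fun Z => ‖f Z‖ * C') (fun p => ?_) (fun p => ?_)
    ((hf.integrable hσ hh).norm.mul_const _) (Filter.Eventually.of_forall fun Z => ?_)
  · exact (hf.1.continuous.mul (continuous_conj.comp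
      (contDiff_tfShift hψ.1 p.1 p.2).continuous)).aestronglyMeasurable
  · refine Filter.Eventually.of_forall fun Z => ?_
    rw [norm_mul, RCLike.norm_conj, norm_tfShift]
    gcongr
    exact hψ.norm_le_const hh _
  · exact continuous_const.mul (continuous_conj.comp (continuous_tfShift_param hψ.1.continuous Z))

lemma integrable_exp_neg_prod {n : ℕ} {p r h : ℝ} (hp : 0 < p) (hr : 0 < r) (hh : 0 < h) :
    Integrable (fun q : RSpace n × RSpace n =>
      Real.exp (-(r * ((‖q.1‖ / h) ^ p + (‖q.2‖ / h) ^ p)))) := by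
  have h1 : Integrable (fun x : RSpace n => Real.exp (-(r * (‖x‖ / h) ^ p))) := by
    simp_rw [div_rpow_norm_eq hh, ← mul_assoc]
    exact integrable_exp_neg_norm_rpow hp (by positivity)
  refine (h1.mul_prod h1).congr (Filter.Eventually.of_forall fun q => ?_)
  simp only
  rw [← Real.exp_add]
  ring_nf

/-- For fixed `X` the integral over `Ξ` is Fourier inversion of `Z ↦ f(Z) conj(ψ(Z - X))` at `Y`. It
leaves `f(Y) |ψ(Y - X)|²`, and integrating over `X` gives the squared `L²` norm of the window. -/
lemma integral_tfCoeff_mul_tfShift {n : ℕ} {σ h C C' : ℝ} (hσ : 0 < σ) (hh : 0 < h)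
    {f ψ : RSpace n → ℂ} (hf : HasGSBound σ h C f) (hψ : HasGSBound σ h C' ψ) (Y : RSpace n) :
    ∫ p, tfCoeff f ψ p * tfShift ψ p.1 p.2 Y =
      (((2 * Real.pi) ^ n * ∫ x, ‖ψ x‖ ^ 2 : ℝ) : ℂ) * f Y := by
  have hp : 0 < 1 / σ := by positivity
  obtain ⟨K, hK, hF⟩ := exists_norm_tfCoeff_le hσ hh hf hψ
  have hFc := continuous_tfCoeff hσ hh hf hψ
  have hFi : Integrable (tfCoeff f ψ) :=
    ((integrable_exp_neg_prod hp (coeffRate_pos hσ) hh).const_mul K).mono' hFc.aestronglyMeasurable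
      (Filter.Eventually.of_forall fun q => hF q.1 q.2)
  have hFX : ∀ X, Integrable (fun Ξ => tfCoeff f ψ (X, Ξ)) := by
    intro X
    have h1 : Integrable (fun Ξ : RSpace n => Real.exp (-(coeffRate σ * (‖Ξ‖ / h) ^ (1 / σ)))) := by
      simp_rw [div_rpow_norm_eq hh, ← mul_assoc]
      have := coeffRate_pos hσ
      exact integrable_exp_neg_norm_rpow hp (by positivity)
    refine (h1.const_mul K).mono' (hFc.comp (Continuous.prodMk_right X)).aestronglyMeasurable
      (Filter.Eventually.of_forall fun Ξ => (hF X Ξ).trans ?_)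
    gcongr
    · exact (coeffRate_pos hσ).le
    · have : 0 ≤ (‖X‖ / h) ^ (1 / σ) := by positivity
      linarith
  have hint : Integrable (fun p : RSpace n × RSpace n =>
      tfCoeff f ψ p * tfShift ψ p.1 p.2 Y) := by
    refine (hFi.norm.mul_const C').mono' ?_ (Filter.Eventually.of_forall fun q => ?_)
    · exact (hFc.mul (continuous_tfShift_param hψ.1.continuous Y)).aestronglyMeasurable
    · rw [norm_mul, norm_tfShift]
      gcongr
      exact hψ.norm_le_const hh _
  rw [Measure.volume_eq_prod] at hint ⊢
  rw [integral_prod _ hint]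
  have h1 : ∀ X, ∫ Ξ, tfCoeff f ψ (X, Ξ) * tfShift ψ X Ξ Y =
      ((2 * Real.pi) ^ n * f Y) * ((‖ψ (Y - X)‖ ^ 2 : ℝ) : ℂ) := by
    intro X
    have hcc : Continuous fun Z => f Z * (starRingEnd ℂ) (ψ (Z - X)) := by
      have h2 := hf.1.continuous
      have h3 := hψ.1.continuous
      fun_prop
    have hWi : Integrable fun Z => f Z * (starRingEnd ℂ) (ψ (Z - X)) := by
      refine ((hf.integrable hσ hh).norm.mul_const C').mono' hcc.aestronglyMeasurable
        (Filter.Eventually.of_forall fun Z => ?_)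
      rw [norm_mul, RCLike.norm_conj]
      gcongr
      exact hψ.norm_le_const hh _
    have h4 := integral_modChar_mul_fourier hcc hWi (by
      simp_rw [← tfCoeff_eq]; exact hFX X) Y
    simp_rw [← tfCoeff_eq] at h4
    calc _ = ∫ Ξ, ψ (Y - X) * (modChar Ξ Y * tfCoeff f ψ (X, Ξ)) := by
          congr 1; ext Ξ; rw [tfShift]; ring
      _ = ψ (Y - X) * ((2 * Real.pi) ^ n * (f Y * (starRingEnd ℂ) (ψ (Y - X)))) := by
          rw [integral_const_mul, h4]
      _ = ((2 * Real.pi) ^ n * f Y) * (ψ (Y - X) * (starRingEnd ℂ) (ψ (Y - X))) := by ring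
      _ = _ := by rw [Complex.mul_conj, Complex.normSq_eq_norm_sq]
  simp_rw [h1]
  rw [integral_const_mul, integral_complex_ofReal,
    integral_sub_left_eq_self (fun x => ‖ψ x‖ ^ 2)]
  push_cast
  ring

/-- The ratio between the scales in the inversion formula. -/
def inversionScale (σ : ℝ) : ℝ :=
  2 * max 2 (2 ^ σ) * max 1 ((2 * (1 + σ) / coeffRate σ) ^ σ)

lemma inversionScale_ge {σ : ℝ} : 2 * max 2 (2 ^ σ) ≤ inversionScale σ :=
  le_mul_of_one_le_right (by positivity) (le_max_left _ _)

/-- Regarding the window as a function of scale `m h` with `m` large makes shifts cheap: their norms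
grow at half the rate at which `tfCoeff` decays. -/
lemma HasGSBound.tfShift_large {n : ℕ} {σ h C : ℝ} (hσ : 0 < σ) (hh : 0 < h)
    {ψ : RSpace n → ℂ} (hψ : HasGSBound σ h C ψ) (X Ξ : RSpace n) :
    HasGSBound σ (inversionScale σ * h)
      (C * Real.exp (coeffRate σ / 2 * ((‖X‖ / h) ^ (1 / σ) + (‖Ξ‖ / h) ^ (1 / σ))))
      (_root_.tfShift ψ X Ξ) := by
  have hC := hψ.nonneg
  have hr := coeffRate_pos hσ
  set m : ℝ := max 1 ((2 * (1 + σ) / coeffRate σ) ^ σ)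
  have hm1 : 1 ≤ m := le_max_left _ _
  have h1 := (hψ.mono (h' := m * h) hσ hh (le_mul_of_one_le_left hh.le hm1) le_rfl).tfShift hσ
    (by positivity) X Ξ
  refine h1.mono hσ (by positivity) ?_ ?_
  · rw [← mul_assoc]
    unfold inversionScale
    gcongr
    have : (2 : ℝ) ≤ max 2 (2 ^ σ) := le_max_left _ _
    linarith
  · gcongr
    have h2 : ∀ x : RSpace n, (1 + σ) * (‖x‖ / (m * h)) ^ (1 / σ) ≤
        coeffRate σ / 2 * (‖x‖ / h) ^ (1 / σ) := by
      intro x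
      rw [show ‖x‖ / (m * h) = ‖x‖ / h / m by field_simp,
        Real.div_rpow (by positivity) (by positivity)]
      have h3 : 2 * (1 + σ) / coeffRate σ ≤ m ^ (1 / σ) := by
        have := Real.rpow_le_rpow (by positivity) (le_max_right 1 ((2 * (1 + σ) / coeffRate σ) ^ σ))
          (by positivity : 0 ≤ 1 / σ)
        rwa [← Real.rpow_mul (by positivity), mul_one_div_cancel hσ.ne', Real.rpow_one] at this
      have h4 : 0 ≤ (‖x‖ / h) ^ (1 / σ) := by positivity
      rw [← mul_div_assoc, div_le_iff₀ (by positivity)]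
      rw [div_le_iff₀ hr] at h3
      nlinarith
    have h5 := h2 X
    have h6 := h2 Ξ
    have h7 : 0 ≤ σ * (‖X‖ / (m * h)) ^ (1 / σ) := by positivity
    have h8 : 0 ≤ (‖Ξ‖ / (m * h)) ^ (1 / σ) := by positivity
    linarith

/-- The inversion formula for functionals on a space of test functions. -/
lemma tfShift_inversion {n : ℕ} {σ h h₁ C C' : ℝ} (hσ : 0 < σ) (hh : 0 < h)
    {f ψ : RSpace n → ℂ} (hf : HasGSBound σ h C f) (hψ : HasGSBound σ h C' ψ)
    (hh₁ : gsScale n σ * (inversionScale σ * h) ≤ h₁)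
    {T : Submodule ℂ (RSpace n → ℂ)} (hT : ∀ f ∈ T, ContDiff ℝ (⊤ : ℕ∞) f) (u : T →ₗ[ℂ] ℂ)
    {D : ℝ≥0} (hu : ∀ f : T, gsNorm σ σ h₁ (f : RSpace n → ℂ) < ⊤ →
      ‖u f‖ₑ ≤ D * gsNorm σ σ h₁ (f : RSpace n → ℂ))
    (hfT : f ∈ T) (hψT : ∀ X Ξ, tfShift ψ X Ξ ∈ T) :
    Continuous (fun p : RSpace n × RSpace n => pairing u (tfShift ψ p.1 p.2)) ∧
    ∫ p, tfCoeff f ψ p * pairing u (tfShift ψ p.1 p.2) =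
      (((2 * Real.pi) ^ n * ∫ x, ‖ψ x‖ ^ 2 : ℝ) : ℂ) * pairing u f := by
  have hp : 0 < 1 / σ := by positivity
  have hr := coeffRate_pos hσ
  have hg := one_le_gsScale (n := n) (σ := σ)
  have hs1 := inversionScale_ge (σ := σ)
  have hm2 : (2 : ℝ) ≤ max 2 (2 ^ σ) := le_max_left _ _
  have hs0 : 0 < inversionScale σ := by linarith
  have hh₁0 : 0 < h₁ := lt_of_lt_of_le (by positivity) hh₁
  have hC' := hψ.nonneg
  have hpair : ∀ g (hg : g ∈ T), pairing u g = u ⟨g, hg⟩ := fun g hg => dif_pos hg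
  -- norms at the scale `h₁`
  have hnorm : ∀ {g : RSpace n → ℂ} {M : ℝ}, HasGSBound σ (inversionScale σ * h) M g →
      gsNorm σ σ h₁ g ≤ ENNReal.ofReal M := fun {g M} hg' =>
    (gsNorm_anti (by positivity) hh₁ g).trans (gsNorm_le_of_hasGSBound hσ (by positivity) hg')
  -- From here on `u` is replaced by the continuous functional `U` on families, which commutes with
  -- Bochner integrals.
  obtain ⟨U, hU⟩ := exists_extension_to_families hh₁0 hT u D hu
  have htf : ∀ X Ξ, gsNorm σ σ h₁ (tfShift ψ X Ξ) < ⊤ := fun X Ξ =>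
    (hnorm (hψ.tfShift_large hσ hh X Ξ)).trans_lt ENNReal.ofReal_lt_top
  let Φ : RSpace n × RSpace n → GSFamily n := fun p =>
    ⟨gsCoord σ h₁ (tfShift ψ p.1 p.2), memℓp_gsCoord hh₁0 (htf p.1 p.2)⟩
  have hUΦ : ∀ p, U (Φ p) = pairing u (tfShift ψ p.1 p.2) := fun p => by
    rw [hpair _ (hψT p.1 p.2)]
    exact hU ⟨_, hψT p.1 p.2⟩ (htf _ _) (Φ p) rfl
  have hΦn : ∀ p, ‖Φ p‖ ≤ C' * Real.exp (coeffRate σ / 2 *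
      ((‖p.1‖ / h) ^ (1 / σ) + (‖p.2‖ / h) ^ (1 / σ))) := fun p =>
    lp.norm_le_of_forall_le (by positivity) fun i =>
      norm_gsCoord_le hh₁0 (by positivity) (hnorm (hψ.tfShift_large hσ hh p.1 p.2)) i
  have hΦc : Continuous Φ := by
    refine continuous_of_tfShift_sub hσ hh hψ Φ 1 fun p p₀ M hM => ?_
    rw [one_mul]
    have hM0 := hM.nonneg
    refine lp.norm_le_of_forall_le hM0 fun i => ?_
    have h1 : gsCoord σ h₁ (tfShift ψ p.1 p.2 - tfShift ψ p₀.1 p₀.2) =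
        gsCoord σ h₁ (tfShift ψ p.1 p.2) - gsCoord σ h₁ (tfShift ψ p₀.1 p₀.2) := by
      have hc := contDiff_tfShift hψ.1
      have hc' : ContDiff ℝ (⊤ : ℕ∞) ((-1 : ℂ) • tfShift ψ p₀.1 p₀.2) :=
        contDiff_const.smul (hc p₀.1 p₀.2)
      rw [sub_eq_add_neg, ← neg_one_smul ℂ, gsCoord_add (hc _ _) hc',
        gsCoord_smul _ (hc _ _), neg_one_smul, ← sub_eq_add_neg]
    have h2 := norm_gsCoord_le hh₁0 hM0
      (hnorm (hM.mono (h' := inversionScale σ * h) hσ (by positivity) (by gcongr) le_rfl)) i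
    rw [h1] at h2
    exact h2
  have hcont : Continuous (fun p : RSpace n × RSpace n => pairing u (tfShift ψ p.1 p.2)) := by
    simp_rw [← hUΦ]
    exact U.continuous.comp hΦc
  refine ⟨hcont, ?_⟩
  obtain ⟨K, hK, hF⟩ := exists_norm_tfCoeff_le hσ hh hf hψ
  have hFc := continuous_tfCoeff hσ hh hf hψ
  set E₂ : RSpace n × RSpace n → ℝ := fun q =>
    Real.exp (-(coeffRate σ / 2 * ((‖q.1‖ / h) ^ (1 / σ) + (‖q.2‖ / h) ^ (1 / σ))))
  have hE₂ : Integrable E₂ := integrable_exp_neg_prod hp (by positivity) hh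
  have hprod : ∀ q A, A ≤ C' * Real.exp (coeffRate σ / 2 *
      ((‖q.1‖ / h) ^ (1 / σ) + (‖q.2‖ / h) ^ (1 / σ))) → ‖tfCoeff f ψ q‖ * A ≤ K * C' * E₂ q := by
    intro q A hA
    calc _ ≤ (K * Real.exp (-(coeffRate σ * ((‖q.1‖ / h) ^ (1 / σ) + (‖q.2‖ / h) ^ (1 / σ))))) *
          (C' * Real.exp (coeffRate σ / 2 * ((‖q.1‖ / h) ^ (1 / σ) + (‖q.2‖ / h) ^ (1 / σ)))) :=
          (mul_le_mul_of_nonneg_left hA (norm_nonneg _)).trans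
            (mul_le_mul_of_nonneg_right (hF q.1 q.2) (by positivity))
      _ = K * C' * (Real.exp (-(coeffRate σ * ((‖q.1‖ / h) ^ (1 / σ) + (‖q.2‖ / h) ^ (1 / σ)))) *
          Real.exp (coeffRate σ / 2 * ((‖q.1‖ / h) ^ (1 / σ) + (‖q.2‖ / h) ^ (1 / σ)))) := by ring
      _ = _ := by rw [← Real.exp_add]; congr 2; ring
  -- Decay at rate `coeffRate σ` against growth at rate `coeffRate σ / 2` leaves the integrable
  -- `E₂`.
  have hGi : Integrable (fun p => tfCoeff f ψ p • Φ p) := by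
    refine (hE₂.const_mul (K * C')).mono' (hFc.smul hΦc).aestronglyMeasurable
      (Filter.Eventually.of_forall fun q => ?_)
    rw [norm_smul]
    exact hprod q _ (hΦn q)
  set c : ℂ := (((2 * Real.pi) ^ n * ∫ x, ‖ψ x‖ ^ 2 : ℝ) : ℂ)
  -- differentiation of the pointwise inversion formula
  have hder := iteratedFDeriv_integral (μ := (volume : Measure (RSpace n × RSpace n)))
    (G := fun x p => tfCoeff f ψ p * tfShift ψ p.1 p.2 x)
    (fun p => contDiff_const.mul (contDiff_tfShift hψ.1 p.1 p.2))
  have hcs : ∀ (k : ℕ) (p : RSpace n × RSpace n) (x : RSpace n), iteratedFDeriv ℝ k (fun x => tfCoeff f ψ p * tfShift ψ p.1 p.2 x) x =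
      tfCoeff f ψ p • iteratedFDeriv ℝ k (tfShift ψ p.1 p.2) x := fun k p x =>
    iteratedFDeriv_const_smul_apply (a := tfCoeff f ψ p) (f := tfShift ψ p.1 p.2)
      (((contDiff_tfShift hψ.1 p.1 p.2).of_le (by exact_mod_cast le_top)).contDiffAt)
  have hbd : ∀ k p x, ‖iteratedFDeriv ℝ k (fun x => tfCoeff f ψ p * tfShift ψ p.1 p.2 x) x‖ ≤
      K * C' * E₂ p * ((inversionScale σ * h) ^ k * (k.factorial : ℝ) ^ σ) := by
    intro k p x
    rw [hcs, norm_smul]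
    have h1 := (hψ.tfShift_large hσ hh p.1 p.2).2 k x
    have h2 : Real.exp (-(‖x‖ / (inversionScale σ * h)) ^ (1 / σ)) ≤ 1 := by
      rw [Real.exp_le_one_iff, neg_nonpos]; positivity
    have h3 := hprod p _ le_rfl
    calc _ ≤ ‖tfCoeff f ψ p‖ * (C' * Real.exp (coeffRate σ / 2 *
          ((‖p.1‖ / h) ^ (1 / σ) + (‖p.2‖ / h) ^ (1 / σ))) *
          ((inversionScale σ * h) ^ k * (k.factorial : ℝ) ^ σ * 1)) := by
          refine mul_le_mul_of_nonneg_left (h1.trans ?_) (norm_nonneg _)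
          gcongr
      _ = ‖tfCoeff f ψ p‖ * (C' * Real.exp (coeffRate σ / 2 *
          ((‖p.1‖ / h) ^ (1 / σ) + (‖p.2‖ / h) ^ (1 / σ)))) *
          ((inversionScale σ * h) ^ k * (k.factorial : ℝ) ^ σ) := by ring
      _ ≤ _ := mul_le_mul_of_nonneg_right h3 (by positivity)
  have hms : ∀ k x, AEStronglyMeasurable (fun p : RSpace n × RSpace n =>
      iteratedFDeriv ℝ k (fun x => tfCoeff f ψ p * tfShift ψ p.1 p.2 x) x) volume := by
    intro k x
    simp_rw [hcs]
    exact (hFc.smul (continuous_iteratedFDeriv_tfShift hσ hh hψ k x)).aestronglyMeasurable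
  obtain ⟨-, hD⟩ := hder hms fun k x₀ => ⟨_, (hE₂.const_mul (K * C')).mul_const _,
    Filter.Eventually.of_forall fun p x _ => hbd k p x⟩
  simp_rw [integral_tfCoeff_mul_tfShift hσ hh hf hψ] at hD
  have hfn : gsNorm σ σ h₁ f < ⊤ := (hnorm (hf.mono (h' := inversionScale σ * h) hσ hh
    (le_mul_of_one_le_left hh.le (by linarith)) le_rfl)).trans_lt ENNReal.ofReal_lt_top
  let Φf : GSFamily n := ⟨gsCoord σ h₁ f, memℓp_gsCoord hh₁0 hfn⟩
  -- Coordinate by coordinate, this is a weighted partial derivative of the pointwise inversion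
  -- formula.
  have hsum : ∫ p, tfCoeff f ψ p • Φ p = c • Φf := by
    refine Subtype.ext (funext fun i => ?_)
    change familyEval i (∫ p, tfCoeff f ψ p • Φ p) = familyEval i (c • Φf)
    rw [← ContinuousLinearMap.integral_comp_comm _ hGi]
    simp only [map_smul, familyEval_apply, Φ, Φf, gsCoord, smul_eq_mul]
    have h1 : ∀ p : RSpace n × RSpace n, tfCoeff f ψ p * ((gsCoeff σ h₁ i : ℂ) *
        partialD i.1 (tfShift ψ p.1 p.2) i.2.2) = (gsCoeff σ h₁ i : ℂ) *
        partialD i.1 (fun x => tfCoeff f ψ p * tfShift ψ p.1 p.2 x) i.2.2 := by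
      intro p
      have h3 := partialD_smul (tfCoeff f ψ p) (contDiff_tfShift hψ.1 p.1 p.2) i.1 i.2.2
      rw [show (fun x => tfCoeff f ψ p * tfShift ψ p.1 p.2 x) =
        tfCoeff f ψ p • tfShift ψ p.1 p.2 from rfl, h3]
      ring
    simp_rw [h1]
    rw [integral_const_mul]
    have h2 : c * ((gsCoeff σ h₁ i : ℂ) * partialD i.1 f i.2.2) = (gsCoeff σ h₁ i : ℂ) *
        partialD i.1 (fun x => c * f x) i.2.2 := by
      have := partialD_smul c hf.1 i.1 i.2.2
      rw [show (fun x => c * f x) = c • f from rfl, this]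
      ring
    rw [h2]
    congr 1
    simp only [partialD]
    rw [hD, ContinuousMultilinearMap.integral_apply]
    exact ((hE₂.const_mul (K * C')).mul_const _).mono' (hms _ _)
      (Filter.Eventually.of_forall fun p => hbd _ p _)
  have hfin := congrArg U hsum
  rw [← ContinuousLinearMap.integral_comp_comm _ hGi] at hfin
  simp only [map_smul, smul_eq_mul, hUΦ] at hfin
  rw [hfin, hU ⟨f, hfT⟩ hfn Φf rfl, hpair f hfT]

/-! ### Gaussians -/

section Gaussian

variable {E : Type*} [NormedAddCommGroup E] [NormedSpace ℝ E]

lemma norm_iteratedFDeriv_clm_of_two_le {F : Type*} [NormedAddCommGroup F] [NormedSpace ℝ F]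
    (N : E →L[ℝ] F) (k : ℕ) (x : E) : ‖iteratedFDeriv ℝ (k + 2) (fun x => N x) x‖ = 0 := by
  rw [← norm_iteratedFDeriv_fderiv]
  have : fderiv ℝ (fun x => N x) = fun _ => N := by ext1 x; exact N.fderiv
  rw [this, iteratedFDeriv_const_of_ne (by omega)]
  simp

lemma contDiff_exp_neg_quadratic (M : E →L[ℝ] E →L[ℝ] ℝ) :
    ContDiff ℝ (⊤ : ℕ∞) (fun x => Real.exp (-(M x x))) := by
  refine Real.contDiff_exp.comp (ContDiff.neg ?_)
  exact M.contDiff.clm_apply contDiff_id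

/-- The derivative of `g = e^{-M(x,x)}` is `-g` times the linear map `N = M + M.flip`, so only two
terms of the Leibniz sum survive: `‖D^{k+1}g‖ ≤ ‖N‖‖x‖ ‖D^k g‖ + k‖N‖ ‖D^{k-1}g‖`, as for Hermite
functions. The stated majorant is propagated by this recursion. -/
lemma norm_iteratedFDeriv_exp_neg_quadratic_le (M : E →L[ℝ] E →L[ℝ] ℝ) (k : ℕ) (x : E) :
    ‖iteratedFDeriv ℝ k (fun x => Real.exp (-(M x x))) x‖ ≤
      Real.exp (-(M x x)) * (‖M + M.flip‖ * ‖x‖ + Real.sqrt (k * ‖M + M.flip‖)) ^ k := by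
  set g : E → ℝ := fun x => Real.exp (-(M x x)) with hg
  set N := M + M.flip with hN
  set B := ‖N‖
  have hgc : ContDiff ℝ (⊤ : ℕ∞) g := contDiff_exp_neg_quadratic M
  have hB : 0 ≤ B := ContinuousLinearMap.opNorm_nonneg _
  have hfd : fderiv ℝ g = fun x => g x • (-N) x := by
    ext1 x
    have h0 := (M.hasFDerivAt (x := x)).clm_apply (hasFDerivAt_id x)
    have h1 : HasFDerivAt (fun x => M x x) (N x) x := h0.congr_fderiv (by ext y; simp [hN])
    have h2 : HasFDerivAt g (Real.exp (-(M x x)) • -N x) x := h1.neg.exp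
    rw [h2.fderiv]
    rfl
  have hg0 : 0 < g x := Real.exp_pos _
  have hL0 : 0 ≤ B * ‖x‖ := by positivity
  set b : ℕ → ℝ := fun j => ‖iteratedFDeriv ℝ j (fun x => (-N) x) x‖ with hb
  have hb0 : b 0 ≤ B * ‖x‖ := by
    simp only [hb, norm_iteratedFDeriv_zero]
    rw [neg_apply, norm_neg]
    exact N.le_opNorm x
  have hb1 : b 1 ≤ B := by
    simp only [hb]
    rw [show (1 : ℕ) = 0 + 1 from rfl, ← norm_iteratedFDeriv_fderiv, norm_iteratedFDeriv_zero]
    have : fderiv ℝ (fun x => (-N) x) x = -N := (-N).fderiv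
    rw [this, norm_neg]
  have hb2 : ∀ j, b (j + 2) = 0 := fun j => norm_iteratedFDeriv_clm_of_two_le _ _ _
  have hstep : ∀ k, ‖iteratedFDeriv ℝ (k + 1) g x‖ ≤ ∑ i ∈ Finset.range (k + 1),
      (k.choose i : ℝ) * ‖iteratedFDeriv ℝ i g x‖ * b (k - i) := by
    intro k
    rw [← norm_iteratedFDeriv_fderiv, hfd]
    exact norm_iteratedFDeriv_smul_le hgc (-N).contDiff x (n := k) (N := (⊤ : ℕ∞))
      (by exact_mod_cast le_top)
  change _ ≤ g x * _
  induction k using Nat.strong_induction_on with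
  | _ k ih =>
    rcases k with _ | k
    · rw [norm_iteratedFDeriv_zero, pow_zero, mul_one]
      exact (abs_of_pos hg0).le
    · refine (hstep k).trans ?_
      rcases k with _ | k
      · simp only [zero_add, Finset.range_one, Finset.sum_singleton, Nat.choose_self, Nat.cast_one,
          one_mul, norm_iteratedFDeriv_zero, Nat.sub_self, pow_one, Real.norm_eq_abs, abs_of_pos hg0]
        have := Real.sqrt_nonneg B
        gcongr
        linarith
      · rw [Finset.sum_range_succ, Finset.sum_range_succ, Finset.sum_eq_zero]
        · have h0 := ih (k + 1) (by omega)
          have h1 := ih k (by omega)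
          simp only [Nat.choose_self, Nat.cast_one, one_mul, Nat.sub_self,
            show k + 1 - k = 1 by omega, Nat.choose_succ_self_right, zero_add]
          set S := Real.sqrt ((k + 1 + 1 : ℕ) * B)
          have hS2 : S ^ 2 = (k + 1 + 1 : ℕ) * B := Real.sq_sqrt (by positivity)
          have hS0 : 0 ≤ S := Real.sqrt_nonneg _
          have hs1 : Real.sqrt ((k + 1 : ℕ) * B) ≤ S :=
            Real.sqrt_le_sqrt (by gcongr; exact_mod_cast Nat.le_succ _)
          have hs2 : Real.sqrt ((k : ℕ) * B) ≤ S :=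
            Real.sqrt_le_sqrt (by gcongr; exact_mod_cast (by omega : k ≤ k + 1 + 1))
          have e0 : ‖iteratedFDeriv ℝ (k + 1) g x‖ ≤ g x * (B * ‖x‖ + S) ^ (k + 1) :=
            h0.trans (by gcongr)
          have e1 : ‖iteratedFDeriv ℝ k g x‖ ≤ g x * (B * ‖x‖ + S) ^ k := h1.trans (by gcongr)
          calc _ ≤ ((k + 1 : ℕ) : ℝ) * (g x * (B * ‖x‖ + S) ^ k) * B +
                (g x * (B * ‖x‖ + S) ^ (k + 1)) * (B * ‖x‖) := by gcongr
            _ = g x * (B * ‖x‖ + S) ^ k * (((k + 1 : ℕ) : ℝ) * B + (B * ‖x‖ + S) * (B * ‖x‖)) := by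
                ring
            _ ≤ g x * (B * ‖x‖ + S) ^ k * (B * ‖x‖ + S) ^ 2 := by
                gcongr
                -- The square root is chosen for this: the term without `‖x‖` in the recursion fits
                -- into `S ^ 2`.
                have : ((k + 1 : ℕ) : ℝ) * B ≤ S ^ 2 := by
                  rw [hS2]; gcongr; exact_mod_cast Nat.le_succ _
                nlinarith [mul_nonneg hL0 hS0]
            _ = _ := by ring
        · intro i hi
          rw [Finset.mem_range] at hi
          obtain ⟨j, hj⟩ := Nat.exists_eq_add_of_le (show 2 ≤ k + 1 - i by omega)
          rw [hj, add_comm 2 j, hb2, mul_zero]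

end Gaussian

/-- Half of the decay `e^{-m‖x‖²}` absorbs `(B‖x‖)^k` at the price of `k!^{1/2}` and a geometric
factor, and `k^k ≤ e^k k!` treats `√(kB)^k` in the same way. The other half is the decay that
remains. -/
lemma exists_hasGSBound_exp_neg_quadratic {n : ℕ} (M : RSpace n →L[ℝ] RSpace n →L[ℝ] ℝ) {m : ℝ}
    (hm : 0 < m) (hM : ∀ x, m * ‖x‖ ^ 2 ≤ M x x) :
    ∃ h C : ℝ, 0 < h ∧ HasGSBound (1 / 2) h C (fun x => ((Real.exp (-(M x x)) : ℝ) : ℂ)) := by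
  set B := ‖M + M.flip‖
  have hB : 0 ≤ B := ContinuousLinearMap.opNorm_nonneg _
  set D : ℝ := max (B / Real.sqrt m) (Real.sqrt (B * Real.exp 1))
  have hD0 : 0 ≤ D := le_max_of_le_right (Real.sqrt_nonneg _)
  have hsm : 0 < Real.sqrt m := Real.sqrt_pos.2 hm
  refine ⟨max (2 * D) (Real.sqrt (2 / m)), 2, lt_max_of_lt_right (by positivity),
    ofRealCLM.contDiff.comp (contDiff_exp_neg_quadratic M), fun k x => ?_⟩
  set h := max (2 * D) (Real.sqrt (2 / m))
  have hh : 0 < h := lt_max_of_lt_right (by positivity)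
  have h1 := ofRealLI.norm_iteratedFDeriv_comp_left (n := (⊤ : ℕ∞)) (i := k)
    ((contDiff_exp_neg_quadratic M).contDiffAt (x := x)) (by exact_mod_cast le_top)
  refine (le_of_eq h1).trans ((norm_iteratedFDeriv_exp_neg_quadratic_le M k x).trans ?_)
  have hk0 : (0 : ℝ) < k.factorial := by exact_mod_cast k.factorial_pos
  have e1 : (B * ‖x‖) ^ k ≤ D ^ k * ((k.factorial : ℝ) ^ (1 / 2 : ℝ) *
      Real.exp (m / 2 * ‖x‖ ^ 2)) := by
    have := pow_le_factorial_rpow_mul_exp (σ := 1 / 2) (by norm_num) (t := Real.sqrt m * ‖x‖)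
      (by positivity) k
    rw [one_div_one_div, Real.rpow_two, mul_pow _ _ 2, Real.sq_sqrt hm.le] at this
    calc (B * ‖x‖) ^ k = (B / Real.sqrt m) ^ k * (Real.sqrt m * ‖x‖) ^ k := by
          rw [← mul_pow]; congr 1; field_simp
      _ ≤ D ^ k * ((k.factorial : ℝ) ^ (1 / 2 : ℝ) * Real.exp (1 / 2 * (m * ‖x‖ ^ 2))) := by
          gcongr
          exact le_max_left _ _
      _ = _ := by ring_nf
  have e2 : Real.sqrt (k * B) ^ k ≤ D ^ k * ((k.factorial : ℝ) ^ (1 / 2 : ℝ) *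
      Real.exp (m / 2 * ‖x‖ ^ 2)) := by
    have h2 : (k : ℝ) ^ k ≤ Real.exp 1 ^ k * k.factorial := by
      have := Real.pow_div_factorial_le_exp (k : ℝ) (by positivity) k
      rw [div_le_iff₀ hk0] at this
      rwa [← Real.exp_nat_mul, mul_one]
    have h3 : Real.sqrt k ^ k ≤ Real.sqrt (Real.exp 1) ^ k * (k.factorial : ℝ) ^ (1 / 2 : ℝ) := by
      rw [← pow_le_pow_iff_left₀ (by positivity) (by positivity) two_ne_zero, mul_pow, ← pow_mul,
        ← pow_mul, mul_comm k 2, pow_mul, pow_mul, Real.sq_sqrt (by positivity),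
        Real.sq_sqrt (by positivity), ← Real.sqrt_eq_rpow, Real.sq_sqrt (by positivity)]
      exact h2
    have h4 : 1 ≤ Real.exp (m / 2 * ‖x‖ ^ 2) := Real.one_le_exp (by positivity)
    calc Real.sqrt (k * B) ^ k = Real.sqrt k ^ k * Real.sqrt B ^ k := by
          rw [Real.sqrt_mul (by positivity), mul_pow]
      _ ≤ (Real.sqrt (Real.exp 1) ^ k * (k.factorial : ℝ) ^ (1 / 2 : ℝ)) * Real.sqrt B ^ k := by
          gcongr
      _ = Real.sqrt (B * Real.exp 1) ^ k * ((k.factorial : ℝ) ^ (1 / 2 : ℝ) * 1) := by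
          rw [Real.sqrt_mul hB, mul_pow]; ring
      _ ≤ _ := by
          gcongr
          exact le_max_right _ _
  have e3 : (B * ‖x‖ + Real.sqrt (k * B)) ^ k ≤ 2 ^ k * ((B * ‖x‖) ^ k + Real.sqrt (k * B) ^ k) := by
    refine (add_pow_le (by positivity) (Real.sqrt_nonneg _) k).trans ?_
    gcongr
    · norm_num
    · omega
  have e4 : Real.exp (-(M x x)) ≤ Real.exp (-(m * ‖x‖ ^ 2)) := by
    gcongr
    exact hM x
  have e5 : Real.exp (-(m / 2 * ‖x‖ ^ 2)) ≤ Real.exp (-(‖x‖ / h) ^ (1 / (1 / 2) : ℝ)) := by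
    rw [one_div_one_div, Real.rpow_two]
    gcongr
    rw [div_pow, div_le_iff₀ (by positivity)]
    have : 2 / m ≤ h ^ 2 := by
      rw [← Real.sq_sqrt (by positivity : 0 ≤ 2 / m)]
      gcongr
      exact le_max_right _ _
    calc ‖x‖ ^ 2 = m / 2 * ‖x‖ ^ 2 * (2 / m) := by field_simp
      _ ≤ _ := by gcongr
  calc _ ≤ Real.exp (-(m * ‖x‖ ^ 2)) * (2 ^ k * (D ^ k * ((k.factorial : ℝ) ^ (1 / 2 : ℝ) *
        Real.exp (m / 2 * ‖x‖ ^ 2)) + D ^ k * ((k.factorial : ℝ) ^ (1 / 2 : ℝ) *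
        Real.exp (m / 2 * ‖x‖ ^ 2)))) := by
        refine mul_le_mul e4 (e3.trans ?_) (by positivity) (Real.exp_pos _).le
        gcongr
    _ = 2 * ((2 * D) ^ k * (k.factorial : ℝ) ^ (1 / 2 : ℝ) *
        (Real.exp (-(m * ‖x‖ ^ 2)) * Real.exp (m / 2 * ‖x‖ ^ 2))) := by rw [mul_pow]; ring
    _ = 2 * ((2 * D) ^ k * (k.factorial : ℝ) ^ (1 / 2 : ℝ) * Real.exp (-(m / 2 * ‖x‖ ^ 2))) := by
        rw [← Real.exp_add]; ring_nf
    _ ≤ _ := by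
        gcongr
        exact le_max_left _ _

lemma HasGSBound.const_mul {n : ℕ} {σ h C : ℝ} {f : RSpace n → ℂ} (hf : HasGSBound σ h C f)
    (c : ℂ) : HasGSBound σ h (‖c‖ * C) (fun x => c * f x) := by
  refine ⟨contDiff_const.mul hf.1, fun k x => ?_⟩
  have h1 := iteratedFDeriv_const_smul_apply (𝕜 := ℝ) (a := c) (f := f) (i := k) (x := x)
    ((hf.1.of_le (by exact_mod_cast le_top)).contDiffAt)
  rw [show (fun x => c * f x) = c • f from rfl, h1, norm_smul, mul_assoc]
  exact mul_le_mul_of_nonneg_left (hf.2 k x) (norm_nonneg c)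

/-- The bilinear form with a given matrix. -/
def matrixForm {n : ℕ} (A : Matrix (Fin n) (Fin n) ℝ) : RSpace n →L[ℝ] RSpace n →L[ℝ] ℝ :=
  ∑ i, ∑ j, A i j • (EuclideanSpace.proj (𝕜 := ℝ) i).smulRight
    (EuclideanSpace.proj (𝕜 := ℝ) j : RSpace n →L[ℝ] ℝ)

lemma matrixForm_apply {n : ℕ} (A : Matrix (Fin n) (Fin n) ℝ) (x y : RSpace n) :
    matrixForm A x y = ∑ i, ∑ j, A i j * x i * y j := by
  simp [matrixForm, mul_assoc]

lemma exists_pos_le_matrixForm {n : ℕ} {A : Matrix (Fin n) (Fin n) ℝ} (hA : A.PosDef) :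
    ∃ m : ℝ, 0 < m ∧ ∀ x, m * ‖x‖ ^ 2 ≤ matrixForm A x x := by
  have hpos : ∀ x : RSpace n, x ≠ 0 → 0 < matrixForm A x x := by
    intro x hx
    have h1 := hA.dotProduct_mulVec_pos (x := fun i => x i) (fun h => hx (by
      ext i; exact congrFun h i))
    rw [matrixForm_apply]
    refine lt_of_lt_of_eq h1 ?_
    simp only [dotProduct, Matrix.mulVec, Finset.mul_sum, star_trivial]
    refine Finset.sum_congr rfl fun i _ => Finset.sum_congr rfl fun j _ => ?_
    ring
  -- The sphere is empty in dimension zero; otherwise `m` is the minimum of the form on it.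
  rcases (Metric.sphere (0 : RSpace n) 1).eq_empty_or_nonempty with he | hne
  · refine ⟨1, one_pos, fun x => ?_⟩
    have hx : x = 0 := by
      by_contra hx
      have : (‖x‖⁻¹ • x) ∈ Metric.sphere (0 : RSpace n) 1 := by
        simp [norm_smul, hx]
      rw [he] at this
      exact this
    simp [hx]
  · obtain ⟨x₀, hx₀, hmin⟩ := (isCompact_sphere (0 : RSpace n) 1).exists_isMinOn hne
      (f := fun x => matrixForm A x x) (by fun_prop)
    have hx₀0 : x₀ ≠ 0 := by
      rintro rfl
      simp at hx₀
    refine ⟨matrixForm A x₀ x₀, hpos x₀ hx₀0, fun x => ?_⟩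
    rcases eq_or_ne x 0 with rfl | hx
    · simp
    have h1 : (‖x‖⁻¹ • x) ∈ Metric.sphere (0 : RSpace n) 1 := by
      simp [norm_smul, hx]
    have h2 := isMinOn_iff.1 hmin _ h1
    have hx' : 0 < ‖x‖ := norm_pos_iff.2 hx
    simp only [map_smul, smul_apply, smul_eq_mul] at h2
    calc _ ≤ (‖x‖⁻¹ * (‖x‖⁻¹ * matrixForm A x x)) * ‖x‖ ^ 2 := by gcongr
      _ = _ := by field_simp

lemma modChar_zero {n : ℕ} (y : RSpace n) : modChar 0 y = 1 := by simp [modChar]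

lemma IsGaussianFun.mem_gelfandShilov {n : ℕ} {φ : RSpace n → ℂ} (hφ : IsGaussianFun φ) :
    φ ∈ gelfandShilov n (1 / 2) (1 / 2) := by
  obtain ⟨c, A, x₀, -, hA, hφ⟩ := hφ
  obtain ⟨m, hm, hmA⟩ := exists_pos_le_matrixForm hA
  obtain ⟨h, C, hh, hg⟩ := exists_hasGSBound_exp_neg_quadratic _ hm hmA
  rw [mem_gelfandShilov_iff (by norm_num)]
  have h1 := (hg.const_mul c).tfShift (by norm_num) hh x₀ 0
  have h2 : φ = tfShift (fun x => c * ((Real.exp (-(matrixForm A x x)) : ℝ) : ℂ)) x₀ 0 := by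
    ext x
    rw [hφ, tfShift, modChar_zero, one_mul, matrixForm_apply]
    simp
  rw [h2]
  exact ⟨2 * h, _, by positivity, h1⟩

lemma IsGaussianFun.ne_zero {n : ℕ} {φ : RSpace n → ℂ} (hφ : IsGaussianFun φ) : φ ≠ 0 := by
  obtain ⟨c, A, x₀, hc, -, hφ⟩ := hφ
  intro h
  have := hφ x₀
  rw [h] at this
  simp at this
  exact hc this.symm

lemma isGaussianFun_standardGaussian (n : ℕ) : IsGaussianFun (standardGaussian n) := by
  refine ⟨((Real.pi ^ (-(n : ℝ) / 4) : ℝ) : ℂ), Matrix.diagonal fun _ => 1 / 2, 0, ?_,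
    Matrix.PosDef.diagonal fun _ => by norm_num, fun x => ?_⟩
  · have := Real.pi_pos
    exact_mod_cast (Real.rpow_pos_of_pos this _).ne'
  · have h1 : ∑ i, ∑ j, (Matrix.diagonal (fun _ : Fin n => (1 / 2 : ℝ))) i j * (x i - (0 : RSpace n) i) *
        (x j - (0 : RSpace n) j) = ‖x‖ ^ 2 / 2 := by
      rw [EuclideanSpace.real_norm_sq_eq, Finset.sum_div]
      refine Finset.sum_congr rfl fun i _ => ?_
      rw [Finset.sum_eq_single i]
      · simp only [Matrix.diagonal_apply_eq, PiLp.zero_apply, sub_zero]; ring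
      · intro j _ hj; simp [Matrix.diagonal_apply_ne' _ hj]
      · simp
    rw [h1, standardGaussian]
    push_cast
    ring_nf

/-! ### Symbol classes -/

lemma norm_partialD_le_of_iteratedFDeriv_le {n : ℕ} {s ε A : ℝ} (hs : 0 ≤ s) (hε : 0 ≤ ε)
    (hA : 0 ≤ A) {f : RSpace n → ℂ} {x : RSpace n} (α : Fin n → ℕ)
    (h : ‖iteratedFDeriv ℝ (multiOrder α) f x‖ ≤
      A * (ε ^ multiOrder α * ((multiOrder α).factorial : ℝ) ^ s)) :
    ‖partialD α f x‖ ≤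
      A * (((2 ^ n) ^ s * ε) ^ multiOrder α * multiFactorial α ^ s) := by
  refine (norm_partialD_le f α x).trans (h.trans ?_)
  have h1 : ((multiOrder α).factorial : ℝ) ^ s ≤
      ((2 ^ n) ^ s) ^ multiOrder α * multiFactorial α ^ s := by
    have h2 := Real.rpow_le_rpow (by positivity) (factorial_multiOrder_le α) hs
    rwa [Real.mul_rpow (by positivity) (multiFactorial_pos α).le, ← Real.rpow_natCast_mul
      (by positivity), mul_comm (multiOrder α : ℝ), Real.rpow_mul_natCast (by positivity)] at h2
  calc _ ≤ A * (ε ^ multiOrder α * (((2 ^ n) ^ s) ^ multiOrder α * multiFactorial α ^ s)) := by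
        gcongr
    _ = _ := by rw [mul_pow]; ring

lemma norm_iteratedFDeriv_le_of_forall_partialD {n : ℕ} {s ε A : ℝ} (hs : 0 ≤ s) (hε : 0 ≤ ε)
    (hA : 0 ≤ A) {f : RSpace n → ℂ} (hf : ContDiff ℝ (⊤ : ℕ∞) f) {x : RSpace n}
    (h : ∀ α : Fin n → ℕ, ‖partialD α f x‖ ≤ A * (ε ^ multiOrder α * multiFactorial α ^ s)) (k : ℕ) :
    ‖iteratedFDeriv ℝ k f x‖ ≤ A * ((n * ε) ^ k * (k.factorial : ℝ) ^ s) := by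
  have := norm_iteratedFDeriv_le_of_partialD (k := k) (M := A * (ε ^ k * (k.factorial : ℝ) ^ s))
    hf (x := x) (by positivity) fun α hα => (h α).trans (by
      have h1 := multiFactorial_le α
      have h2 := (multiFactorial_pos α).le
      rw [hα] at h1 ⊢
      gcongr)
  refine this.trans_eq ?_
  rw [mul_pow]
  ring

/-- The symbol class, with bounds on the full derivatives. -/
def HasSymbolBound {n : ℕ} (s : ℝ) (ω : RSpace n → ℝ) (a : RSpace n → ℂ) : Prop :=
  ContDiff ℝ (⊤ : ℕ∞) a ∧ ∀ ε : ℝ, 0 < ε → ∃ C : ℝ, 0 ≤ C ∧ ∀ (k : ℕ) (x : RSpace n),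
    ‖iteratedFDeriv ℝ k a x‖ ≤ C * ω x * (ε ^ k * (k.factorial : ℝ) ^ s)

/-- Passing between partial and full derivatives costs factors geometric in the order, which are
harmless because `ε` is arbitrary. -/
lemma mem_symbolClass_iff {n : ℕ} {s : ℝ} (hs : 0 ≤ s) {ω : RSpace n → ℝ} (hω : ∀ x, 0 < ω x)
    {a : RSpace n → ℂ} : a ∈ symbolClass s ω ↔ HasSymbolBound s ω a := by
  refine and_congr_right fun ha => ⟨fun H ε hε => ?_, fun H ε hε => ?_⟩
  · obtain ⟨C, hC⟩ := H (ε / (n + 1)) (by positivity)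
    refine ⟨max C 0, le_max_right _ _, fun k x => ?_⟩
    have hx := hω x
    have hle : (n : ℝ) * (ε / (n + 1)) ≤ ε := by
      rw [mul_div_left_comm]
      refine mul_le_of_le_one_right hε.le ?_
      rw [div_le_one (by positivity)]
      linarith
    refine (norm_iteratedFDeriv_le_of_forall_partialD hs (ε := ε / (n + 1)) (A := max C 0 * ω x)
      (by positivity) (by positivity) ha (fun α => (hC α x).trans ?_) k).trans ?_
    · have h2 := (multiFactorial_pos α).le
      have h3 : C ≤ max C 0 := le_max_left _ _
      calc _ ≤ max C 0 * (ω x * (ε / (n + 1)) ^ multiOrder α * multiFactorial α ^ s) := by gcongr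
        _ = _ := by ring
    · gcongr
  · obtain ⟨C, hC0, hC⟩ := H (ε / (2 ^ n) ^ s) (by positivity)
    refine ⟨C, fun α x => ?_⟩
    have hx := hω x
    refine (norm_partialD_le_of_iteratedFDeriv_le hs (ε := ε / (2 ^ n) ^ s) (A := C * ω x)
      (by positivity) (by positivity) α (hC _ x)).trans_eq ?_
    rw [mul_div_cancel₀ _ (by positivity)]
    ring

lemma HasSymbolBound.exists_norm_le {n : ℕ} {s : ℝ} {ω : RSpace n → ℝ} {a : RSpace n → ℂ}
    (ha : HasSymbolBound s ω a) : ∃ A : ℝ, 0 ≤ A ∧ ∀ x, ‖a x‖ ≤ A * ω x := by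
  obtain ⟨A, hA, h⟩ := ha.2 1 one_pos
  exact ⟨A, hA, fun x => by simpa using h 0 x⟩

/-! ### Distributions given by functions -/

lemma pairing_of_mem {n : ℕ} {T : Submodule ℂ (RSpace n → ℂ)} (u : T →ₗ[ℂ] ℂ) {f : RSpace n → ℂ}
    (hf : f ∈ T) : pairing u f = u ⟨f, hf⟩ := dif_pos hf

/-- Translates bounds at all scales into decay at all rates, the form in which they compete with the
weight. -/
lemma exists_scale {σ : ℝ} (hσ : 0 < σ) (r : ℝ) :
    ∃ h : ℝ, 0 < h ∧ ∀ h', 0 < h' → h' ≤ h → r ≤ (1 / h') ^ (1 / σ) := by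
  refine ⟨(max r 1) ^ (-σ), by positivity, fun h' hh' hle => (le_max_left r 1).trans ?_⟩
  have h1 : (max r 1) ^ σ ≤ 1 / h' := by
    rw [le_div_iff₀ hh']
    calc _ ≤ (max r 1) ^ σ * (max r 1) ^ (-σ) := by gcongr
      _ = 1 := by rw [← Real.rpow_add (by positivity)]; simp
  calc max r 1 = ((max r 1) ^ σ) ^ (1 / σ) := by
        rw [← Real.rpow_mul (by positivity), mul_one_div_cancel hσ.ne', Real.rpow_one]
    _ ≤ _ := by gcongr

lemma HasGSBound.norm_le_exp {n : ℕ} {σ h C r : ℝ} {f : RSpace n → ℂ} (hh : 0 < h)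
    (hf : HasGSBound σ h C f) (hr : r ≤ (1 / h) ^ (1 / σ)) (x : RSpace n) :
    ‖f x‖ ≤ C * Real.exp (-(r * ‖x‖ ^ (1 / σ))) := by
  refine (hf.norm_le x).trans ?_
  have := hf.nonneg
  rw [div_rpow_norm_eq hh]
  gcongr

/-- Restriction is composition with the inclusion; the uniform constant of `exists_hasGSBound_of_lt`
bounds the result at every scale. -/
lemma exists_restriction {n : ℕ} {s : ℝ} (hs : 1 / 2 < s) (v : GelfandShilovSigmaDual n s s) :
    ∃ u : GelfandShilovDual n (1 / 2) (1 / 2), ExtendsTo u v := by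
  have hle : gelfandShilov n (1 / 2) (1 / 2) ≤ gelfandShilovSigma n s s := fun f hf =>
    gelfandShilov_le_sigma (by norm_num) hs hf
  obtain ⟨v, h₁, hh₁, C, hv⟩ := v
  refine ⟨⟨v ∘ₗ Submodule.inclusion hle, fun h hh => ?_⟩, fun f hf => ⟨hle hf, ?_⟩⟩
  · have hg := one_le_gsScale (n := n) (σ := 1 / 2)
    have hg' := one_le_gsScale (n := n) (σ := s)
    have hs0 : 0 < s := by linarith
    obtain ⟨D, hD, H⟩ := exists_hasGSBound_of_lt n (σ := 1 / 2) (τ := s)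
      (h := gsScale n (1 / 2) * h) (h' := h₁ / gsScale n s) (by norm_num) hs (by positivity)
      (by positivity)
    refine ⟨C * (D * 2 ^ (1 / 2 : ℝ)).toNNReal, fun f hf => (hv _).trans ?_⟩
    obtain ⟨M, hM⟩ : ∃ M : ℝ≥0, (M : ℝ≥0∞) = gsNorm (1 / 2) (1 / 2) h (f : RSpace n → ℂ) :=
      ⟨_, ENNReal.coe_toNNReal hf.ne⟩
    have h1 := hasGSBound_of_gsNorm_le (σ := 1 / 2) (by norm_num) hh M.2 f.2.1
      (hM.symm.le.trans_eq (by simp))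
    have h2 := gsNorm_le_of_hasGSBound hs0 (by positivity) (H _ _ h1)
    rw [mul_div_cancel₀ _ (by positivity)] at h2
    rw [← hM, ENNReal.coe_mul, mul_assoc]
    gcongr
    refine h2.trans_eq ?_
    rw [← mul_assoc, ENNReal.ofReal_mul (by positivity)]
    simp [ENNReal.ofReal]
  · rw [pairing_of_mem _ (hle hf), pairing_of_mem _ hf]
    rfl

lemma integrable_mul_of_norm_le {n : ℕ} {p c C A M : ℝ} (hp : 0 < p) (hA : 0 ≤ A) (hC : 0 ≤ C)
    {ω : RSpace n → ℝ} (hpos : ∀ x, 0 < ω x)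
    (hmod : ∀ x y, ω (x + y) ≤ C * (ω x * Real.exp (c * ‖y‖ ^ p))) {a f : RSpace n → ℂ}
    (ha : Continuous a) (haω : ∀ x, ‖a x‖ ≤ A * ω x) (hf : Continuous f)
    (hfM : ∀ x, ‖f x‖ ≤ M * Real.exp (-((c + 1) * ‖x‖ ^ p))) :
    Integrable (fun x => a x * f x) ∧
      ‖∫ x, a x * f x‖ ≤ A * C * ω 0 * (∫ x : RSpace n, Real.exp (-(1 * ‖x‖ ^ p))) * M := by
  have hI := integrable_exp_neg_norm_rpow (n := n) hp one_pos
  have hle : ∀ x, ‖a x * f x‖ ≤ A * C * ω 0 * M * Real.exp (-(1 * ‖x‖ ^ p)) := by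
    intro x
    have h1 := hmod 0 x
    rw [zero_add] at h1
    have h0 := hpos 0
    have hM : 0 ≤ M := nonneg_of_mul_nonneg_left ((norm_nonneg _).trans (hfM x)) (Real.exp_pos _)
    rw [norm_mul]
    calc _ ≤ (A * (C * (ω 0 * Real.exp (c * ‖x‖ ^ p)))) *
          (M * Real.exp (-((c + 1) * ‖x‖ ^ p))) := by
          gcongr
          · exact (haω x).trans (by gcongr)
          · exact hfM x
      _ = A * C * ω 0 * M * (Real.exp (c * ‖x‖ ^ p) * Real.exp (-((c + 1) * ‖x‖ ^ p))) := by ring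
      _ = _ := by rw [← Real.exp_add]; ring_nf
  refine ⟨(hI.const_mul _).mono' (ha.mul hf).aestronglyMeasurable (Filter.Eventually.of_forall hle),
    (norm_integral_le_of_norm_le (hI.const_mul _) (Filter.Eventually.of_forall hle)).trans_eq ?_⟩
  rw [integral_const_mul]
  ring

/-- One sufficiently small scale makes test functions decay at rate `c + 1`, against growth of the
weight at rate `c`. That single norm bounds the functional, as the dual of the Beurling space
requires. -/
lemma exists_sigmaDual_of_weight {n : ℕ} {σ A : ℝ} (hσ : 0 < σ) {ω : RSpace n → ℝ}
    (hω : ω ∈ weightClass n σ) (hA : 0 ≤ A) {a : RSpace n → ℂ} (ha : Continuous a)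
    (haω : ∀ x, ‖a x‖ ≤ A * ω x) :
    ∃ v : GelfandShilovSigmaDual n σ σ, ∀ f ∈ gelfandShilovSigma n σ σ,
      Integrable (fun x => a x * f x) ∧ pairing v.1 f = ∫ x, a x * f x := by
  obtain ⟨c, C, hc, hC, hmod⟩ := weightClass_bound hω
  have hpos := hω.2.1
  have hg := one_le_gsScale (n := n) (σ := σ)
  obtain ⟨h, hh, hr⟩ := exists_scale hσ (c + 1)
  have key : ∀ f M, HasGSBound σ h M f → Integrable (fun x => a x * f x) ∧
      ‖∫ x, a x * f x‖ ≤ A * C * ω 0 * (∫ x : RSpace n, Real.exp (-(1 * ‖x‖ ^ (1 / σ)))) * M :=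
    fun f M hf => integrable_mul_of_norm_le (by positivity) hA (by linarith) hpos hmod ha haω
      hf.1.continuous (hf.norm_le_exp hh (hr h hh le_rfl))
  have hint : ∀ f ∈ gelfandShilovSigma n σ σ, Integrable (fun x => a x * f x) := fun f hf => by
    obtain ⟨M, hM⟩ := (mem_gelfandShilovSigma_iff hσ).1 hf h hh
    exact (key f M hM).1
  let v : gelfandShilovSigma n σ σ →ₗ[ℂ] ℂ :=
    { toFun := fun f => ∫ x, a x * (f : RSpace n → ℂ) x
      map_add' := fun f g => by
        rw [← integral_add (hint f f.2) (hint g g.2)]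
        simp [mul_add]
      map_smul' := fun r f => by
        rw [RingHom.id_apply, smul_eq_mul, ← integral_const_mul]
        congr 1
        ext x
        simp only [Submodule.coe_smul, Pi.smul_apply, smul_eq_mul]
        ring }
  refine ⟨⟨v, h / gsScale n σ, by positivity, (A * C * ω 0 *
    (∫ x : RSpace n, Real.exp (-(1 * ‖x‖ ^ (1 / σ)))) * 2 ^ σ).toNNReal, fun f => ?_⟩,
    fun f hf => ⟨hint f hf, pairing_of_mem v hf⟩⟩
  obtain ⟨M, hM⟩ : ∃ M : ℝ≥0, (M : ℝ≥0∞) = gsNorm σ σ (h / gsScale n σ) (f : RSpace n → ℂ) :=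
    ⟨_, ENNReal.coe_toNNReal (f.2.2 (h / gsScale n σ) (by positivity)).ne⟩
  have h1 := hasGSBound_of_gsNorm_le hσ (by positivity) M.2 f.2.1
    (hM.symm.le.trans_eq (by simp))
  rw [mul_div_cancel₀ _ (by positivity)] at h1
  have h2 := (key _ _ h1).2
  have h3 : 0 ≤ ∫ x : RSpace n, Real.exp (-(1 * ‖x‖ ^ (1 / σ))) :=
    integral_nonneg fun _ => (Real.exp_pos _).le
  have h0 := hpos 0
  rw [← hM, ← ofReal_norm]
  refine (ENNReal.ofReal_le_ofReal (h2.trans_eq (mul_assoc _ _ _).symm)).trans_eq ?_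
  rw [ENNReal.ofReal_mul (by positivity)]
  simp [ENNReal.ofReal]

/-! ### Short-time Fourier transforms of symbols -/

lemma modChar_add_right {n : ℕ} (Ξ x y : RSpace n) :
    modChar Ξ (x + y) = modChar Ξ x * modChar Ξ y := by
  rw [modChar, modChar, modChar, ← Complex.exp_add, inner_add_left]
  push_cast
  ring_nf

/-- Substituting `y = X + Y` splits off the phase that the factor in `modulatedStft` cancels, and
moves all dependence on `X` in the remaining integral into `a`. -/
lemma integral_mul_tfShift {n : ℕ} (a ψ : RSpace n → ℂ) (X Ξ : RSpace n) :
    ∫ y, a y * tfShift ψ X Ξ y = modChar Ξ X * ∫ Y, modChar Ξ Y * (ψ Y * a (X + Y)) := by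
  rw [← integral_add_left_eq_self _ X, ← integral_const_mul]
  congr 1
  ext Y
  rw [tfShift, modChar_add_right, add_sub_cancel_left]
  ring

lemma continuous_modChar {n : ℕ} (Ξ : RSpace n) : Continuous (modChar Ξ) :=
  (contDiff_modChar Ξ).continuous

section Decay

variable {n : ℕ} {s c Cω : ℝ} {ω : RSpace n → ℝ} {a ψ : RSpace n → ℂ}

/-- Two scales are kept apart: `e` for the `k` derivatives in `X`, and `h` for the `m` derivatives
in `Y` that produce decay in frequency. Splitting `(j+k)!^s` costs `2^{s(j+k)}`, paid in advance by
the scale `e / 2^s` of the symbol; the window at rate `c + 1` pays for replacing `ω(X + Y)` by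
`ω(X)`. -/
lemma norm_iteratedFDeriv_mul_apply_le {h e A B : ℝ} (hs : 0 < s) (hh : 0 < h) (he : 0 < e)
    (heh : e ≤ h) (hA : 0 ≤ A) (hpos : ∀ x, 0 < ω x)
    (hmod : ∀ x y, ω (x + y) ≤ Cω * (ω x * Real.exp (c * ‖y‖ ^ (1 / s)))) (hψ : HasGSBound s h B ψ)
    (hc : c + 1 ≤ (1 / h) ^ (1 / s)) (ha : ContDiff ℝ (⊤ : ℕ∞) a)
    (haω : ∀ k x, ‖iteratedFDeriv ℝ k a x‖ ≤ A * ω x * ((e / 2 ^ s) ^ k * (k.factorial : ℝ) ^ s))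
    (X : RSpace n) (k : ℕ) (v : Fin k → RSpace n) (m : ℕ) (Y : RSpace n) :
    ‖iteratedFDeriv ℝ m (fun Y => ψ Y * iteratedFDeriv ℝ k a (X + Y) v) Y‖ ≤
      (B * A * Cω * ω X * (e ^ k * (k.factorial : ℝ) ^ s) * ∏ i, ‖v i‖) *
        ((2 * h) ^ m * (m.factorial : ℝ) ^ s) * Real.exp (-(1 * ‖Y‖ ^ (1 / s))) := by
  have hB := hψ.nonneg
  have hω := hpos (X + Y)
  have hωX := hpos X
  have hak : ContDiff ℝ (⊤ : ℕ∞) (iteratedFDeriv ℝ k a) := by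
    rw [contDiff_infty]
    exact fun m => (ha.of_le (by exact_mod_cast le_top : ((m + k : ℕ) : WithTop ℕ∞) ≤ _)).iteratedFDeriv_right
      (by push_cast; rfl)
  have hshift : ContDiff ℝ (⊤ : ℕ∞) (fun Y => iteratedFDeriv ℝ k a (X + Y)) :=
    hak.comp (contDiff_const.add contDiff_id)
  set L := ContinuousMultilinearMap.apply ℝ (fun _ : Fin k => RSpace n) ℂ v
  have hL : ‖L‖ ≤ ∏ i, ‖v i‖ := by
    refine L.opNorm_le_bound (by positivity) fun f => ?_
    rw [mul_comm]
    exact f.le_opNorm v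
  have h2 : ∀ j ≤ m, ‖iteratedFDeriv ℝ j (fun Y => iteratedFDeriv ℝ k a (X + Y) v) Y‖ ≤
      (A * ω (X + Y) * (e ^ k * (k.factorial : ℝ) ^ s) * ∏ i, ‖v i‖) *
        (h ^ j * (j.factorial : ℝ) ^ s) := by
    intro j _
    have h3 : (fun Y => iteratedFDeriv ℝ k a (X + Y) v) =
        L ∘ (fun Y => iteratedFDeriv ℝ k a (X + Y)) := rfl
    rw [h3, ContinuousLinearMap.iteratedFDeriv_comp_left L hshift.contDiffAt
      (by exact_mod_cast le_top)]
    refine (ContinuousLinearMap.norm_compContinuousMultilinearMap_le _ _).trans ?_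
    rw [iteratedFDeriv_comp_add_left, norm_iteratedFDeriv_iteratedFDeriv]
    have h4 : ‖iteratedFDeriv ℝ (j + k) a (X + Y)‖ ≤
        A * ω (X + Y) * (e ^ (j + k) * ((j.factorial : ℝ) ^ s * (k.factorial : ℝ) ^ s)) := by
      refine (haω (j + k) (X + Y)).trans ?_
      have h5 := factorial_add_rpow_le hs.le j k
      calc _ ≤ A * ω (X + Y) * ((e / 2 ^ s) ^ (j + k) * ((2 ^ s) ^ (j + k) *
            ((j.factorial : ℝ) ^ s * (k.factorial : ℝ) ^ s))) := by gcongr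
        _ = _ := by
          rw [← mul_assoc ((e / 2 ^ s) ^ (j + k)), ← mul_pow, div_mul_cancel₀ _ (by positivity)]
    calc _ ≤ (∏ i, ‖v i‖) *
          (A * ω (X + Y) * (e ^ (j + k) * ((j.factorial : ℝ) ^ s * (k.factorial : ℝ) ^ s))) := by
          gcongr
      _ ≤ (∏ i, ‖v i‖) * (A * ω (X + Y) * ((h ^ j * e ^ k) *
          ((j.factorial : ℝ) ^ s * (k.factorial : ℝ) ^ s))) := by
          rw [pow_add]; gcongr
      _ = _ := by ring
  have h1 : ∀ j ≤ m, ‖iteratedFDeriv ℝ j ψ Y‖ ≤ (B * Real.exp (-(‖Y‖ / h) ^ (1 / s))) *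
      (h ^ j * (j.factorial : ℝ) ^ s) := fun j _ => (hψ.2 j Y).trans_eq (by ring)
  have h6 := norm_iteratedFDeriv_smul_le_of_le hs.le (by positivity) hh.le (by positivity) hh.le
    hψ.1 (L.contDiff.comp hshift) h1 h2
  refine h6.trans ?_
  have h7 : Real.exp (-(‖Y‖ / h) ^ (1 / s)) * ω (X + Y) ≤
      Cω * ω X * Real.exp (-(1 * ‖Y‖ ^ (1 / s))) := by
    calc _ ≤ Real.exp (-((c + 1) * ‖Y‖ ^ (1 / s))) *
          (Cω * (ω X * Real.exp (c * ‖Y‖ ^ (1 / s)))) := by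
          rw [div_rpow_norm_eq hh]
          have := hmod X Y
          gcongr
      _ = Cω * ω X * (Real.exp (-((c + 1) * ‖Y‖ ^ (1 / s))) * Real.exp (c * ‖Y‖ ^ (1 / s))) := by
          ring
      _ = _ := by rw [← Real.exp_add]; ring_nf
  calc _ = (B * A * (e ^ k * (k.factorial : ℝ) ^ s) * ∏ i, ‖v i‖) *
        ((2 * h) ^ m * (m.factorial : ℝ) ^ s) *
        (Real.exp (-(‖Y‖ / h) ^ (1 / s)) * ω (X + Y)) := by ring
    _ ≤ (B * A * (e ^ k * (k.factorial : ℝ) ^ s) * ∏ i, ‖v i‖) *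
        ((2 * h) ^ m * (m.factorial : ℝ) ^ s) *
        (Cω * ω X * Real.exp (-(1 * ‖Y‖ ^ (1 / s)))) := by gcongr
    _ = _ := by ring

lemma iteratedFDeriv_integral_modChar {h A B : ℝ} (hs : 0 < s) (hc0 : 0 ≤ c) (hh : 0 < h)
    (hA : 0 ≤ A) (hCω : 0 ≤ Cω)
    (hpos : ∀ x, 0 < ω x) (hmod : ∀ x y, ω (x + y) ≤ Cω * (ω x * Real.exp (c * ‖y‖ ^ (1 / s))))
    (hψ : HasGSBound s h B ψ) (hc : c + 1 ≤ (1 / h) ^ (1 / s)) (ha : ContDiff ℝ (⊤ : ℕ∞) a)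
    (haω : ∀ k x, ‖iteratedFDeriv ℝ k a x‖ ≤ A * ω x * (1 ^ k * (k.factorial : ℝ) ^ s))
    (Ξ : RSpace n) :
    ContDiff ℝ (⊤ : ℕ∞) (fun X => ∫ Y, modChar Ξ Y * (ψ Y * a (X + Y))) ∧
      ∀ k X v, iteratedFDeriv ℝ k (fun X => ∫ Y, modChar Ξ Y * (ψ Y * a (X + Y))) X v =
        ∫ Y, modChar Ξ Y * (ψ Y * iteratedFDeriv ℝ k a (X + Y) v) := by
  have hB := hψ.nonneg
  have hc1 := continuous_modChar Ξ
  have hc2 := hψ.1.continuous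
  have hI := integrable_exp_neg_norm_rpow (n := n) (p := 1 / s) (by positivity) one_pos
  have hD : ∀ k X Y, iteratedFDeriv ℝ k (fun X => modChar Ξ Y * (ψ Y * a (X + Y))) X =
      (modChar Ξ Y * ψ Y) • iteratedFDeriv ℝ k a (X + Y) := by
    intro k X Y
    have hcd : ContDiff ℝ (⊤ : ℕ∞) (fun X => a (X + Y)) := ha.comp (contDiff_id.add contDiff_const)
    have := iteratedFDeriv_const_smul_apply (𝕜 := ℝ) (i := k) (a := modChar Ξ Y * ψ Y)
      (f := fun X => a (X + Y)) (x := X) ((hcd.of_le (by exact_mod_cast le_top)).contDiffAt)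
    rw [iteratedFDeriv_comp_add_right] at this
    rw [← this]
    congr 1
    ext X
    simp [mul_assoc]
  have hm : ∀ k X, Continuous (fun Y => (modChar Ξ Y * ψ Y) • iteratedFDeriv ℝ k a (X + Y)) := by
    intro k X
    have := ha.continuous_iteratedFDeriv (m := k) (by exact_mod_cast le_top)
    fun_prop
  have hb : ∀ k X₀ Y, ∀ X ∈ Metric.ball X₀ 1,
      ‖(modChar Ξ Y * ψ Y) • iteratedFDeriv ℝ k a (X + Y)‖ ≤
      (B * A * Cω * (Cω * (ω X₀ * Real.exp c)) * (k.factorial : ℝ) ^ s) *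
        Real.exp (-(1 * ‖Y‖ ^ (1 / s))) := by
    intro k X₀ Y X hX
    rw [norm_smul, norm_mul, norm_modChar, one_mul]
    have h1 : ω X ≤ Cω * (ω X₀ * Real.exp c) := by
      have h2 := hmod X₀ (X - X₀)
      rw [add_sub_cancel] at h2
      have h0 := hpos X₀
      rw [Metric.mem_ball, dist_eq_norm] at hX
      refine h2.trans ?_
      gcongr
      exact mul_le_of_le_one_right hc0 (Real.rpow_le_one (norm_nonneg _) hX.le (by positivity))
    have hX := hpos X
    have hXY := hpos (X + Y)
    calc _ ≤ (B * Real.exp (-((c + 1) * ‖Y‖ ^ (1 / s)))) *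
          (A * (Cω * (ω X * Real.exp (c * ‖Y‖ ^ (1 / s)))) * (1 ^ k * (k.factorial : ℝ) ^ s)) := by
          gcongr
          · exact hψ.norm_le_exp hh hc Y
          · refine (haω k (X + Y)).trans ?_
            have := hmod X Y
            gcongr
      _ = (B * A * Cω * ω X * (k.factorial : ℝ) ^ s) *
          (Real.exp (-((c + 1) * ‖Y‖ ^ (1 / s))) * Real.exp (c * ‖Y‖ ^ (1 / s))) := by
          rw [one_pow]; ring
      _ ≤ (B * A * Cω * (Cω * (ω X₀ * Real.exp c)) * (k.factorial : ℝ) ^ s) *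
          (Real.exp (-((c + 1) * ‖Y‖ ^ (1 / s))) * Real.exp (c * ‖Y‖ ^ (1 / s))) := by gcongr
      _ = _ := by rw [← Real.exp_add]; ring_nf
  have hmain := iteratedFDeriv_integral (μ := (volume : Measure (RSpace n)))
    (G := fun X Y => modChar Ξ Y * (ψ Y * a (X + Y)))
    (fun Y => contDiff_const.mul (contDiff_const.mul (ha.comp (contDiff_id.add contDiff_const))))
    (fun k X => by simp_rw [hD]; exact (hm k X).aestronglyMeasurable)
    (fun k X₀ => ⟨_, hI.const_mul _, Filter.Eventually.of_forall fun Y X hX => by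
      simp_rw [hD]; exact hb k X₀ Y X hX⟩)
  refine ⟨hmain.1, fun k X v => ?_⟩
  rw [hmain.2]
  simp_rw [hD]
  rw [ContinuousMultilinearMap.integral_apply]
  · congr 1
    ext Y
    simp [mul_assoc]
  · exact (hI.const_mul _).mono' (hm k X).aestronglyMeasurable (Filter.Eventually.of_forall fun Y =>
      hb k X Y X (Metric.mem_ball_self one_pos))

/-- The window and the symbol satisfy bounds at all scales, so the scale in `Y` can be chosen from
`R` and the scale in `X` from `ε`. Evaluating the `X`-derivative on vectors reduces the claim to a
scalar Fourier integral. -/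
theorem HasSymbolBound.exists_norm_iteratedFDeriv_integral_le (hs : 0 < s)
    (hω : ω ∈ weightClass n s) (ha : HasSymbolBound s ω a)
    (hψ : ∀ h, 0 < h → ∃ C, HasGSBound s h C ψ) :
    (∀ Ξ, ContDiff ℝ (⊤ : ℕ∞) (fun X => ∫ Y, modChar Ξ Y * (ψ Y * a (X + Y)))) ∧
    ∀ ε R : ℝ, 0 < ε → ∃ C : ℝ, 0 ≤ C ∧ ∀ k X Ξ,
      ‖iteratedFDeriv ℝ k (fun X => ∫ Y, modChar Ξ Y * (ψ Y * a (X + Y))) X‖ ≤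
        C * (ω X * Real.exp (-R * ‖Ξ‖ ^ (1 / s))) * (ε ^ k * (k.factorial : ℝ) ^ s) := by
  obtain ⟨c, Cω, hc, hCω, hmod⟩ := weightClass_bound hω
  have hpos := hω.2.1
  obtain ⟨A₁, hA₁, haω₁⟩ := ha.2 1 one_pos
  have hder : ∀ {h B : ℝ}, 0 < h → HasGSBound s h B ψ → c + 1 ≤ (1 / h) ^ (1 / s) → ∀ Ξ, _ :=
    fun hh hB hch Ξ => iteratedFDeriv_integral_modChar hs hc.le hh hA₁ (by linarith) hpos hmod hB hch
      ha.1 haω₁ Ξ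
  obtain ⟨h₀, hh₀, hch₀⟩ := exists_scale hs (c + 1)
  refine ⟨fun Ξ => ?_, fun ε R hε => ?_⟩
  · obtain ⟨B, hB⟩ := hψ h₀ hh₀
    exact (hder hh₀ hB (hch₀ h₀ hh₀ le_rfl) Ξ).1
  obtain ⟨h₁, hh₁, hR⟩ := exists_scale hs R
  have hs2 : 0 < (2 / s) ^ s * 2 := by positivity
  -- The first bound lets the window beat the weight; the second makes the Fourier decay, at scale
  -- `(2/s)^s · 2h`, at least of rate `R`.
  set h := min h₀ (h₁ / ((2 / s) ^ s * 2))
  have hh : 0 < h := lt_min hh₀ (by positivity)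
  have hch := hch₀ h hh (min_le_left _ _)
  have hRh := hR ((2 / s) ^ s * (2 * h)) (by positivity) (by
    have := min_le_right h₀ (h₁ / ((2 / s) ^ s * 2))
    rw [le_div_iff₀ hs2] at this
    change h * _ ≤ _ at this
    linarith)
  obtain ⟨B, hB⟩ := hψ h hh
  have hB0 := hB.nonneg
  set e := min ε h
  have he : 0 < e := lt_min hε hh
  obtain ⟨A, hA, haω⟩ := ha.2 (e / 2 ^ s) (by positivity)
  set b : RSpace n → ℝ := fun Y => Real.exp (-(1 * ‖Y‖ ^ (1 / s)))
  have hI : Integrable b := integrable_exp_neg_norm_rpow (n := n) (by positivity) one_pos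
  have hI0 : 0 ≤ ∫ Y, b Y := integral_nonneg fun _ => (Real.exp_pos _).le
  have hCω0 : 0 < Cω := by linarith
  refine ⟨2 ^ s * (B * A * Cω * ∫ Y, b Y), by positivity, fun k X Ξ => ?_⟩
  have hX := hpos X
  refine ContinuousMultilinearMap.opNorm_le_bound (by positivity) fun v => ?_
  rw [(hder hh hB hch Ξ).2]
  have hcd : ContDiff ℝ (⊤ : ℕ∞) (fun Y => ψ Y * iteratedFDeriv ℝ k a (X + Y) v) := by
    refine hB.1.mul ?_
    have hak : ContDiff ℝ (⊤ : ℕ∞) (iteratedFDeriv ℝ k a) := by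
      rw [contDiff_infty]
      exact fun m => (ha.1.of_le (by exact_mod_cast le_top :
        ((m + k : ℕ) : WithTop ℕ∞) ≤ _)).iteratedFDeriv_right (by push_cast; rfl)
    exact (ContinuousMultilinearMap.apply ℝ (fun _ : Fin k => RSpace n) ℂ v).contDiff.comp
      (hak.comp (contDiff_const.add contDiff_id))
  refine (norm_integral_modChar_mul_le hs (by positivity) hcd hI (fun _ => (Real.exp_pos _).le)
    (by positivity) (norm_iteratedFDeriv_mul_apply_le hs hh he (min_le_right _ _) hA hpos hmod hB
      hch ha.1 haω X k v) Ξ).trans ?_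
  rw [div_rpow_norm_eq (by positivity), neg_mul]
  calc _ ≤ 2 ^ s * ((B * A * Cω * ω X * (ε ^ k * (k.factorial : ℝ) ^ s) * ∏ i, ‖v i‖) *
        ∫ Y, b Y) * Real.exp (-(R * ‖Ξ‖ ^ (1 / s))) := by
        gcongr
        exact min_le_left _ _
    _ = _ := by ring

end Decay

/-! ### Mixed norms with respect to exponential weights -/

lemma mixedNorm_top_lt_top {n : ℕ} {p C : ℝ} (hp : 0 < p) (hC : 0 ≤ C) {q : ℝ≥0∞} (hq : 1 ≤ q)
    {F : RSpace n → RSpace n → ℂ} (hF : ∀ X Ξ, ‖F X Ξ‖ ≤ C * Real.exp (-‖Ξ‖ ^ p)) :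
    mixedNorm ⊤ q F < ⊤ := by
  have h1 : ∀ Ξ, ‖eLpNorm (fun X => F X Ξ) ⊤ volume‖ₑ ≤ ‖C * Real.exp (-‖Ξ‖ ^ p)‖ₑ := by
    intro Ξ
    rw [enorm_eq_self, eLpNorm_exponent_top]
    refine eLpNormEssSup_le_of_ae_enorm_bound (Filter.Eventually.of_forall fun X => ?_)
    rw [← ofReal_norm, Real.enorm_eq_ofReal (by positivity)]
    exact ENNReal.ofReal_le_ofReal (hF X Ξ)
  refine (eLpNorm_mono_enorm h1).trans_lt ?_
  rcases eq_or_ne q ⊤ with rfl | hqt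
  · rw [eLpNorm_exponent_top]
    refine (eLpNormEssSup_le_of_ae_enorm_bound (C := ENNReal.ofReal C)
      (Filter.Eventually.of_forall fun Ξ => ?_)).trans_lt ENNReal.ofReal_lt_top
    rw [Real.enorm_eq_ofReal (by positivity)]
    refine ENNReal.ofReal_le_ofReal (mul_le_of_le_one_right hC ?_)
    rw [Real.exp_le_one_iff, neg_nonpos]
    positivity
  · have hq0 : q ≠ 0 := (zero_lt_one.trans_le hq).ne'
    have hqr : 0 < q.toReal := ENNReal.toReal_pos hq0 hqt
    rw [eLpNorm_lt_top_iff_lintegral_rpow_enorm_lt_top hq0 hqt]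
    have h2 : ∀ Ξ : RSpace n, ‖C * Real.exp (-‖Ξ‖ ^ p)‖ₑ ^ q.toReal =
        ENNReal.ofReal (C ^ q.toReal * Real.exp (-(q.toReal * ‖Ξ‖ ^ p))) := by
      intro Ξ
      rw [Real.enorm_eq_ofReal (by positivity), ENNReal.ofReal_rpow_of_nonneg (by positivity) hqr.le,
        Real.mul_rpow hC (Real.exp_pos _).le, ← Real.exp_mul]
      ring_nf
    simp_rw [h2]
    exact ((integrable_exp_neg_norm_rpow hp hqr).const_mul _).lintegral_lt_top

/-- For finite `q`, Hölder is replaced by a case split: `e T ≤ e` where `T ≤ 1`, and `e T ≤ T ≤ T^q`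
elsewhere. No measurability of `T` is asked for. -/
lemma lintegral_mul_lt_top_of_eLpNorm_lt_top {α : Type*} [MeasurableSpace α] {μ : Measure α}
    {q : ℝ≥0∞} (hq : 1 ≤ q) {e T : α → ℝ≥0∞} (he : Measurable e) (he1 : ∀ x, e x ≤ 1)
    (hei : ∫⁻ x, e x ∂μ < ⊤) (hT : eLpNorm T q μ < ⊤) : ∫⁻ x, e x * T x ∂μ < ⊤ := by
  rcases eq_or_ne q ⊤ with rfl | hqt
  · rw [eLpNorm_exponent_top] at hT
    calc _ ≤ ∫⁻ x, e x * eLpNormEssSup T μ ∂μ := lintegral_mono_ae (by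
          filter_upwards [enorm_ae_le_eLpNormEssSup T μ] with x hx
          gcongr
          exact hx)
      _ = (∫⁻ x, e x ∂μ) * eLpNormEssSup T μ := lintegral_mul_const _ he
      _ < ⊤ := ENNReal.mul_lt_top hei hT
  · have h1 := lintegral_rpow_enorm_lt_top_of_eLpNorm_lt_top (zero_lt_one.trans_le hq).ne' hqt hT
    have hq1 : 1 ≤ q.toReal := by
      simpa using ENNReal.toReal_mono hqt hq
    · calc _ ≤ ∫⁻ x, (e x + ‖T x‖ₑ ^ q.toReal) ∂μ := lintegral_mono fun x => by
            rcases le_total (T x) 1 with h | h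
            · exact (mul_le_of_le_one_right' h).trans le_self_add
            · refine le_trans ?_ le_add_self
              calc e x * T x ≤ 1 * T x := by gcongr; exact he1 x
                _ = T x ^ (1 : ℝ) := by simp
                _ ≤ _ := ENNReal.rpow_le_rpow_of_exponent_le h hq1
        _ = (∫⁻ x, e x ∂μ) + ∫⁻ x, ‖T x‖ₑ ^ q.toReal ∂μ := lintegral_add_left he _
        _ < ⊤ := ENNReal.add_lt_top.2 ⟨hei, h1⟩

/-! ### The weights `weightR` -/

section WeightR

variable {d : ℕ}

lemma norm_sq_eq_firstPart_add_secondPart (Z : RSpace (d + d)) :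
    ‖Z‖ ^ 2 = ‖firstPart Z‖ ^ 2 + ‖secondPart Z‖ ^ 2 := by
  rw [EuclideanSpace.real_norm_sq_eq, EuclideanSpace.real_norm_sq_eq,
    EuclideanSpace.real_norm_sq_eq, Fin.sum_univ_add]
  rfl

lemma rpow_parts_le {p : ℝ} (hp : 0 ≤ p) (Z : RSpace (d + d)) :
    ‖secondPart Z‖ ^ p + ‖firstPart Z‖ ^ p ≤ 2 * ‖Z‖ ^ p := by
  have h := norm_sq_eq_firstPart_add_secondPart Z
  have h1 : ‖secondPart Z‖ ≤ ‖Z‖ := abs_le_of_sq_le_sq' (by nlinarith [sq_nonneg ‖firstPart Z‖])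
    (norm_nonneg _) |>.2
  have h2 : ‖firstPart Z‖ ≤ ‖Z‖ := abs_le_of_sq_le_sq' (by nlinarith [sq_nonneg ‖secondPart Z‖])
    (norm_nonneg _) |>.2
  rw [two_mul]
  gcongr

lemma rpow_le_parts {p : ℝ} (hp : 0 ≤ p) (Z : RSpace (d + d)) :
    ‖Z‖ ^ p ≤ 2 ^ p * (‖secondPart Z‖ ^ p + ‖firstPart Z‖ ^ p) := by
  have h := norm_sq_eq_firstPart_add_secondPart Z
  have hm : ‖Z‖ ≤ 2 * max ‖secondPart Z‖ ‖firstPart Z‖ := by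
    have h1 := le_max_left ‖secondPart Z‖ ‖firstPart Z‖
    have h2 := le_max_right ‖secondPart Z‖ ‖firstPart Z‖
    refine (abs_le_of_sq_le_sq' ?_ (by positivity)).2
    nlinarith [norm_nonneg (firstPart Z), norm_nonneg (secondPart Z)]
  calc _ ≤ (2 * max ‖secondPart Z‖ ‖firstPart Z‖) ^ p := by gcongr
    _ = 2 ^ p * (max ‖secondPart Z‖ ‖firstPart Z‖) ^ p := Real.mul_rpow (by norm_num) (by positivity)
    _ ≤ _ := by
      gcongr
      rcases max_cases ‖secondPart Z‖ ‖firstPart Z‖ with ⟨h, -⟩ | ⟨h, -⟩ <;> rw [h]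
      · exact le_add_of_nonneg_right (by positivity)
      · exact le_add_of_nonneg_left (by positivity)

lemma weightR_pos {s R : ℝ} {ω : RSpace (d + d) → ℝ} (hpos : ∀ x, 0 < ω x) (X Ξ : RSpace (d + d)) :
    0 < weightR s ω R X Ξ := mul_pos (hpos X) (Real.exp_pos _)

/-- Functions with rapid decay in the second variable have finite weighted mixed norms. -/
lemma mixedNorm_weightR_lt_top {s : ℝ} (hs : 0 < s) {ω : RSpace (d + d) → ℝ}
    (hpos : ∀ x, 0 < ω x) {V : RSpace (d + d) → RSpace (d + d) → ℂ}
    (hV : ∀ R : ℝ, 0 < R → ∃ C : ℝ, ∀ X Ξ, ‖V X Ξ‖ ≤ C * (ω X * Real.exp (-R * ‖Ξ‖ ^ (1 / s))))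
    {q : ℝ≥0∞} (hq : 1 ≤ q) {R : ℝ} (hR : 0 < R) :
    mixedNorm ⊤ q (fun X Ξ => ((weightR s ω R X Ξ)⁻¹ : ℝ) * V X Ξ) < ⊤ := by
  -- The sum in `weightR` is at most `2‖Ξ‖^{1/s}`, so `2R` compensates the weight; the remaining 1
  -- leaves a function with finite `L^q` norm for every `q`.
  obtain ⟨C, hC⟩ := hV (2 * R + 1) (by positivity)
  refine mixedNorm_top_lt_top (p := 1 / s) (C := max C 0) (by positivity) (le_max_right _ _) hq
    fun X Ξ => ?_
  have hX := hpos X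
  have hw := weightR_pos (s := s) (R := R) hpos X Ξ
  rw [norm_mul, norm_real, norm_inv, Real.norm_of_nonneg hw.le, inv_mul_le_iff₀ hw]
  have h1 := rpow_parts_le (p := 1 / s) (by positivity) Ξ
  calc _ ≤ max C 0 * (ω X * Real.exp (-(2 * R + 1) * ‖Ξ‖ ^ (1 / s))) := by
        refine (hC X Ξ).trans ?_
        gcongr
        exact le_max_left _ _
    _ ≤ max C 0 * (ω X * (Real.exp (-R * (‖secondPart Ξ‖ ^ (1 / s) + ‖firstPart Ξ‖ ^ (1 / s))) *
        Real.exp (-‖Ξ‖ ^ (1 / s)))) := by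
        rw [← Real.exp_add]
        gcongr
        nlinarith
    _ = _ := by rw [weightR]; ring

/-- Finite weighted mixed norms of a continuous function give a pointwise bound by an integrable
function of the second variable. -/
lemma exists_integrable_bound_of_mixedNorm {s : ℝ} (hs : 0 < s) {ω : RSpace (d + d) → ℝ}
    (hω : ω ∈ weightClass (d + d) s) {V : RSpace (d + d) → RSpace (d + d) → ℂ}
    (hV : Continuous fun p : RSpace (d + d) × RSpace (d + d) => V p.1 p.2)
    {q : ℝ≥0∞} (hq : 1 ≤ q) (hfin : ∀ R : ℝ, 0 < R →
      mixedNorm ⊤ q (fun X Ξ => ((weightR s ω R X Ξ)⁻¹ : ℝ) * V X Ξ) < ⊤) :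
    ∃ N : RSpace (d + d) → ℝ, (∀ Ξ, 0 ≤ N Ξ) ∧
      (∀ R : ℝ, Integrable fun Ξ => Real.exp (R * ‖Ξ‖ ^ (1 / s)) * N Ξ) ∧
      ∀ᵐ Ξ, ∀ X, ‖V X Ξ‖ ≤ ω X * N Ξ := by
  obtain ⟨c, Cω, hc, hCω, hmod⟩ := weightClass_bound hω
  have hpos := hω.2.1
  have hp : 0 < 1 / s := by positivity
  set m : RSpace (d + d) → ℝ := fun Ξ => ‖secondPart Ξ‖ ^ (1 / s) + ‖firstPart Ξ‖ ^ (1 / s)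
  have hm0 : ∀ Ξ, 0 ≤ m Ξ := fun Ξ => by positivity
  -- A true supremum of functions continuous in `Ξ` is lower semicontinuous, hence measurable, even
  -- though `ω` need not be continuous.
  set NE : RSpace (d + d) → ℝ≥0∞ := fun Ξ => ⨆ X, ENNReal.ofReal (‖V X Ξ‖ / ω X)
  have hNE : Measurable NE := by
    refine LowerSemicontinuous.measurable (lowerSemicontinuous_iSup fun X => ?_)
    refine Continuous.lowerSemicontinuous (ENNReal.continuous_ofReal.comp ?_)
    exact ((hV.comp (Continuous.prodMk_right X)).norm).div_const _
  set S : ℝ → RSpace (d + d) → ℝ≥0∞ := fun R Ξ =>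
    eLpNorm (fun X => ((weightR s ω R X Ξ)⁻¹ : ℝ) * V X Ξ) ⊤ volume
  have hNS : ∀ R Ξ, NE Ξ * ENNReal.ofReal (Cω⁻¹ * Real.exp (R * m Ξ)) ≤ S R Ξ := by
    intro R Ξ
    rcases eq_or_ne (S R Ξ) ⊤ with h | h
    · rw [h]; exact le_top
    have hae : ∀ᵐ X, ‖V X Ξ‖ ≤ (S R Ξ).toReal * Real.exp (-R * m Ξ) * ω X := by
      filter_upwards [ae_le_eLpNormEssSup (μ := (volume : Measure (RSpace (d + d))))
        (f := fun X => (((weightR s ω R X Ξ)⁻¹ : ℝ) : ℂ) * V X Ξ)] with X hX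
      have hX0 := hpos X
      have hw := weightR_pos (s := s) (R := R) hpos X Ξ
      rw [← eLpNorm_exponent_top] at hX
      have h2 := ENNReal.toReal_mono h hX
      rw [toReal_enorm, norm_mul, norm_real, norm_inv, Real.norm_of_nonneg hw.le,
        inv_mul_le_iff₀ hw] at h2
      refine h2.trans_eq ?_
      rw [weightR]
      ring
    -- To pass from almost every `X` to every `X₀`, `ω(X)` is majorized by a function continuous in
    -- `X`; the inequality then holds on a closed dense set, and at `X = X₀` only the constant `Cω`
    -- is lost.
    have hall : ∀ X₀, ‖V X₀ Ξ‖ ≤ (S R Ξ).toReal * Real.exp (-R * m Ξ) * (Cω * ω X₀) := by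
      intro X₀
      have hcl : IsClosed {X | ‖V X Ξ‖ ≤ (S R Ξ).toReal * Real.exp (-R * m Ξ) *
          (Cω * (ω X₀ * Real.exp (c * ‖X - X₀‖ ^ (1 / s))))} := by
        refine isClosed_le ((hV.comp (Continuous.prodMk_left Ξ)).norm) ?_
        have : Continuous fun X : RSpace (d + d) => ‖X - X₀‖ ^ (1 / s) :=
          (continuous_id.sub continuous_const).norm.rpow_const fun _ => Or.inr hp.le
        fun_prop
      have hd := Measure.dense_of_ae (hae.mono fun X hX => show ‖V X Ξ‖ ≤
          (S R Ξ).toReal * Real.exp (-R * m Ξ) *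
          (Cω * (ω X₀ * Real.exp (c * ‖X - X₀‖ ^ (1 / s)))) from hX.trans (by
        have := hmod X₀ (X - X₀)
        rw [add_sub_cancel] at this
        gcongr))
      have h3 := hcl.closure_eq ▸ hd.closure_eq
      have h4 : X₀ ∈ {X | ‖V X Ξ‖ ≤ (S R Ξ).toReal * Real.exp (-R * m Ξ) *
          (Cω * (ω X₀ * Real.exp (c * ‖X - X₀‖ ^ (1 / s))))} := h3 ▸ Set.mem_univ X₀
      simpa only [Set.mem_ofPred_eq, sub_self, norm_zero, Real.zero_rpow hp.ne', mul_zero,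
        Real.exp_zero, mul_one] using h4
    have hCω0 : 0 < Cω := by linarith
    have h5 : NE Ξ ≤ ENNReal.ofReal ((S R Ξ).toReal * Real.exp (-R * m Ξ) * Cω) := by
      refine iSup_le fun X => ENNReal.ofReal_le_ofReal ?_
      rw [div_le_iff₀ (hpos X), mul_assoc]
      exact hall X
    calc _ ≤ ENNReal.ofReal ((S R Ξ).toReal * Real.exp (-R * m Ξ) * Cω) *
          ENNReal.ofReal (Cω⁻¹ * Real.exp (R * m Ξ)) := by gcongr
      _ = ENNReal.ofReal (S R Ξ).toReal := by
        rw [← ENNReal.ofReal_mul (by positivity)]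
        congr 1
        calc _ = (S R Ξ).toReal * (Real.exp (-R * m Ξ) * Real.exp (R * m Ξ)) * (Cω * Cω⁻¹) := by
              ring
          _ = _ := by rw [← Real.exp_add, mul_inv_cancel₀ hCω0.ne']; simp
      _ = _ := ENNReal.ofReal_toReal h
  have hm_cont : Continuous m := by
    have h1 : Continuous fun Ξ : RSpace (d + d) => secondPart Ξ := by
      unfold secondPart; fun_prop
    have h2 : Continuous fun Ξ : RSpace (d + d) => firstPart Ξ := by
      unfold firstPart; fun_prop
    exact (h1.norm.rpow_const fun _ => Or.inr hp.le).add
      (h2.norm.rpow_const fun _ => Or.inr hp.le)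
  -- Using the norm at `R + 1` frees a factor `e^{-m}`, whose integrability converts the `L^q` bound
  -- into an `L^1` bound.
  have hlint : ∀ R : ℝ, 0 ≤ R → ∫⁻ Ξ, NE Ξ * ENNReal.ofReal (Real.exp (R * m Ξ)) < ⊤ := by
    intro R hR
    have hT : eLpNorm (fun Ξ => NE Ξ * ENNReal.ofReal (Cω⁻¹ * Real.exp ((R + 1) * m Ξ))) q volume
        < ⊤ :=
      (eLpNorm_mono_enorm fun Ξ => by
        rw [enorm_eq_self, enorm_eq_self]; exact hNS (R + 1) Ξ).trans_lt (hfin (R + 1) (by positivity))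
    have hei : ∫⁻ Ξ, ENNReal.ofReal (Real.exp (-m Ξ)) < ⊤ := by
      refine lt_of_le_of_lt (lintegral_mono fun Ξ => ENNReal.ofReal_le_ofReal ?_)
        (integrable_exp_neg_norm_rpow (n := d + d) (r := (2 ^ (1 / s))⁻¹) hp
          (by positivity)).lintegral_lt_top
      refine Real.exp_le_exp.2 (neg_le_neg ?_)
      rw [inv_mul_le_iff₀ (by positivity)]
      exact rpow_le_parts hp.le Ξ
    have h1 := lintegral_mul_lt_top_of_eLpNorm_lt_top hq
      (e := fun Ξ => ENNReal.ofReal (Real.exp (-m Ξ))) (by fun_prop)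
      (fun Ξ => by simpa using hm0 Ξ) hei hT
    have hCω0 : 0 < Cω := by linarith
    have h2 : ∀ Ξ, NE Ξ * ENNReal.ofReal (Real.exp (R * m Ξ)) = ENNReal.ofReal Cω *
        (ENNReal.ofReal (Real.exp (-m Ξ)) *
          (NE Ξ * ENNReal.ofReal (Cω⁻¹ * Real.exp ((R + 1) * m Ξ)))) := by
      intro Ξ
      rw [mul_left_comm _ (NE Ξ), mul_left_comm _ (NE Ξ), ← ENNReal.ofReal_mul (by positivity),
        ← ENNReal.ofReal_mul (by positivity)]
      congr 2
      calc _ = Real.exp (-m Ξ + (R + 1) * m Ξ) := by ring_nf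
        _ = (Cω * Cω⁻¹) * (Real.exp (-m Ξ) * Real.exp ((R + 1) * m Ξ)) := by
          rw [mul_inv_cancel₀ hCω0.ne', one_mul, Real.exp_add]
        _ = _ := by ring
    simp_rw [h2]
    rw [lintegral_const_mul' _ _ ENNReal.ofReal_ne_top]
    exact ENNReal.mul_lt_top ENNReal.ofReal_lt_top h1
  have hfinite : ∀ᵐ Ξ, NE Ξ < ⊤ := by
    have := hlint 0 le_rfl
    simp only [zero_mul, Real.exp_zero, ENNReal.ofReal_one, mul_one] at this
    exact ae_lt_top hNE this.ne
  refine ⟨fun Ξ => (NE Ξ).toReal, fun _ => ENNReal.toReal_nonneg, fun R => ?_, ?_⟩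
  · have hmeas : Measurable fun Ξ : RSpace (d + d) =>
        Real.exp (R * ‖Ξ‖ ^ (1 / s)) * (NE Ξ).toReal :=
      (by fun_prop : Measurable fun Ξ : RSpace (d + d) => Real.exp (R * ‖Ξ‖ ^ (1 / s))).mul
        hNE.ennreal_toReal
    refine ⟨hmeas.aestronglyMeasurable, ?_⟩
    refine lt_of_le_of_lt (lintegral_mono fun Ξ => ?_) (hlint (|R| * 2 ^ (1 / s)) (by positivity))
    rw [Real.enorm_eq_ofReal (by positivity), mul_comm (NE Ξ), ENNReal.ofReal_mul (by positivity)]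
    refine mul_le_mul' (ENNReal.ofReal_le_ofReal (Real.exp_le_exp.2 ?_)) ENNReal.ofReal_toReal_le
    rw [mul_assoc]
    calc R * ‖Ξ‖ ^ (1 / s) ≤ |R| * ‖Ξ‖ ^ (1 / s) := by gcongr; exact le_abs_self R
      _ ≤ _ := by gcongr; exact rpow_le_parts hp.le Ξ
  · filter_upwards [hfinite] with Ξ hΞ X
    have h1 : ENNReal.ofReal (‖V X Ξ‖ / ω X) ≤ NE Ξ :=
      le_iSup (fun X => ENNReal.ofReal (‖V X Ξ‖ / ω X)) X
    have h2 := ENNReal.toReal_mono hΞ.ne h1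
    have h3 := hpos X
    rw [ENNReal.toReal_ofReal (by positivity), div_le_iff₀ h3] at h2
    linarith

end WeightR

/-! ### Synthesis of symbols -/

section Synthesis

variable {n : ℕ} {s c Cω : ℝ} {ω : RSpace n → ℝ} {ψ : RSpace n → ℂ}
  {B : RSpace n × RSpace n → ℂ} {N : RSpace n → ℝ}

/-- The function `Z ↦ ∫∫ B(X, Ξ) conj(ψ(Z - X) e^{-i⟨Z, Ξ⟩}) dX dΞ`. -/
def tfSynthesis (ψ : RSpace n → ℂ) (B : RSpace n × RSpace n → ℂ) (Z : RSpace n) : ℂ :=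
  ∫ p, B p * (starRingEnd ℂ) (tfShift ψ p.1 p.2 Z)

lemma ae_prod_of_ae_snd {P : RSpace n → Prop} (h : ∀ᵐ Ξ, P Ξ) :
    ∀ᵐ p : RSpace n × RSpace n, P p.2 := by
  rw [Measure.volume_eq_prod]
  exact Measure.quasiMeasurePreserving_snd.ae h

/-- Moving the weight from `X` to `Z₀` costs growth at rate `c` in `X - Z₀`, and the window
recentred at `Z₀` decays at rate `c + 1`. What remains is integrable in `X`, and the cost of the
frequency is left to `N`. -/
lemma norm_mul_iteratedFDeriv_conj_tfShift_le {h M : ℝ} (hs : 0 < s) (hh : 0 < h)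
    (hCω : 0 ≤ Cω) (hmod : ∀ x y, ω (x + y) ≤ Cω * (ω x * Real.exp (c * ‖y‖ ^ (1 / s))))
    (hpos : ∀ x, 0 < ω x) (hψ : HasGSBound s h M ψ) (hc : c + 1 ≤ (1 / (2 * h)) ^ (1 / s))
    {b : ℂ} {N : ℝ} (hN : 0 ≤ N) {X : RSpace n} (hb : ‖b‖ ≤ ω X * N)
    (Ξ : RSpace n) (k : ℕ) {Z Z₀ : RSpace n} (hZ : ‖Z - Z₀‖ ≤ 1) :
    ‖iteratedFDeriv ℝ k (fun Z => b * (starRingEnd ℂ) (tfShift ψ X Ξ Z)) Z‖ ≤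
      Cω * M * Real.exp ((1 / h) ^ (1 / s)) * ω Z₀ * ((2 * h) ^ k * (k.factorial : ℝ) ^ s) *
      (Real.exp (-(1 * ‖X - Z₀‖ ^ (1 / s))) *
        (Real.exp (s * (1 / h) ^ (1 / s) * ‖Ξ‖ ^ (1 / s)) * N)) := by
  have hM := hψ.nonneg
  have h0 := hpos Z₀
  simp_rw [conj_tfShift]
  have h1 := iteratedFDeriv_const_smul_apply (𝕜 := ℝ) (i := k) (a := b)
      (f := tfShift (fun z => (starRingEnd ℂ) (ψ z)) X (-Ξ)) (x := Z)
      (((contDiff_tfShift hψ.conj.1 X (-Ξ)).of_le (by exact_mod_cast le_top)).contDiffAt)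
  rw [show (fun Z => b * tfShift (fun z => (starRingEnd ℂ) (ψ z)) X (-Ξ) Z) =
    b • tfShift (fun z => (starRingEnd ℂ) (ψ z)) X (-Ξ) from rfl, h1, norm_smul]
  have h2 := norm_iteratedFDeriv_tfShift_le hs hh hψ.conj X (-Ξ) Z k
  rw [norm_neg, div_rpow_norm_eq hh Ξ, ← mul_assoc s] at h2
  have h3 : Real.exp (-(‖Z - X‖ / h) ^ (1 / s)) ≤
      Real.exp ((1 / h) ^ (1 / s)) * Real.exp (-((c + 1) * ‖X - Z₀‖ ^ (1 / s))) := by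
    rw [← Real.exp_add]
    refine Real.exp_le_exp.2 ?_
    have h4 := neg_div_rpow_le (p := 1 / s) (by positivity) hh (Z - Z₀) (X - Z₀)
    rw [show X - Z₀ - (Z - Z₀) = X - Z by abel, norm_sub_rev X Z,
      div_rpow_norm_eq (by positivity) (X - Z₀)] at h4
    have h5 : (‖Z - Z₀‖ / h) ^ (1 / s) ≤ (1 / h) ^ (1 / s) := by gcongr
    have h6 := mul_le_mul_of_nonneg_right hc
      (by positivity : (0 : ℝ) ≤ ‖X - Z₀‖ ^ (1 / s))
    linarith
  have h7 : ω X ≤ Cω * (ω Z₀ * Real.exp (c * ‖X - Z₀‖ ^ (1 / s))) := by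
    have := hmod Z₀ (X - Z₀)
    rwa [add_sub_cancel] at this
  calc _ ≤ (Cω * (ω Z₀ * Real.exp (c * ‖X - Z₀‖ ^ (1 / s))) * N) *
        (M * Real.exp (s * (1 / h) ^ (1 / s) * ‖Ξ‖ ^ (1 / s)) *
          (Real.exp ((1 / h) ^ (1 / s)) * Real.exp (-((c + 1) * ‖X - Z₀‖ ^ (1 / s)))) *
          ((2 * h) ^ k * (k.factorial : ℝ) ^ s)) := by
        refine mul_le_mul (hb.trans (by gcongr)) (h2.trans ?_) (norm_nonneg _) (by positivity)
        gcongr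
    _ = Cω * M * Real.exp ((1 / h) ^ (1 / s)) * ω Z₀ * ((2 * h) ^ k * (k.factorial : ℝ) ^ s) *
      ((Real.exp (c * ‖X - Z₀‖ ^ (1 / s)) * Real.exp (-((c + 1) * ‖X - Z₀‖ ^ (1 / s)))) *
        (Real.exp (s * (1 / h) ^ (1 / s) * ‖Ξ‖ ^ (1 / s)) * N)) := by ring
    _ = _ := by rw [← Real.exp_add]; ring_nf

/-- Derivatives at scale `ε` need a window of scale `h ≤ ε/2`, which produces the growth
`e^{R‖Ξ‖^{1/s}}` with `R = s h^{-1/s}`. It is arbitrarily fast as `ε` shrinks, hence the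
integrability of `N` against all such factors. -/
theorem hasSymbolBound_tfSynthesis (hs : 0 < s) (hω : ω ∈ weightClass n s)
    (hψ : ∀ h, 0 < h → ∃ C, HasGSBound s h C ψ) (hB : Continuous B) (hN0 : ∀ Ξ, 0 ≤ N Ξ)
    (hN : ∀ R : ℝ, Integrable fun Ξ => Real.exp (R * ‖Ξ‖ ^ (1 / s)) * N Ξ)
    (hBN : ∀ᵐ Ξ, ∀ X, ‖B (X, Ξ)‖ ≤ ω X * N Ξ) : HasSymbolBound s ω (tfSynthesis ψ B) := by
  obtain ⟨c, Cω, hc, hCω, hmod⟩ := weightClass_bound hω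
  have hpos := hω.2.1
  have hCω0 : 0 ≤ Cω := by linarith
  have hI := integrable_exp_neg_norm_rpow (n := n) (p := 1 / s) (by positivity) one_pos
  have hBN' := ae_prod_of_ae_snd hBN
  have hdom : ∀ (R : ℝ) (Z₀ : RSpace n), Integrable (fun p : RSpace n × RSpace n =>
      Real.exp (-(1 * ‖p.1 - Z₀‖ ^ (1 / s))) * (Real.exp (R * ‖p.2‖ ^ (1 / s)) * N p.2)) :=
    fun R Z₀ => (hI.comp_sub_right Z₀).mul_prod (hN R)
  have hbd : ∀ {h M : ℝ}, 0 < h → HasGSBound s h M ψ → c + 1 ≤ (1 / (2 * h)) ^ (1 / s) →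
      ∀ k Z₀, ∀ᵐ p : RSpace n × RSpace n, ∀ Z ∈ Metric.ball Z₀ 1,
      ‖iteratedFDeriv ℝ k (fun Z => B p * (starRingEnd ℂ) (tfShift ψ p.1 p.2 Z)) Z‖ ≤
      Cω * M * Real.exp ((1 / h) ^ (1 / s)) * ω Z₀ * ((2 * h) ^ k * (k.factorial : ℝ) ^ s) *
      (Real.exp (-(1 * ‖p.1 - Z₀‖ ^ (1 / s))) *
        (Real.exp (s * (1 / h) ^ (1 / s) * ‖p.2‖ ^ (1 / s)) * N p.2)) := by
    intro h M hh hM hch k Z₀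
    filter_upwards [hBN'] with p hp Z hZ
    rw [Metric.mem_ball, dist_eq_norm] at hZ
    exact norm_mul_iteratedFDeriv_conj_tfShift_le hs hh hCω0 hmod hpos hM hch (hN0 p.2)
      (hp p.1) p.2 k hZ.le
  obtain ⟨h₀, hh₀, hch₀⟩ := exists_scale hs (c + 1)
  have hsc : ∀ h, 0 < h → h ≤ h₀ / 2 → c + 1 ≤ (1 / (2 * h)) ^ (1 / s) := fun h hh hle =>
    hch₀ (2 * h) (by positivity) (by linarith)
  obtain ⟨M₀, hM₀⟩ := hψ (h₀ / 2) (by positivity)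
  have hcd : ∀ p : RSpace n × RSpace n,
      ContDiff ℝ (⊤ : ℕ∞) (fun Z => B p * (starRingEnd ℂ) (tfShift ψ p.1 p.2 Z)) := fun p =>
    contDiff_const.mul (conjCLE.contDiff.comp (contDiff_tfShift hM₀.1 p.1 p.2))
  have hmeas : ∀ k Z, AEStronglyMeasurable (fun p : RSpace n × RSpace n =>
      iteratedFDeriv ℝ k (fun Z => B p * (starRingEnd ℂ) (tfShift ψ p.1 p.2 Z)) Z) volume := by
    intro k Z
    have h1 : ∀ p : RSpace n × RSpace n,
        iteratedFDeriv ℝ k (fun Z => B p * (starRingEnd ℂ) (tfShift ψ p.1 p.2 Z)) Z =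
        B p • iteratedFDeriv ℝ k (tfShift (fun z => (starRingEnd ℂ) (ψ z)) p.1 (-p.2)) Z := by
      intro p
      simp_rw [conj_tfShift]
      exact iteratedFDeriv_const_smul_apply (𝕜 := ℝ) (i := k) (a := B p)
        (f := tfShift (fun z => (starRingEnd ℂ) (ψ z)) p.1 (-p.2)) (x := Z)
        (((contDiff_tfShift hM₀.conj.1 p.1 (-p.2)).of_le (by exact_mod_cast le_top)).contDiffAt)
    simp_rw [h1]
    have h2 := (continuous_iteratedFDeriv_tfShift hs (by positivity) hM₀.conj k Z).comp
      (continuous_fst.prodMk continuous_snd.neg : Continuous fun p : RSpace n × RSpace n =>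
        (p.1, -p.2))
    exact (hB.smul h2).aestronglyMeasurable
  obtain ⟨hsm, hD⟩ := iteratedFDeriv_integral hcd hmeas fun k Z₀ =>
    ⟨_, (hdom _ Z₀).const_mul _, hbd (by positivity) hM₀ (hsc _ (by positivity) le_rfl) k Z₀⟩
  refine ⟨hsm, fun ε hε => ?_⟩
  set h := min (h₀ / 2) (ε / 2)
  have hh : 0 < h := lt_min (by positivity) (by positivity)
  obtain ⟨M, hM⟩ := hψ h hh
  have hM0 := hM.nonneg
  set R := s * (1 / h) ^ (1 / s)
  set J := (∫ X : RSpace n, Real.exp (-(1 * ‖X‖ ^ (1 / s)))) *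
    ∫ Ξ, Real.exp (R * ‖Ξ‖ ^ (1 / s)) * N Ξ
  have hJ0 : 0 ≤ J := mul_nonneg (integral_nonneg fun _ => (Real.exp_pos _).le)
    (integral_nonneg fun Ξ => mul_nonneg (Real.exp_pos _).le (hN0 Ξ))
  have hJ : ∀ Z₀ : RSpace n, ∫ p : RSpace n × RSpace n, Real.exp (-(1 * ‖p.1 - Z₀‖ ^ (1 / s))) *
      (Real.exp (R * ‖p.2‖ ^ (1 / s)) * N p.2) = J := by
    intro Z₀
    rw [Measure.volume_eq_prod, integral_prod_mul
      (fun X : RSpace n => Real.exp (-(1 * ‖X - Z₀‖ ^ (1 / s))))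
      (fun Ξ => Real.exp (R * ‖Ξ‖ ^ (1 / s)) * N Ξ),
      integral_sub_right_eq_self (fun X : RSpace n => Real.exp (-(1 * ‖X‖ ^ (1 / s))))]
  refine ⟨Cω * M * Real.exp ((1 / h) ^ (1 / s)) * J, by positivity, fun k Z => ?_⟩
  have hZ := hpos Z
  rw [show tfSynthesis ψ B = fun Z => ∫ p, B p * (starRingEnd ℂ) (tfShift ψ p.1 p.2 Z) from rfl, hD]
  refine (norm_integral_le_of_norm_le ((hdom _ Z).const_mul _) ((hbd hh hM (hsc h hh
    (min_le_left _ _)) k Z).mono fun p hp => hp Z (Metric.mem_ball_self one_pos))).trans ?_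
  rw [integral_const_mul, hJ]
  have h2ε : 2 * h ≤ ε := by
    have := min_le_right (h₀ / 2) (ε / 2)
    change h ≤ _ at this
    linarith
  calc _ = Cω * M * Real.exp ((1 / h) ^ (1 / s)) * J * ω Z *
        ((2 * h) ^ k * (k.factorial : ℝ) ^ s) := by ring
    _ ≤ _ := by gcongr

theorem integral_tfSynthesis_mul {f : RSpace n → ℂ} (hs : 0 < s)
    (hω : ω ∈ weightClass n s)
    (hψ : ∀ h, 0 < h → ∃ C, HasGSBound s h C ψ) (hf : ∀ h, 0 < h → ∃ C, HasGSBound s h C f)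
    (hB : Continuous B) (hN0 : ∀ Ξ, 0 ≤ N Ξ)
    (hN : ∀ R : ℝ, Integrable fun Ξ => Real.exp (R * ‖Ξ‖ ^ (1 / s)) * N Ξ)
    (hBN : ∀ᵐ Ξ, ∀ X, ‖B (X, Ξ)‖ ≤ ω X * N Ξ) :
    ∫ Z, tfSynthesis ψ B Z * f Z = ∫ p, tfCoeff f ψ p * B p := by
  obtain ⟨c, Cω, hc, hCω, hmod⟩ := weightClass_bound hω
  have hpos := hω.2.1
  have h0 := hpos 0
  have hp : 0 < 1 / s := by positivity
  -- The factor 2 is there because only half of the decay in `Z - X` is converted into decay in `X`.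
  obtain ⟨h', hh', hr⟩ := exists_scale hs (2 * (c + 1))
  obtain ⟨h, rfl⟩ : ∃ h, h' = 2 * h := ⟨h' / 2, by ring⟩
  have hh : 0 < h := by linarith
  have hr1 := hr h hh (by linarith)
  have hr2 := hr (2 * h) hh' le_rfl
  obtain ⟨Mψ, hMψ⟩ := hψ h hh
  obtain ⟨Mf, hMf⟩ := hf h hh
  have hMψ0 := hMψ.nonneg
  have hMf0 := hMf.nonneg
  have hI := integrable_exp_neg_norm_rpow (n := n) hp one_pos
  have hN1 : Integrable N := by simpa using hN 0
  have hint : Integrable (fun q : RSpace n × (RSpace n × RSpace n) =>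
      f q.1 * (B q.2 * (starRingEnd ℂ) (tfShift ψ q.2.1 q.2.2 q.1))) := by
    have hdom : Integrable (fun q : RSpace n × (RSpace n × RSpace n) =>
        (Mf * Mψ * Cω * ω 0) * (Real.exp (-(1 * ‖q.1‖ ^ (1 / s))) *
          (Real.exp (-(1 * ‖q.2.1‖ ^ (1 / s))) * N q.2.2))) :=
      (hI.mul_prod (hI.mul_prod hN1)).const_mul _
    refine hdom.mono' ?_ ?_
    · have h1 := hMf.1.continuous
      have h2 : Continuous fun q : RSpace n × (RSpace n × RSpace n) =>
          tfShift ψ q.2.1 q.2.2 q.1 := by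
        have := hMψ.1.continuous
        unfold tfShift modChar
        fun_prop
      exact ((h1.comp continuous_fst).mul ((hB.comp continuous_snd).mul
        (continuous_conj.comp h2))).aestronglyMeasurable
    · have h1 : ∀ᵐ q : RSpace n × (RSpace n × RSpace n), ∀ X, ‖B (X, q.2.2)‖ ≤ ω X * N q.2.2 := by
        rw [Measure.volume_eq_prod]
        exact Measure.quasiMeasurePreserving_snd.ae (ae_prod_of_ae_snd hBN)
      filter_upwards [h1] with ⟨Z, X, Ξ⟩ hq
      rw [norm_mul, norm_mul, RCLike.norm_conj, norm_tfShift]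
      have h2 := hmod 0 X
      rw [zero_add] at h2
      have h3 := hN0 Ξ
      have h4 : Real.exp (-(‖Z‖ / h) ^ (1 / s)) * Real.exp (-(‖Z - X‖ / h) ^ (1 / s)) ≤
          Real.exp (-(1 * ‖Z‖ ^ (1 / s))) * Real.exp (-((c + 1) * ‖X‖ ^ (1 / s))) := by
        rw [← Real.exp_add, ← Real.exp_add]
        refine Real.exp_le_exp.2 ?_
        have h5 := neg_div_rpow_le hp.le hh Z X
        rw [norm_sub_rev X Z, div_rpow_norm_eq hh', div_rpow_norm_eq hh Z] at h5
        rw [div_rpow_norm_eq hh Z]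
        have h6 := mul_le_mul_of_nonneg_right hr2 (by positivity : (0 : ℝ) ≤ ‖X‖ ^ (1 / s))
        have h7 := mul_le_mul_of_nonneg_right (le_trans (by linarith) hr1 : 2 ≤ (1 / h) ^ (1 / s))
          (by positivity : (0 : ℝ) ≤ ‖Z‖ ^ (1 / s))
        have h8 : 0 ≤ (‖Z - X‖ / h) ^ (1 / s) := by positivity
        linarith
      calc _ ≤ (Mf * Real.exp (-(‖Z‖ / h) ^ (1 / s))) *
            ((Cω * (ω 0 * Real.exp (c * ‖X‖ ^ (1 / s))) * N Ξ) *
              (Mψ * Real.exp (-(‖Z - X‖ / h) ^ (1 / s)))) := by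
            gcongr
            · exact hMf.norm_le Z
            · exact (hq X).trans (by gcongr)
            · exact hMψ.norm_le _
        _ = (Mf * Mψ * Cω * ω 0) * N Ξ * Real.exp (c * ‖X‖ ^ (1 / s)) *
            (Real.exp (-(‖Z‖ / h) ^ (1 / s)) * Real.exp (-(‖Z - X‖ / h) ^ (1 / s))) := by ring
        _ ≤ (Mf * Mψ * Cω * ω 0) * N Ξ * Real.exp (c * ‖X‖ ^ (1 / s)) *
            (Real.exp (-(1 * ‖Z‖ ^ (1 / s))) * Real.exp (-((c + 1) * ‖X‖ ^ (1 / s)))) := by gcongr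
        _ = (Mf * Mψ * Cω * ω 0) * (Real.exp (-(1 * ‖Z‖ ^ (1 / s))) *
            ((Real.exp (c * ‖X‖ ^ (1 / s)) * Real.exp (-((c + 1) * ‖X‖ ^ (1 / s)))) * N Ξ)) := by ring
        _ = _ := by rw [← Real.exp_add]; ring_nf
  calc _ = ∫ Z, ∫ p : RSpace n × RSpace n,
        f Z * (B p * (starRingEnd ℂ) (tfShift ψ p.1 p.2 Z)) := by
        congr 1
        ext Z
        rw [integral_const_mul, mul_comm]
        rfl
    _ = ∫ p : RSpace n × RSpace n, ∫ Z,
        f Z * (B p * (starRingEnd ℂ) (tfShift ψ p.1 p.2 Z)) := integral_integral_swap hint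
    _ = _ := by
        congr 1
        ext p
        rw [tfCoeff, ← integral_mul_const]
        congr 1
        ext Z
        ring

end Synthesis

/-! ### Inversion in the dual spaces -/

lemma conj_mem_gelfandShilov {n : ℕ} {σ : ℝ} (hσ : 0 < σ) {φ : RSpace n → ℂ}
    (hφ : φ ∈ gelfandShilov n σ σ) : (fun z => (starRingEnd ℂ) (φ z)) ∈ gelfandShilov n σ σ := by
  obtain ⟨h, C, hh, H⟩ := (mem_gelfandShilov_iff hσ).1 hφ
  exact (mem_gelfandShilov_iff hσ).2 ⟨h, C, hh, H.conj⟩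

lemma conj_mem_gelfandShilovSigma {n : ℕ} {σ : ℝ} (hσ : 0 < σ) {φ : RSpace n → ℂ}
    (hφ : φ ∈ gelfandShilovSigma n σ σ) :
    (fun z => (starRingEnd ℂ) (φ z)) ∈ gelfandShilovSigma n σ σ := by
  refine (mem_gelfandShilovSigma_iff hσ).2 fun h hh => ?_
  obtain ⟨C, H⟩ := (mem_gelfandShilovSigma_iff hσ).1 hφ h hh
  exact ⟨C, H.conj⟩

lemma tfShift_mem_gelfandShilov {n : ℕ} {σ : ℝ} (hσ : 0 < σ) {ψ : RSpace n → ℂ}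
    (hψ : ψ ∈ gelfandShilov n σ σ) (X Ξ : RSpace n) : tfShift ψ X Ξ ∈ gelfandShilov n σ σ := by
  obtain ⟨h, C, hh, H⟩ := (mem_gelfandShilov_iff hσ).1 hψ
  exact (mem_gelfandShilov_iff hσ).2 ⟨2 * h, _, by positivity, H.tfShift hσ hh X Ξ⟩

lemma tfShift_mem_gelfandShilovSigma {n : ℕ} {σ : ℝ} (hσ : 0 < σ) {ψ : RSpace n → ℂ}
    (hψ : ψ ∈ gelfandShilovSigma n σ σ) (X Ξ : RSpace n) :
    tfShift ψ X Ξ ∈ gelfandShilovSigma n σ σ := by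
  refine (mem_gelfandShilovSigma_iff hσ).2 fun h hh => ?_
  obtain ⟨C, H⟩ := (mem_gelfandShilovSigma_iff hσ).1 hψ (h / 2) (by positivity)
  have := H.tfShift hσ (by positivity) X Ξ
  rw [mul_div_cancel₀ _ two_ne_zero] at this
  exact ⟨_, this⟩

/-- The constant in the inversion formula. -/
def inversionConst {n : ℕ} (ψ : RSpace n → ℂ) : ℂ := (((2 * Real.pi) ^ n * ∫ x, ‖ψ x‖ ^ 2 : ℝ) : ℂ)

lemma HasGSBound.inversionConst_ne_zero {n : ℕ} {σ h C : ℝ} (hσ : 0 < σ) (hh : 0 < h)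
    {ψ : RSpace n → ℂ} (hψ : HasGSBound σ h C ψ) (hψ0 : ψ ≠ 0) : inversionConst ψ ≠ 0 := by
  obtain ⟨x₀, hx₀⟩ := Function.ne_iff.1 hψ0
  have hc : Continuous fun x => ‖ψ x‖ ^ 2 := hψ.1.continuous.norm.pow 2
  have hi : Integrable fun x => ‖ψ x‖ ^ 2 := by
    refine ((hψ.integrable hσ hh).norm.const_mul C).mono' hc.aestronglyMeasurable
      (Filter.Eventually.of_forall fun x => ?_)
    rw [Real.norm_of_nonneg (by positivity), pow_two]
    gcongr
    exact hψ.norm_le_const hh x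
  have h1 : 0 < ∫ x, ‖ψ x‖ ^ 2 :=
    integral_pos_of_integrable_nonneg_nonzero hc hi (fun x => by positivity)
      (x := x₀) (pow_ne_zero _ (norm_ne_zero_iff.2 hx₀))
  have := Real.pi_pos
  exact ofReal_ne_zero.2 (by positivity : (0 : ℝ) < (2 * Real.pi) ^ n * ∫ x, ‖ψ x‖ ^ 2).ne'

/-- In the Roumieu case `f` and `ψ` dictate the scale, and the functional is bounded at every scale,
in particular at the enlarged one. -/
lemma GelfandShilovDual.inversion {n : ℕ} {σ : ℝ} (hσ : 0 < σ) (u : GelfandShilovDual n σ σ)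
    {f ψ : RSpace n → ℂ} (hf : f ∈ gelfandShilov n σ σ) (hψ : ψ ∈ gelfandShilov n σ σ) :
    Continuous (fun p : RSpace n × RSpace n => pairing u.1 (tfShift ψ p.1 p.2)) ∧
    ∫ p, tfCoeff f ψ p * pairing u.1 (tfShift ψ p.1 p.2) = inversionConst ψ * pairing u.1 f := by
  obtain ⟨h, C, hh, hfh⟩ := (mem_gelfandShilov_iff hσ).1 hf
  obtain ⟨h', C', hh', hψh⟩ := (mem_gelfandShilov_iff hσ).1 hψ
  have hg := one_le_gsScale (n := n) (σ := σ)
  have hs1 := inversionScale_ge (σ := σ)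
  have hm2 : (2 : ℝ) ≤ max 2 (2 ^ σ) := le_max_left _ _
  have hs0 : 0 < inversionScale σ := by linarith
  have hm : 0 < max h h' := lt_max_of_lt_left hh
  obtain ⟨D, hD⟩ := u.2 (gsScale n σ * (inversionScale σ * max h h')) (by positivity)
  exact tfShift_inversion hσ hm (hfh.mono hσ hh (le_max_left _ _) le_rfl)
    (hψh.mono hσ hh' (le_max_right _ _) le_rfl) le_rfl (fun f (hf : f ∈ gelfandShilov n σ σ) => hf.1) u.1 hD hf
    (tfShift_mem_gelfandShilov hσ hψ)

/-- In the Beurling case the functional dictates the scale `h₁`, and `f` and `ψ` are bounded at the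
correspondingly smaller one. -/
lemma GelfandShilovSigmaDual.inversion {n : ℕ} {σ : ℝ} (hσ : 0 < σ)
    (v : GelfandShilovSigmaDual n σ σ) {f ψ : RSpace n → ℂ} (hf : f ∈ gelfandShilovSigma n σ σ)
    (hψ : ψ ∈ gelfandShilovSigma n σ σ) :
    Continuous (fun p : RSpace n × RSpace n => pairing v.1 (tfShift ψ p.1 p.2)) ∧
    ∫ p, tfCoeff f ψ p * pairing v.1 (tfShift ψ p.1 p.2) = inversionConst ψ * pairing v.1 f := by
  obtain ⟨h₁, hh₁, D, hD⟩ := v.2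
  have hg := one_le_gsScale (n := n) (σ := σ)
  have hs1 := inversionScale_ge (σ := σ)
  have hm2 : (2 : ℝ) ≤ max 2 (2 ^ σ) := le_max_left _ _
  have hs0 : 0 < inversionScale σ := by linarith
  have hh : 0 < h₁ / (gsScale n σ * inversionScale σ) := by positivity
  obtain ⟨C, hfh⟩ := (mem_gelfandShilovSigma_iff hσ).1 hf _ hh
  obtain ⟨C', hψh⟩ := (mem_gelfandShilovSigma_iff hσ).1 hψ _ hh
  refine tfShift_inversion hσ hh hfh hψh (le_of_eq ?_) (fun f (hf : f ∈ gelfandShilovSigma n σ σ) => hf.1) v.1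
    (fun f _ => hD f) hf (tfShift_mem_gelfandShilovSigma hσ hψ)
  field_simp

lemma IsGaussianFun.exists_hasGSBound {n : ℕ} {φ : RSpace n → ℂ} (hφ : IsGaussianFun φ) :
    ∃ h C, 0 < h ∧ HasGSBound (1 / 2) h C φ :=
  (mem_gelfandShilov_iff (by norm_num)).1 hφ.mem_gelfandShilov

/-- The restriction map from `(Σ_s)'` to `(𝓢_{1/2})'` is injective. -/
lemma ExtendsTo.pairing_eq {n : ℕ} {s : ℝ} (hs : 1 / 2 < s) {u : GelfandShilovDual n (1 / 2) (1 / 2)}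
    {v w : GelfandShilovSigmaDual n s s} (hv : ExtendsTo u v) (hw : ExtendsTo u w)
    (f : RSpace n → ℂ) : pairing v.1 f = pairing w.1 f := by
  by_cases hf : f ∈ gelfandShilovSigma n s s
  · have hs0 : 0 < s := by linarith
    have hG := isGaussianFun_standardGaussian n
    have hg := hG.mem_gelfandShilov
    obtain ⟨h, C, hh, hgb⟩ := hG.exists_hasGSBound
    have hgs := gelfandShilov_le_sigma (by norm_num) hs hg
    have h1 := (v.inversion hs0 hf hgs).2
    have h2 := (w.inversion hs0 hf hgs).2
    -- Shifts of the Gaussian lie in `𝓢_{1/2}`, where both functionals equal `u`; by inversion these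
    -- values determine them on all of `Σ_s`.
    have h3 : ∀ p : RSpace n × RSpace n, pairing v.1 (tfShift (standardGaussian n) p.1 p.2) =
        pairing w.1 (tfShift (standardGaussian n) p.1 p.2) := fun p => by
      have h4 := tfShift_mem_gelfandShilov (by norm_num) hg p.1 p.2
      rw [(hv _ h4).2, (hw _ h4).2]
    simp_rw [h3] at h1
    exact mul_left_cancel₀ (hgb.inversionConst_ne_zero (by norm_num) hh hG.ne_zero)
      (h1.symm.trans h2)
  · rw [pairing, pairing, dif_neg hf, dif_neg hf]

/-! ### The short-time Fourier transform through time-frequency shifts -/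

/-- The normalizing factor of the short-time Fourier transform. -/
def stftConst (n : ℕ) : ℂ := (((2 * Real.pi) ^ (-(n : ℝ) / 2) : ℝ) : ℂ)

lemma stftConst_ne_zero (n : ℕ) : stftConst n ≠ 0 := by
  have := Real.pi_pos
  exact ofReal_ne_zero.2 (by positivity : (0 : ℝ) < (2 * Real.pi) ^ (-(n : ℝ) / 2)).ne'

section Stft

variable {n : ℕ} {T : Submodule ℂ (RSpace n → ℂ)}

lemma stft_eq (φ : RSpace n → ℂ) (u : T →ₗ[ℂ] ℂ) (X Ξ : RSpace n) :
    stft φ u X Ξ = stftConst n * pairing u (tfShift (fun z => (starRingEnd ℂ) (φ z)) X Ξ) := by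
  rw [stft, stftConst]
  congr 2
  ext y
  rw [tfShift, map_mul, mul_comm, modChar, ← Complex.exp_conj]
  simp

lemma exp_mul_stft_eq {φ a : RSpace n → ℂ} {u : T →ₗ[ℂ] ℂ} {X Ξ : RSpace n}
    (hu : pairing u (tfShift (fun z => (starRingEnd ℂ) (φ z)) X Ξ) =
      ∫ y, a y * tfShift (fun z => (starRingEnd ℂ) (φ z)) X Ξ y) :
    Complex.exp (I * (inner ℝ X Ξ : ℝ)) * stft φ u X Ξ =
      stftConst n * ∫ Y, modChar Ξ Y * ((starRingEnd ℂ) (φ Y) * a (X + Y)) := by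
  rw [stft_eq, hu, integral_mul_tfShift, mul_left_comm, ← mul_assoc (Complex.exp _), modChar,
    ← Complex.exp_add, add_neg_cancel, Complex.exp_zero, one_mul]

lemma norm_exp_mul_stft (φ : RSpace n → ℂ) (u : T →ₗ[ℂ] ℂ) (X Ξ : RSpace n) :
    ‖Complex.exp (I * (inner ℝ X Ξ : ℝ)) * stft φ u X Ξ‖ = ‖stft φ u X Ξ‖ := by
  rw [norm_mul, mul_comm I, norm_exp_ofReal_mul_I, one_mul]

variable {s : ℝ} {ω : RSpace n → ℝ}

/-- Short-time Fourier transforms of symbols are smooth and decay rapidly. -/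
lemma HasSymbolBound.exp_mul_stft (hs : 0 < s) (hω : ω ∈ weightClass n s) {a φ : RSpace n → ℂ}
    (ha : HasSymbolBound s ω a) (hφ : φ ∈ gelfandShilovSigma n s s) {u : T →ₗ[ℂ] ℂ}
    (hu : ∀ X Ξ, pairing u (tfShift (fun z => (starRingEnd ℂ) (φ z)) X Ξ) =
      ∫ y, a y * tfShift (fun z => (starRingEnd ℂ) (φ z)) X Ξ y) :
    (∀ Ξ, ContDiff ℝ (⊤ : ℕ∞) fun X => Complex.exp (I * (inner ℝ X Ξ : ℝ)) * stft φ u X Ξ) ∧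
    ∀ ε R : ℝ, 0 < ε → ∃ C : ℝ, 0 ≤ C ∧ ∀ k X Ξ,
      ‖iteratedFDeriv ℝ k (fun X => Complex.exp (I * (inner ℝ X Ξ : ℝ)) * stft φ u X Ξ) X‖ ≤
        C * (ω X * Real.exp (-R * ‖Ξ‖ ^ (1 / s))) * (ε ^ k * (k.factorial : ℝ) ^ s) := by
  obtain ⟨h1, h2⟩ := ha.exists_norm_iteratedFDeriv_integral_le hs hω
    ((mem_gelfandShilovSigma_iff hs).1 (conj_mem_gelfandShilovSigma hs hφ))
  simp_rw [exp_mul_stft_eq (hu _ _)]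
  refine ⟨fun Ξ => contDiff_const.mul (h1 Ξ), fun ε R hε => ?_⟩
  obtain ⟨C, hC, H⟩ := h2 ε R hε
  refine ⟨‖stftConst n‖ * C, by positivity, fun k X Ξ => ?_⟩
  have h3 := iteratedFDeriv_const_smul_apply (𝕜 := ℝ) (i := k) (a := stftConst n)
    (f := fun X => ∫ Y, modChar Ξ Y * ((starRingEnd ℂ) (φ Y) * a (X + Y))) (x := X)
    (((h1 Ξ).of_le (by exact_mod_cast le_top)).contDiffAt)
  refine (congrArg norm h3).le.trans ?_
  rw [norm_smul, mul_assoc, mul_assoc]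
  gcongr
  rw [← mul_assoc]
  exact H k X Ξ

lemma HasSymbolBound.norm_stft_le (hs : 0 < s) (hω : ω ∈ weightClass n s) {a φ : RSpace n → ℂ}
    (ha : HasSymbolBound s ω a) (hφ : φ ∈ gelfandShilovSigma n s s) {u : T →ₗ[ℂ] ℂ}
    (hu : ∀ X Ξ, pairing u (tfShift (fun z => (starRingEnd ℂ) (φ z)) X Ξ) =
      ∫ y, a y * tfShift (fun z => (starRingEnd ℂ) (φ z)) X Ξ y) (R : ℝ) :
    ∃ C : ℝ, ∀ X Ξ, ‖stft φ u X Ξ‖ ≤ C * (ω X * Real.exp (-R * ‖Ξ‖ ^ (1 / s))) := by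
  obtain ⟨C, -, H⟩ := (ha.exp_mul_stft hs hω hφ hu).2 1 R one_pos
  refine ⟨C, fun X Ξ => ?_⟩
  have := H 0 X Ξ
  rwa [norm_iteratedFDeriv_zero, norm_exp_mul_stft, pow_zero, Nat.factorial_zero, Nat.cast_one,
    Real.one_rpow, mul_one, mul_one] at this

end Stft

/-- Finite weighted mixed norms of the short-time Fourier transform yield a symbol. -/
theorem exists_symbol_of_mixedNorm {d : ℕ} {s : ℝ} (hs : 1 / 2 < s) {ω : RSpace (d + d) → ℝ}
    (hω : ω ∈ weightClass (d + d) s) {T : Submodule ℂ (RSpace (d + d) → ℂ)} {u : T →ₗ[ℂ] ℂ}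
    {φ : RSpace (d + d) → ℂ} (hφ : φ ∈ gelfandShilovSigma (d + d) s s) (hφ0 : φ ≠ 0)
    (hcont : Continuous fun p : RSpace (d + d) × RSpace (d + d) =>
      pairing u (tfShift (fun z => (starRingEnd ℂ) (φ z)) p.1 p.2))
    (hinv : ∀ f ∈ gelfandShilov (d + d) (1 / 2) (1 / 2),
      ∫ p, tfCoeff f (fun z => (starRingEnd ℂ) (φ z)) p *
        pairing u (tfShift (fun z => (starRingEnd ℂ) (φ z)) p.1 p.2) =
      inversionConst (fun z => (starRingEnd ℂ) (φ z)) * pairing u f)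
    {q : ℝ≥0∞} (hq : 1 ≤ q) (hfin : ∀ R : ℝ, 0 < R →
      mixedNorm ⊤ q (fun X Ξ => ((weightR s ω R X Ξ)⁻¹ : ℝ) * stft φ u X Ξ) < ⊤) :
    ∃ a, HasSymbolBound s ω a ∧ ∀ f ∈ gelfandShilov (d + d) (1 / 2) (1 / 2),
      ∫ x, a x * f x = pairing u f := by
  have hs0 : 0 < s := by linarith
  set ψ : RSpace (d + d) → ℂ := fun z => (starRingEnd ℂ) (φ z)
  have hψ : ψ ∈ gelfandShilovSigma (d + d) s s := conj_mem_gelfandShilovSigma hs0 hφ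
  have hψb := (mem_gelfandShilovSigma_iff hs0).1 hψ
  have hψ0 : ψ ≠ 0 := fun h => hφ0 (funext fun x => by
    have := congrFun h x
    simpa [ψ] using this)
  have hconst : inversionConst ψ ≠ 0 := by
    obtain ⟨C, hC⟩ := hψb 1 one_pos
    exact hC.inversionConst_ne_zero hs0 one_pos hψ0
  have hV : Continuous fun p : RSpace (d + d) × RSpace (d + d) => stft φ u p.1 p.2 := by
    simp_rw [stft_eq]
    exact continuous_const.mul hcont
  obtain ⟨N, hN0, hN, hVN⟩ := exists_integrable_bound_of_mixedNorm hs0 hω hV hq hfin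
  -- Normalized so that Fubini and `hinv` turn the integral of `tfSynthesis ψ B` against `f` into
  -- `pairing u f`.
  set B : RSpace (d + d) × RSpace (d + d) → ℂ := fun p =>
    (inversionConst ψ)⁻¹ * pairing u (tfShift ψ p.1 p.2)
  set κ : ℂ := (inversionConst ψ)⁻¹ * (stftConst (d + d))⁻¹
  have hB : Continuous B := continuous_const.mul hcont
  have hBV : ∀ p, B p = κ * stft φ u p.1 p.2 := fun p => by
    rw [stft_eq, mul_assoc, inv_mul_cancel_left₀ (stftConst_ne_zero _)]
  have hN' : ∀ R : ℝ, Integrable fun Ξ : RSpace (d + d) =>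
      Real.exp (R * ‖Ξ‖ ^ (1 / s)) * (‖κ‖ * N Ξ) := fun R => by
    refine ((hN R).const_mul ‖κ‖).congr (Filter.Eventually.of_forall fun Ξ => ?_)
    simp only
    ring
  have hBN : ∀ᵐ Ξ, ∀ X, ‖B (X, Ξ)‖ ≤ ω X * (‖κ‖ * N Ξ) := by
    filter_upwards [hVN] with Ξ hΞ X
    rw [hBV, norm_mul, mul_left_comm]
    gcongr
    exact hΞ X
  have hN0' : ∀ Ξ, 0 ≤ ‖κ‖ * N Ξ := fun Ξ => mul_nonneg (norm_nonneg _) (hN0 Ξ)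
  refine ⟨tfSynthesis ψ B, hasSymbolBound_tfSynthesis hs0 hω hψb hB hN0' hN' hBN, fun f hf => ?_⟩
  rw [integral_tfSynthesis_mul hs0 hω hψb ((mem_gelfandShilovSigma_iff hs0).1
    (gelfandShilov_le_sigma (by norm_num) hs hf)) hB hN0' hN' hBN]
  calc _ = ∫ p, (inversionConst ψ)⁻¹ * (tfCoeff f ψ p * pairing u (tfShift ψ p.1 p.2)) := by
        congr 1
        ext p
        ring
    _ = _ := by rw [integral_const_mul, hinv f hf, inv_mul_cancel_left₀ hconst]

/-! ### Distributions defined by symbols -/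

section Main

variable {n : ℕ} {s : ℝ} {ω : RSpace n → ℝ}

/-- The exponent `σ` of the test functions is decoupled from the order `s` of the symbol, since both
`σ = s` and `σ = 1` are needed. -/
lemma HasSymbolBound.exists_extension {σ : ℝ} (hσ : 1 / 2 < σ)
    (hω : ω ∈ weightClass n σ) {a : RSpace n → ℂ} (ha : HasSymbolBound s ω a) :
    ∃ v : GelfandShilovSigmaDual n σ σ, (∀ f ∈ gelfandShilovSigma n σ σ,
      Integrable (fun x => a x * f x) ∧ pairing v.1 f = ∫ x, a x * f x) ∧
      ∀ u : GelfandShilovDual n (1 / 2) (1 / 2), IsGivenBy u a → ExtendsTo u v := by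
  obtain ⟨A, hA, haA⟩ := ha.exists_norm_le
  obtain ⟨v, hv⟩ := exists_sigmaDual_of_weight (by linarith) hω hA ha.1.continuous haA
  refine ⟨v, hv, fun u hu f hf => ?_⟩
  have hfs := gelfandShilov_le_sigma (by norm_num) hσ hf
  exact ⟨hfs, (hv f hfs).2.trans (hu f hf).2.symm⟩

lemma ExtendsTo.isGivenBy {a : RSpace n → ℂ}
    {v : GelfandShilovSigmaDual n s s}
    (hv : ∀ f ∈ gelfandShilovSigma n s s,
      Integrable (fun x => a x * f x) ∧ pairing v.1 f = ∫ x, a x * f x)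
    {u : GelfandShilovDual n (1 / 2) (1 / 2)} (hu : ExtendsTo u v) : IsGivenBy u a := fun f hf => by
  obtain ⟨h1, h2⟩ := hu f hf
  exact ⟨(hv f h1).1, h2.symm.trans (hv f h1).2⟩

lemma HasSymbolBound.mem_symbolDistributions (hs : 1 / 2 < s) (hω : ω ∈ weightClass n s)
    {a : RSpace n → ℂ} (ha : HasSymbolBound s ω a) {u : GelfandShilovDual n (1 / 2) (1 / 2)}
    (hu : ∀ f ∈ gelfandShilov n (1 / 2) (1 / 2), ∫ x, a x * f x = pairing u.1 f) :
    u ∈ symbolDistributions s ω := by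
  have hs0 : 0 < s := by linarith
  obtain ⟨v, hv, -⟩ := ha.exists_extension hs hω
  exact ⟨a, (mem_symbolClass_iff hs0.le hω.2.1).2 ha, fun f hf =>
    ⟨(hv f (gelfandShilov_le_sigma (by norm_num) hs hf)).1, (hu f hf).symm⟩⟩

end Main

/-! ### The characterizations -/

section Characterization

variable {n : ℕ} {s : ℝ} {ω : RSpace n → ℝ} {u : GelfandShilovDual n (1 / 2) (1 / 2)}
  {φ : RSpace n → ℂ}

/-- The smoothness and decay of the modulated short-time Fourier transform of a symbol. -/
lemma modulatedStft_of_mem_symbolDistributions (hs : 1 / 2 < s) (hω : ω ∈ weightClass n s)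
    (hu : u ∈ symbolDistributions s ω) (hφ : φ ∈ gelfandShilov n (1 / 2) (1 / 2)) :
    (∀ Ξ, ContDiff ℝ (⊤ : ℕ∞) (modulatedStft φ u Ξ)) ∧
    ∀ ε R : ℝ, 0 < ε → ∃ C : ℝ, 0 ≤ C ∧ ∀ k X Ξ, ‖iteratedFDeriv ℝ k (modulatedStft φ u Ξ) X‖ ≤
      C * (ω X * Real.exp (-R * ‖Ξ‖ ^ (1 / s))) * (ε ^ k * (k.factorial : ℝ) ^ s) := by
  have hs0 : 0 < s := by linarith
  obtain ⟨a, ha, hua⟩ := hu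
  rw [mem_symbolClass_iff hs0.le hω.2.1] at ha
  exact ha.exp_mul_stft hs0 hω (gelfandShilov_le_sigma (by norm_num) hs hφ) fun X Ξ =>
    (hua _ (tfShift_mem_gelfandShilov (by norm_num) (conj_mem_gelfandShilov (by norm_num) hφ)
      X Ξ)).2

lemma norm_stft_le_of_mem_symbolDistributions (hs : 1 / 2 < s) (hω : ω ∈ weightClass n s)
    (hu : u ∈ symbolDistributions s ω) (hφ : φ ∈ gelfandShilov n (1 / 2) (1 / 2)) (R : ℝ) :
    ∃ C : ℝ, ∀ X Ξ, ‖stft φ u.1 X Ξ‖ ≤ C * (ω X * Real.exp (-R * ‖Ξ‖ ^ (1 / s))) := by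
  have hs0 : 0 < s := by linarith
  obtain ⟨a, ha, hua⟩ := hu
  rw [mem_symbolClass_iff hs0.le hω.2.1] at ha
  exact ha.norm_stft_le hs0 hω (gelfandShilov_le_sigma (by norm_num) hs hφ) (fun X Ξ =>
    (hua _ (tfShift_mem_gelfandShilov (by norm_num) (conj_mem_gelfandShilov (by norm_num) hφ)
      X Ξ)).2) R

end Characterization

section Doubled

variable {d : ℕ} {s : ℝ} {ω : RSpace (d + d) → ℝ}

lemma symbolDistributions_eq_of_mem_gelfandShilov (hs : 1 / 2 < s)
    (hω : ω ∈ weightClass (d + d) s) {q : ℝ≥0∞} (hq : 1 ≤ q) {φ : RSpace (d + d) → ℂ}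
    (hφ : φ ∈ gelfandShilov (d + d) (1 / 2) (1 / 2)) (hφ0 : φ ≠ 0) :
    symbolDistributions s ω = ⋂ R > (0 : ℝ), {u |
      mixedNorm ⊤ q (fun X Ξ => ((weightR s ω R X Ξ)⁻¹ : ℝ) * stft φ u.1 X Ξ) < ⊤} := by
  ext u
  simp only [Set.mem_iInter]
  refine ⟨fun hu R hR => ?_, fun hu => ?_⟩
  · exact mixedNorm_weightR_lt_top (by linarith) hω.2.1
      (fun R _ => norm_stft_le_of_mem_symbolDistributions hs hω hu hφ R) hq hR
  · have hψ := conj_mem_gelfandShilov (by norm_num) hφ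
    obtain ⟨a, ha, hau⟩ := exists_symbol_of_mixedNorm hs hω
      (gelfandShilov_le_sigma (by norm_num) hs hφ) hφ0 (u.inversion (by norm_num) hψ hψ).1
      (fun f hf => (u.inversion (by norm_num) hf hψ).2) hq hu
    exact ha.mem_symbolDistributions hs hω hau

lemma symbolDistributions_eq_of_mem_gelfandShilovSigma (hs : 1 / 2 < s)
    (hω : ω ∈ weightClass (d + d) s) {q : ℝ≥0∞} (hq : 1 ≤ q) {φ : RSpace (d + d) → ℂ}
    (hφ : φ ∈ gelfandShilovSigma (d + d) s s) (hφ0 : φ ≠ 0) :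
    symbolDistributions s ω =
      ⋂ R > (0 : ℝ), {u | ∃ v : GelfandShilovSigmaDual (d + d) s s, ExtendsTo u v ∧
        mixedNorm ⊤ q (fun X Ξ => ((weightR s ω R X Ξ)⁻¹ : ℝ) * stft φ v.1 X Ξ) < ⊤} := by
  have hs0 : 0 < s := by linarith
  have hψ := conj_mem_gelfandShilovSigma hs0 hφ
  ext u
  simp only [Set.mem_iInter]
  refine ⟨?_, fun hu => ?_⟩
  · rintro ⟨a, ha, hua⟩ R hR
    rw [mem_symbolClass_iff hs0.le hω.2.1] at ha
    obtain ⟨v, hv, huv⟩ := ha.exists_extension hs hω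
    exact ⟨v, huv u hua, mixedNorm_weightR_lt_top hs0 hω.2.1 (fun R _ =>
      ha.norm_stft_le hs0 hω hφ (fun X Ξ =>
        (hv _ (tfShift_mem_gelfandShilovSigma hs0 hψ X Ξ)).2) R) hq hR⟩
  -- The extension could depend on `R`; the one for `R = 1` serves all `R` because extensions are
  -- unique.
  · obtain ⟨v, huv, -⟩ := hu 1 one_pos
    have hfin : ∀ R : ℝ, 0 < R →
        mixedNorm ⊤ q (fun X Ξ => ((weightR s ω R X Ξ)⁻¹ : ℝ) * stft φ v.1 X Ξ) < ⊤ := by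
      intro R hR
      obtain ⟨w, huw, hw⟩ := hu R hR
      have h1 : ∀ X Ξ, stft φ v.1 X Ξ = stft φ w.1 X Ξ := fun X Ξ => by
        rw [stft, stft, huv.pairing_eq hs huw]
      simpa only [h1] using hw
    obtain ⟨a, ha, hau⟩ := exists_symbol_of_mixedNorm hs hω hφ hφ0 (v.inversion hs0 hψ hψ).1
      (fun f hf => (v.inversion hs0 (gelfandShilov_le_sigma (by norm_num) hs hf) hψ).2) hq hfin
    exact ha.mem_symbolDistributions hs hω fun f hf => (hau f hf).trans (huv f hf).2

lemma symbolDistributions_eq_modulationSpace (hs : 1 / 2 < s) (hω : ω ∈ weightClass (d + d) s)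
    {q : ℝ≥0∞} (hq : 1 ≤ q) : symbolDistributions s ω =
      ⋂ R > (0 : ℝ), modulationSpace (d + d) ⊤ q (fun X Ξ => 1 / weightR s ω R X Ξ) := by
  have hG := isGaussianFun_standardGaussian (d + d)
  rw [symbolDistributions_eq_of_mem_gelfandShilov hs hω hq hG.mem_gelfandShilov hG.ne_zero]
  simp only [modulationSpace, one_div, mul_comm]

lemma exists_extension_one_of_mem_symbolDistributions (hs : 1 / 2 < s)
    (hω : ω ∈ weightClass (d + d) s) {u : GelfandShilovDual (d + d) (1 / 2) (1 / 2)}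
    (hu : u ∈ symbolDistributions s ω) :
    ∃ v : GelfandShilovSigmaDual (d + d) 1 1, ExtendsTo u v := by
  have hs0 : 0 < s := by linarith
  obtain ⟨a, ha, hua⟩ := hu
  obtain ⟨v, -, hv⟩ := ((mem_symbolClass_iff hs0.le hω.2.1).1 ha).exists_extension
    (by norm_num) (weightClass_one hs0 hω)
  exact ⟨v, hv u hua⟩

/-- The modulating factor is unimodular, so the hypothesis bounds the transform itself and the
characterization with `q = ∞` applies. -/
lemma mem_symbolDistributions_of_norm_modulatedStft_le (hs : 1 / 2 < s)
    (hω : ω ∈ weightClass (d + d) s) {φ : RSpace (d + d) → ℂ} (hφ : IsGaussianFun φ)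
    {u : GelfandShilovDual (d + d) (1 / 2) (1 / 2)}
    (hu : ∀ R : ℝ, 0 < R → ∃ C : ℝ, ∀ X Ξ : RSpace (d + d),
      ‖modulatedStft φ u Ξ X‖ ≤ C * (ω X * Real.exp (-R * ‖Ξ‖ ^ (1 / s)))) :
    u ∈ symbolDistributions s ω := by
  rw [symbolDistributions_eq_of_mem_gelfandShilov hs hω le_top hφ.mem_gelfandShilov hφ.ne_zero]
  simp only [Set.mem_iInter]
  refine fun R hR => mixedNorm_weightR_lt_top (by linarith) hω.2.1 (fun R hR => ?_) le_top hR
  obtain ⟨C, hC⟩ := hu R hR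
  refine ⟨C, fun X Ξ => ?_⟩
  rw [← norm_exp_mul_stft]
  exact hC X Ξ

end Doubled

end

theorem mainTheorem9 (d : ℕ) (s : ℝ) (hs : 1 / 2 < s) (ω : RSpace (d + d) → ℝ)
    (hω : ω ∈ weightClass (d + d) s) :
    -- every function in the symbol class is a distribution
    (∀ a ∈ symbolClass s ω, ∃ u : GelfandShilovDual (d + d) (1 / 2) (1 / 2), IsGivenBy u a) ∧
    -- characterization through the short-time Fourier transform with a Gaussian window
    (∀ φ : RSpace (d + d) → ℂ, IsGaussianFun φ →
      ∀ u : GelfandShilovDual (d + d) (1 / 2) (1 / 2),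
        List.TFAE [
          u ∈ symbolDistributions s ω,
          (∃ v : GelfandShilovSigmaDual (d + d) 1 1, ExtendsTo u v) ∧
            (∀ Ξ : RSpace (d + d), ContDiff ℝ (⊤ : ℕ∞) (modulatedStft φ u Ξ)) ∧
            ∀ ε R : ℝ, 0 < ε → 0 < R → ∃ C : ℝ,
              ∀ (α : Fin (d + d) → ℕ) (X Ξ : RSpace (d + d)),
                ‖partialD α (modulatedStft φ u Ξ) X‖ ≤
                  C * (ω X * ε ^ multiOrder α * multiFactorial α ^ s *
                    Real.exp (-R * ‖Ξ‖ ^ (1 / s))),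
          (∃ v : GelfandShilovSigmaDual (d + d) 1 1, ExtendsTo u v) ∧
            ∀ R : ℝ, 0 < R → ∃ C : ℝ, ∀ X Ξ : RSpace (d + d),
              ‖modulatedStft φ u Ξ X‖ ≤ C * (ω X * Real.exp (-R * ‖Ξ‖ ^ (1 / s)))]) ∧
    -- the symbol class as an intersection of modulation spaces
    symbolDistributions s ω =
      ⋂ R > (0 : ℝ), modulationSpace (d + d) ⊤ ⊤ (fun X Ξ => 1 / weightR s ω R X Ξ) ∧
    symbolDistributions s ω =
      ⋂ R > (0 : ℝ), modulationSpace (d + d) ⊤ 1 (fun X Ξ => 1 / weightR s ω R X Ξ) ∧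
    -- the symbol class through mixed norms, for general windows
    (∀ q : ℝ≥0∞, 1 ≤ q →
      (∀ φ ∈ gelfandShilovSigma (d + d) s s, φ ≠ 0 →
        symbolDistributions s ω =
          ⋂ R > (0 : ℝ), {u | ∃ v : GelfandShilovSigmaDual (d + d) s s, ExtendsTo u v ∧
            mixedNorm ⊤ q (fun X Ξ => ((weightR s ω R X Ξ)⁻¹ : ℝ) * stft φ v.1 X Ξ) < ⊤}) ∧
      (∀ φ ∈ gelfandShilov (d + d) (1 / 2) (1 / 2), φ ≠ 0 →
        symbolDistributions s ω =
          ⋂ R > (0 : ℝ), {u |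
            mixedNorm ⊤ q (fun X Ξ => ((weightR s ω R X Ξ)⁻¹ : ℝ) * stft φ u.1 X Ξ) < ⊤})) := by
  have hs0 : 0 < s := by linarith
  have hpos := hω.2.1
  refine ⟨fun a ha => ?_, fun φ hφ u => ?_, symbolDistributions_eq_modulationSpace hs hω le_top,
    symbolDistributions_eq_modulationSpace hs hω le_rfl, fun q hq =>
    ⟨fun φ hφ hφ0 => symbolDistributions_eq_of_mem_gelfandShilovSigma hs hω hq hφ hφ0,
      fun φ hφ hφ0 => symbolDistributions_eq_of_mem_gelfandShilov hs hω hq hφ hφ0⟩⟩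
  · obtain ⟨v, hv, -⟩ := ((mem_symbolClass_iff hs0.le hpos).1 ha).exists_extension hs hω
    obtain ⟨u, hu⟩ := exists_restriction hs v
    exact ⟨u, hu.isGivenBy hv⟩
  · tfae_have 1 → 2 := by
      intro hu
      obtain ⟨h1, h2⟩ := modulatedStft_of_mem_symbolDistributions hs hω hu hφ.mem_gelfandShilov
      refine ⟨exists_extension_one_of_mem_symbolDistributions hs hω hu, h1, fun ε R hε _ => ?_⟩
      -- The division of `ε` pays for replacing `|α|!` by `α!`.
      obtain ⟨C, hC, H⟩ := h2 (ε / (2 ^ (d + d)) ^ s) R (by positivity)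
      refine ⟨C, fun α X Ξ => ?_⟩
      have hX := hpos X
      refine (norm_partialD_le_of_iteratedFDeriv_le hs0.le (by positivity) (by positivity) α
        (H (multiOrder α) X Ξ)).trans_eq ?_
      rw [mul_div_cancel₀ _ (by positivity)]
      ring
    tfae_have 2 → 3 := by
      rintro ⟨h1, h2, h3⟩
      refine ⟨h1, fun R hR => ?_⟩
      -- The value of `ε` is irrelevant, since only the derivative of order zero is used in the end.
      obtain ⟨C, hC⟩ := h3 1 R one_pos hR
      refine ⟨max C 0, fun X Ξ => ?_⟩
      have hX := hpos X
      have h4 := norm_iteratedFDeriv_le_of_forall_partialD (s := s) (ε := 1)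
        (A := max C 0 * (ω X * Real.exp (-R * ‖Ξ‖ ^ (1 / s)))) hs0.le zero_le_one (by positivity)
        (h2 Ξ) (x := X) (fun α => (hC α X Ξ).trans ?_) 0
      · simpa using h4
      · have h5 := (multiFactorial_pos α).le
        have h6 : C ≤ max C 0 := le_max_left _ _
        calc _ ≤ max C 0 * (ω X * 1 ^ multiOrder α * multiFactorial α ^ s *
              Real.exp (-R * ‖Ξ‖ ^ (1 / s))) := by gcongr
          _ = _ := by ring
    tfae_have 3 → 1 := fun h => mem_symbolDistributions_of_norm_modulatedStft_le hs hω hφ h.2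
    tfae_finish
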